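/- A \emph{standard multigraph} is a finite loopless multigraph in which any two vertices $x,y$ are joined by $\mu(xy)\le 2$ edges; the pair $xy$ is a \emph{light} edge if $\mu(xy)=1$ and a \emph{heavy} edge if $\mu(xy)=2$. Let $e(G)$ be the number of edges of $G$ counted with multiplicity, $e_2(G)$ the number of heavy edges of $G$, and $\delta(G)$ the minimum degree of $G$, where degrees are counted with multiplicity. For $r\in\mathbb N$ and $\gamma>0$, a standard multigraph $G$ on $n$ vertices is \emph{$(1/r,\gamma)$-extremal} if there is a set $S\subseteq V(G)$ such that either $\big||S|-n/r\big|<\gamma n$ and $e(G[S])<\gamma n^2$, or $\big||S|-2n/r\big|<\gamma n$ and $e_2(G[S])<\gamma n^2$. Let $\mathcal K'_r$ be the family of all standard multigraphs on $r$ vertices obtained from the complete standard multigraph (in which all pairs of vertices are heavy edges) by removing one copy of each edge of vertex-disjoint paths $P_1,\dots,P_t$ with $|P_1|\ge\dots\ge|P_t|$, where $|P_i|$ denotes the number of vertices of $P_i$ and either $|P_1|\le 4$ and $|P_i|\le 2$ for all $i\ge 2$, or $|P_1|,|P_2|\le 3$ and $|P_i|\le 2$ for all $i\ge 3$. A \emph{$\mathcal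 K'_r$-tiling} in $G$ is a collection of vertex-disjoint (not necessarily induced) subgraphs of $G$, each isomorphic to an element of $\mathcal K'_r$. \textbf{Theorem.} There are increasing functions $f_1,f_2,f_3,f_4:(0,\infty)\to(0,\infty)$ such that the following holds for all integers $n\ge 1$, $r\ge 2$ and all reals $\alpha,\eta,\gamma>0$ with $$\frac1n\le f_4(\alpha),\qquad \alpha\le f_3(\eta),\qquad \eta\le f_2(\gamma),\qquad \gamma\le f_1(1/r)$$ (that is, $0<1/n\ll\alpha\ll\eta\ll\gamma\ll 1/r$). Let $G$ be a standard multigraph on $n$ vertices. If $G$ is not $(1/r,\gamma)$-extremal and $$\delta(G)\ge 2\left(1-\frac1r-\eta\right)n,$$ then $G$ contains a $\mathcal K'_r$-tiling covering all but at most $\alpha n$ vertices. -/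

import Mathlib

/-- A standard multigraph: no loops, and at most two (parallel) edges between any two vertices.
`G.mult x y` is the number of edges between `x` and `y`. -/
@[ext]
structure StdMultigraph (V : Type*) where
  mult : V → V → ℕ
  symm : ∀ x y, mult x y = mult y x
  loopless : ∀ x, mult x x = 0
  le_two : ∀ x y, mult x y ≤ 2

namespace StdMultigraph

variable {V W : Type*}

/-- The simple graph of light edges (pairs of multiplicity one). -/
def lightGraph (G : StdMultigraph V) : SimpleGraph V where
  Adj x y := G.mult x y = 1
  symm := ⟨fun x y h => by rw [G.symm]; exact h⟩
  loopless := ⟨fun x h => by simp [G.loopless] at h⟩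

/-- The simple graph of heavy edges (pairs of multiplicity two). -/
def heavyGraph (G : StdMultigraph V) : SimpleGraph V where
  Adj x y := G.mult x y = 2
  symm := ⟨fun x y h => by rw [G.symm]; exact h⟩
  loopless := ⟨fun x h => by simp [G.loopless] at h⟩

/-- The number `e₂(G)` of heavy edges (a heavy edge is a pair of vertices). -/
noncomputable def numHeavy (G : StdMultigraph V) : ℕ := G.heavyGraph.edgeSet.ncard

/-- The total number `e(G)` of edges, counted with multiplicity. -/
noncomputable def numEdges (G : StdMultigraph V) : ℕ :=
  G.lightGraph.edgeSet.ncard + 2 * G.numHeavy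

/-- The submultigraph `G[S]` induced by `S`. -/
def induce (G : StdMultigraph V) (S : Finset V) : StdMultigraph S where
  mult x y := G.mult x y
  symm x y := G.symm x y
  loopless x := G.loopless x
  le_two x y := G.le_two x y

/-- The degree of a vertex, counted with multiplicity. -/
def degree [Fintype V] (G : StdMultigraph V) (v : V) : ℕ := ∑ u, G.mult v u

/-- The minimum degree `δ(G)` (used for nonempty vertex sets). -/
noncomputable def minDegree [Fintype V] (G : StdMultigraph V) : ℕ := ⨅ v, G.degree v

/-- `G` is `(1/r, γ)`-extremal. -/
def IsExtremal [Fintype V] (G : StdMultigraph V) (r : ℕ) (γ : ℝ) : Prop :=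
  (∃ S : Finset V,
    |(S.card : ℝ) - (Fintype.card V : ℝ) / r| < γ * (Fintype.card V : ℝ) ∧
    ((G.induce S).numEdges : ℝ) < γ * (Fintype.card V : ℝ) ^ 2) ∨
  (∃ S : Finset V,
    |(S.card : ℝ) - 2 * (Fintype.card V : ℝ) / r| < γ * (Fintype.card V : ℝ) ∧
    ((G.induce S).numHeavy : ℝ) < γ * (Fintype.card V : ℝ) ^ 2)

/-- `x` and `y` are consecutive, in either order, on the path whose vertices are listed by `p`. -/
def IsPathEdge (p : List V) (x y : V) : Prop := [x, y] <:+: p ∨ [y, x] <:+: p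

open Classical in
/-- The family `𝒦'_r`: the standard multigraphs on `r` vertices obtained from the complete standard
multigraph (all multiplicities two) by removing one copy of every edge of vertex-disjoint
paths `P₁, …, P_t` with `|P₁| ≥ ⋯ ≥ |P_t|`, where either `|P₁| ≤ 4` and all other `|P_i| ≤ 2`, or
`|P₁|, |P₂| ≤ 3` and all other `|P_i| ≤ 2`; here `|P|` is the number of vertices. A path in the
complete graph is a nonempty list of distinct vertices, and `Ps[i]` is `P_{i+1}`. -/
def KPrime (r : ℕ) : Set (StdMultigraph (Fin r)) :=
  {K | ∃ Ps : List (List (Fin r)),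
    (∀ p ∈ Ps, p ≠ []) ∧
    Ps.flatten.Nodup ∧
    Ps.Pairwise (fun p q => q.length ≤ p.length) ∧
    ((∀ (i : ℕ) (h : i < Ps.length), Ps[i].length ≤ if i = 0 then 4 else 2) ∨
      (∀ (i : ℕ) (h : i < Ps.length), Ps[i].length ≤ if i < 2 then 3 else 2)) ∧
    ∀ x y, x ≠ y → K.mult x y = if ∃ p ∈ Ps, IsPathEdge p x y then 1 else 2}

/-- A copy of `H` in `G`: a (not necessarily induced) subgraph of `G` isomorphic to `H`, given by
an injection of the vertices that does not decrease multiplicities in `G`. -/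
structure Copy (H : StdMultigraph W) (G : StdMultigraph V) where
  toEmbedding : W ↪ V
  mult_le : ∀ x y, H.mult x y ≤ G.mult (toEmbedding x) (toEmbedding y)

/-- The vertices of `G` used by a copy. -/
def Copy.verts {H : StdMultigraph W} {G : StdMultigraph V} (c : Copy H G) : Set V :=
  Set.range c.toEmbedding

/-- An `X`-tiling in `G`: a finite collection of vertex-disjoint copies of elements of `X`. -/
structure Tiling (X : Set (StdMultigraph W)) (G : StdMultigraph V) where
  size : ℕ
  tile : Fin size → StdMultigraph W
  tile_mem : ∀ i, tile i ∈ X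
  copy : ∀ i, Copy (tile i) G
  disjoint : ∀ i j, i ≠ j → Disjoint (copy i).verts (copy j).verts

/-- The set of vertices covered by a tiling. -/
def Tiling.covered {X : Set (StdMultigraph W)} {G : StdMultigraph V} (T : Tiling X G) : Set V :=
  ⋃ i, (T.copy i).verts

end StdMultigraph

/-- The functions that quantify a hierarchy `a ≪ b` (meaning `a ≤ f b`): positive and increasing
on the positive reals. -/
def IsHierarchyFunction (f : ℝ → ℝ) : Prop :=
  StrictMonoOn f (Set.Ioi 0) ∧ ∀ x, 0 < x → 0 < f x

/-! The proof transfers the problem to a weighted reduced multigraph by regularity, finds there a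
perfect fractional tiling by linear programming duality, and rounds it back to a tiling of `G`.

Only one family of tiles is used: sets of `r` pairwise adjacent vertices whose light edges form a
matching, apart from at most one path on three or four vertices ("near matched" sets; "matched" if
no such path is needed). By `mem_KPrime_of_isNearMatched` these give members of `KPrime r`.

The basic exchange is this. If a vertex misses at most one edge to a matched set, then either it can
be added, or it can replace its light neighbour there and destroy a light edge. Thus every vertex
misses at least two edges to an optimal matched set, while the degree condition bounds what the
vertices of that set can miss altogether. Double counting then forces the set to be large. Applied
to the vertices left uncovered by an optimal fractional tiling, the same argument shows that matched
sets of size `r` cover almost everything (`exists_matched_fractional_tiling`).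

To cover everything, near matched tiles are allowed at a small penalty `κ`, and a dual solution `w`
is considered. An uncovered vertex has dual weight zero. The vertices whose dual weight lies below a
threshold then form a set `A` which has no near matched subset of more than some `s ≥ 1` vertices
but has weight almost `s / r` (`IsOptimalTiling.le_sum_small`, with the threshold chosen by
pigeonhole). By `exists_extremal_of_stability` such a set yields an independent set of weight near
`1 / r` or a set without heavy edges of weight near `2 / r`. Both are excluded, since `G` is not
extremal. Hence no vertex is uncovered (`exists_near_matched_fractional_tiling`).

Regularity is needed only in a one-sided form: between most dense pairs, large subsets keep half of
the threshold density. This suffices for greedy embedding. `exists_almost_perfect_tiling` assembles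
the parts, and the final theorem encodes the order of the quantifiers in increasing functions. -/

open Finset
set_option linter.unusedSectionVars false

/-! ### Energy of a partition and its increments -/

section CellMean

variable {X K K' : Type*} [Fintype X] [DecidableEq K] [DecidableEq K']

/-- The mean of `F` on the cell `c = k`. -/
noncomputable def cellMean (F : X → ℝ) (c : X → K) (k : K) : ℝ :=
  (∑ y with c y = k, F y) / (#{y | c y = k} : ℝ)

/-- The energy of the partition into the cells of `c`. -/
noncomputable def energy (F : X → ℝ) (c : X → K) : ℝ := ∑ x, cellMean F c (c x) ^ 2

theorem card_mul_cellMean (F : X → ℝ) (c : X → K) (k : K) :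
    (#{y | c y = k} : ℝ) * cellMean F c k = ∑ y with c y = k, F y := by
  unfold cellMean
  rcases eq_or_ne (#{y | c y = k}) 0 with h | h
  · rw [Finset.card_eq_zero] at h
    simp [h]
  · field_simp

theorem sum_cellMean_mul [Fintype K] (F : X → ℝ) (c : X → K) (h : K → ℝ) :
    ∑ x, cellMean F c (c x) * h (c x) = ∑ x, F x * h (c x) := by
  rw [← Finset.sum_fiberwise univ c (fun x => cellMean F c (c x) * h (c x)),
    ← Finset.sum_fiberwise univ c (fun x => F x * h (c x))]
  refine Finset.sum_congr rfl fun k _ => ?_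
  have h1 : ∑ x with c x = k, cellMean F c (c x) * h (c x)
      = ∑ x with c x = k, cellMean F c k * h k :=
    Finset.sum_congr rfl fun x hx => by rw [(Finset.mem_filter.1 hx).2]
  have h2 : ∑ x with c x = k, F x * h (c x) = ∑ x with c x = k, F x * h k :=
    Finset.sum_congr rfl fun x hx => by rw [(Finset.mem_filter.1 hx).2]
  rw [h1, h2, Finset.sum_const, ← Finset.sum_mul, ← card_mul_cellMean, nsmul_eq_mul]
  ring

theorem cellMean_nonneg {F : X → ℝ} (h0 : ∀ x, 0 ≤ F x) (c : X → K) (k : K) :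
    0 ≤ cellMean F c k :=
  div_nonneg (Finset.sum_nonneg fun x _ => h0 x) (Nat.cast_nonneg _)

theorem cellMean_le_one {F : X → ℝ} (h1 : ∀ x, F x ≤ 1) (c : X → K) (k : K) :
    cellMean F c k ≤ 1 := by
  refine div_le_one_of_le₀ ?_ (Nat.cast_nonneg _)
  refine (Finset.sum_le_sum fun x _ => h1 x).trans ?_
  simp

theorem energy_le {F : X → ℝ} (h0 : ∀ x, 0 ≤ F x) (h1 : ∀ x, F x ≤ 1) (c : X → K) :
    energy F c ≤ Fintype.card X := by
  have : ∀ x ∈ (univ : Finset X), cellMean F c (c x) ^ 2 ≤ 1 := fun x _ =>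
    pow_le_one₀ (cellMean_nonneg h0 c _) (cellMean_le_one h1 c _)
  refine (Finset.sum_le_sum this).trans ?_
  simp

theorem energy_nonneg (F : X → ℝ) (c : X → K) : 0 ≤ energy F c :=
  Finset.sum_nonneg fun _ _ => sq_nonneg _

/-- Pythagoras: the coarser cell means are the orthogonal projection of the finer ones onto
functions constant on coarse cells. -/
theorem energy_refine [Fintype K] [Fintype K'] (F : X → ℝ) {c : X → K} {c' : X → K'} {π : K' → K}
    (hπ : ∀ x, c x = π (c' x)) :
    energy F c + ∑ x, (cellMean F c' (c' x) - cellMean F c (c x)) ^ 2 = energy F c' := by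
  have h1 := sum_cellMean_mul F c (fun k => cellMean F c k)
  have h2 := sum_cellMean_mul F c' (fun k => cellMean F c (π k))
  simp only [← hπ] at h2
  have h3 : ∑ x, (cellMean F c' (c' x) - cellMean F c (c x)) ^ 2
      = energy F c' - 2 * ∑ x, cellMean F c' (c' x) * cellMean F c (c x) + energy F c := by
    unfold energy
    rw [Finset.mul_sum, ← Finset.sum_sub_distrib, ← Finset.sum_add_distrib]
    exact Finset.sum_congr rfl fun x _ => by ring
  have h4 : energy F c = ∑ x, cellMean F c (c x) * cellMean F c (c x) :=
    Finset.sum_congr rfl fun x _ => by ring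
  rw [h3, h2, ← h1, ← h4]
  ring

/-- Each `P k` is a union of fine cells inside the coarse cell `k`, and the average of `F` over it
is lower by `t` than over the cell. The fine and coarse means therefore differ by at least `t` on
average over `P k`, and Cauchy–Schwarz turns this into a gain of `t ^ 2` per point in
`energy_refine`. -/
theorem energy_increment [Fintype K] [Fintype K'] (F : X → ℝ) {c : X → K} {c' : X → K'} {π : K' → K}
    (hπ : ∀ x, c x = π (c' x)) (B : Finset K) (P : K → Finset X) (Q : K → K' → Prop) {t : ℝ}
    (ht : 0 ≤ t) (hP : ∀ k ∈ B, ∀ x ∈ P k, c x = k) (hQ : ∀ k ∈ B, ∀ x, x ∈ P k ↔ Q k (c' x))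
    (hF : ∀ k ∈ B, ∑ x ∈ P k, F x ≤ (cellMean F c k - t) * #(P k)) :
    energy F c + t ^ 2 * ∑ k ∈ B, (#(P k) : ℝ) ≤ energy F c' := by
  classical
  rw [← energy_refine F hπ]
  gcongr
  set g : X → ℝ := fun x => cellMean F c' (c' x) - cellMean F c (c x) with hg
  have key : ∀ k ∈ B, t ^ 2 * (#(P k) : ℝ) ≤ ∑ x ∈ P k, g x ^ 2 := by
    intro k hk
    have h1 : ∑ x ∈ P k, cellMean F c' (c' x) = ∑ x ∈ P k, F x := by
      have := sum_cellMean_mul F c' (fun l => if Q k l then 1 else 0)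
      simp only [mul_ite, mul_one, mul_zero, ← hQ k hk] at this
      simpa [Finset.sum_ite_mem] using this
    have h2 : ∑ x ∈ P k, cellMean F c (c x) = #(P k) * cellMean F c k := by
      rw [Finset.sum_congr rfl fun x hx => by rw [hP k hk x hx]]
      simp
    have h3 : ∑ x ∈ P k, g x ≤ -(t * #(P k)) := by
      simp only [hg, Finset.sum_sub_distrib, h1, h2]
      linarith [hF k hk]
    have h4 : (∑ x ∈ P k, g x) ^ 2 ≤ #(P k) * ∑ x ∈ P k, g x ^ 2 := sq_sum_le_card_mul_sum_sq
    rcases eq_or_ne (#(P k)) 0 with h | h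
    · rw [h]
      simp only [Nat.cast_zero, mul_zero]
      exact Finset.sum_nonneg fun _ _ => sq_nonneg _
    · have hpos : (0 : ℝ) < #(P k) := by positivity
      have h5 : (t * #(P k)) ^ 2 ≤ (∑ x ∈ P k, g x) ^ 2 := by
        rw [← neg_sq (∑ x ∈ P k, g x)]
        exact pow_le_pow_left₀ (by positivity) (by linarith) 2
      have h6 : #(P k) * (t ^ 2 * #(P k)) ≤ #(P k) * ∑ x ∈ P k, g x ^ 2 := by
        calc _ = (t * #(P k)) ^ 2 := by ring
          _ ≤ _ := h5.trans h4
      exact le_of_mul_le_mul_left h6 hpos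
  have hdisj : (B : Set K).PairwiseDisjoint P := by
    intro k hk l hl hkl
    rw [Function.onFun, Finset.disjoint_left]
    intro x hx hx'
    exact hkl ((hP k hk x hx).symm.trans (hP l hl x hx'))
  rw [Finset.mul_sum]
  calc ∑ k ∈ B, t ^ 2 * (#(P k) : ℝ) ≤ ∑ k ∈ B, ∑ x ∈ P k, g x ^ 2 := Finset.sum_le_sum key
    _ = ∑ x ∈ B.biUnion P, g x ^ 2 := (Finset.sum_biUnion hdisj).symm
    _ ≤ ∑ x, g x ^ 2 :=
      Finset.sum_le_sum_of_subset_of_nonneg (Finset.subset_univ _) fun _ _ _ => sq_nonneg _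

end CellMean

namespace StdMultigraph

/-! ### One-sided regularity lemma for both multiplicities -/

section Regularity

/-- The number of pairs in `A × B` of multiplicity at least `k`. -/
def pairCount {V : Type*} (G : StdMultigraph V) (k : ℕ) (A B : Finset V) : ℕ :=
  #{e ∈ A ×ˢ B | k ≤ G.mult e.1 e.2}

/-- The class of the partition `f` with index `i`. -/
def cls {V C : Type*} [Fintype V] [DecidableEq C] (f : V → C) (i : C) : Finset V := {v | f v = i}

variable {V C : Type*} [Fintype V] [DecidableEq C]

@[simp] theorem mem_cls {f : V → C} {i : C} {v : V} : v ∈ cls f i ↔ f v = i := by simp [cls]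

/-- The pair `(i, j)` of classes is dense in multiplicity `k`, but it has large subsets with
less than half of that density. -/
def IsBad (G : StdMultigraph V) (f : V → C) (d ε : ℝ) (k : ℕ) (i j : C) : Prop :=
  d * (#(cls f i) * #(cls f j)) ≤ G.pairCount k (cls f i) (cls f j) ∧
  ∃ A B : Finset V, A ⊆ cls f i ∧ B ⊆ cls f j ∧ ε * #(cls f i) ≤ #A ∧ ε * #(cls f j) ≤ #B ∧
    (G.pairCount k A B : ℝ) < d / 2 * (#A * #B)

open Classical in
/-- The number of pairs of vertices that lie in bad pairs of classes. -/
noncomputable def badWeight [Fintype C] (G : StdMultigraph V) (f : V → C) (d ε : ℝ) (k : ℕ) : ℝ :=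
  ∑ e : C × C with G.IsBad f d ε k e.1 e.2, (#(cls f e.1) * #(cls f e.2) : ℝ)

/-- The energy of the partition `f` with respect to the pairs of multiplicity at least `k`. -/
noncomputable def partEnergy (G : StdMultigraph V) (f : V → C) (k : ℕ) : ℝ :=
  energy (fun e : V × V => if k ≤ G.mult e.1 e.2 then (1 : ℝ) else 0)
    (fun e : V × V => (f e.1, f e.2))

theorem partEnergy_le (G : StdMultigraph V) (f : V → C) (k : ℕ) :
    G.partEnergy f k ≤ (Fintype.card V : ℝ) ^ 2 := by
  refine (energy_le (fun x => ?_) (fun x => ?_) _).trans ?_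
  · split_ifs <;> norm_num
  · split_ifs <;> norm_num
  · simp [sq]

theorem partEnergy_nonneg (G : StdMultigraph V) (f : V → C) (k : ℕ) : 0 ≤ G.partEnergy f k :=
  energy_nonneg _ _

theorem partEnergy_mono [Fintype C] {C' : Type*} [Fintype C'] [DecidableEq C']
    (G : StdMultigraph V) {f : V → C} {f' : V → C'} {π : C' → C} (h : ∀ v, f v = π (f' v))
    (k : ℕ) : G.partEnergy f k ≤ G.partEnergy f' k := by
  unfold partEnergy
  rw [← energy_refine (c := fun e : V × V => (f e.1, f e.2))
    (c' := fun e : V × V => (f' e.1, f' e.2)) (π := fun e => (π e.1, π e.2)) _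
    (fun x => by simp [h])]
  exact le_add_of_nonneg_right (Finset.sum_nonneg fun _ _ => sq_nonneg _)

/-- Each vertex records its membership of all witness sets of bad pairs. A bad pair has mean at
least `d` and its witness rectangle less than `d / 2`, so the energy increment applies with `t = d /
2`. The rectangle holds a share `ε ^ 2` of the pair, and the third factor `ε` comes from the total
weight of bad pairs. -/
theorem exists_refinement [Fintype C] (G : StdMultigraph V) (f : V → C) {d ε : ℝ} (hd : 0 < d)
    (hε : 0 < ε) (k : ℕ) (hbad : ε * (Fintype.card V : ℝ) ^ 2 < G.badWeight f d ε k) :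
    ∃ f' : V → C × (C → C → Bool × Bool), (∀ v, f v = (f' v).1) ∧
      G.partEnergy f k + (d / 2) ^ 2 * ε ^ 3 * (Fintype.card V : ℝ) ^ 2 ≤ G.partEnergy f' k := by
  classical
  have hex : ∀ i j, ∃ A B : Finset V, G.IsBad f d ε k i j →
      A ⊆ cls f i ∧ B ⊆ cls f j ∧ ε * #(cls f i) ≤ #A ∧ ε * #(cls f j) ≤ #B ∧
    (G.pairCount k A B : ℝ) < d / 2 * (#A * #B) := by
    intro i j
    by_cases h : G.IsBad f d ε k i j
    · obtain ⟨A, B, hAB⟩ := h.2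
      exact ⟨A, B, fun _ => hAB⟩
    · exact ⟨∅, ∅, fun h' => absurd h' h⟩
  choose A B hAB using hex
  refine ⟨fun v => (f v, fun i j => (decide (v ∈ A i j), decide (v ∈ B i j))), fun v => rfl, ?_⟩
  set Bd : Finset (C × C) := {e | G.IsBad f d ε k e.1 e.2} with hBd
  have hmem : ∀ e ∈ Bd, G.IsBad f d ε k e.1 e.2 := fun e he => (Finset.mem_filter.1 he).2
  have hinc := energy_increment
    (fun e : V × V => if k ≤ G.mult e.1 e.2 then (1 : ℝ) else 0)
    (c := fun e : V × V => (f e.1, f e.2))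
    (c' := fun e : V × V => ((f e.1, fun i j => (decide (e.1 ∈ A i j), decide (e.1 ∈ B i j))),
      (f e.2, fun i j => (decide (e.2 ∈ A i j), decide (e.2 ∈ B i j)))))
    (π := fun e => (e.1.1, e.2.1)) (fun x => rfl) Bd (fun e => A e.1 e.2 ×ˢ B e.1 e.2)
    (fun e l => (l.1.2 e.1 e.2).1 = true ∧ (l.2.2 e.1 e.2).2 = true) (t := d / 2) (by positivity)
    (fun e he x hx => by
      have h := hAB _ _ (hmem e he)
      rw [Finset.mem_product] at hx
      have h1 := h.1 hx.1
      have h2 := h.2.1 hx.2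
      rw [mem_cls] at h1 h2
      exact Prod.ext h1 h2)
    (fun e he x => by simp)
    (fun e he => by
      have h := hAB _ _ (hmem e he)
      have hsum : ∑ x ∈ A e.1 e.2 ×ˢ B e.1 e.2,
          (if k ≤ G.mult x.1 x.2 then (1 : ℝ) else 0) = G.pairCount k (A e.1 e.2) (B e.1 e.2) := by
        simp [pairCount]
      rw [hsum, Finset.card_product, Nat.cast_mul]
      refine h.2.2.2.2.le.trans ?_
      refine mul_le_mul_of_nonneg_right ?_ (by positivity)
      have hAne : A e.1 e.2 ≠ ∅ := by
        intro h0
        have := h.2.2.2.2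
        rw [h0] at this
        simp [pairCount] at this
      have hBne : B e.1 e.2 ≠ ∅ := by
        intro h0
        have := h.2.2.2.2
        rw [h0] at this
        simp [pairCount] at this
      have hpi : 0 < #(cls f e.1) :=
        Finset.card_pos.2 ((Finset.nonempty_iff_ne_empty.2 hAne).mono h.1)
      have hpj : 0 < #(cls f e.2) :=
        Finset.card_pos.2 ((Finset.nonempty_iff_ne_empty.2 hBne).mono h.2.1)
      have hset : ({y | (f y.1, f y.2) = e} : Finset (V × V)) = cls f e.1 ×ˢ cls f e.2 := by
        ext y
        simp [Prod.ext_iff]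
      have hmean : d ≤ cellMean (fun e : V × V => if k ≤ G.mult e.1 e.2 then (1 : ℝ) else 0)
          (fun e : V × V => (f e.1, f e.2)) e := by
        unfold cellMean
        rw [hset, Finset.card_product, le_div_iff₀ (by positivity)]
        refine (le_of_eq ?_).trans ((hmem e he).1.trans (le_of_eq ?_))
        · push_cast; ring
        · simp [pairCount]
      linarith)
  unfold partEnergy
  refine le_trans ?_ (hinc.trans_eq (by congr!))
  refine add_le_add le_rfl ?_
  have h1 : ε ^ 2 * G.badWeight f d ε k
      ≤ ∑ e ∈ Bd, (#(A e.1 e.2 ×ˢ B e.1 e.2) : ℝ) := by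
    unfold badWeight
    rw [Finset.mul_sum]
    refine Finset.sum_le_sum fun e he => ?_
    have h := hAB _ _ (hmem e he)
    rw [Finset.card_product, Nat.cast_mul]
    calc ε ^ 2 * (#(cls f e.1) * #(cls f e.2) : ℝ)
        = (ε * #(cls f e.1)) * (ε * #(cls f e.2)) := by ring
      _ ≤ _ := mul_le_mul h.2.2.1 h.2.2.2.1 (by positivity) (by positivity)
  have h2 : (d / 2) ^ 2 * ε ^ 3 * (Fintype.card V : ℝ) ^ 2
      = (d / 2) ^ 2 * (ε ^ 2 * (ε * (Fintype.card V : ℝ) ^ 2)) := by ring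
  rw [h2]
  refine mul_le_mul_of_nonneg_left (le_trans ?_ h1) (by positivity)
  exact mul_le_mul_of_nonneg_left hbad.le (by positivity)

/-- Each of the two energies is at most `n ^ 2`, where `n` is the number of vertices, so their sum
can grow only boundedly often. `T` is the number of increments still available, and `M` depends only
on `T` and `m`. -/
theorem exists_regular_refinement {d ε : ℝ} (hd : 0 < d) (hε : 0 < ε) (T m : ℕ) :
    ∃ M : ℕ, ∀ (V : Type*) [Fintype V] [Nonempty V] (G : StdMultigraph V) (f : V → Fin m),
      (2 - T * ((d / 2) ^ 2 * ε ^ 3)) * (Fintype.card V : ℝ) ^ 2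
        ≤ G.partEnergy f 1 + G.partEnergy f 2 →
      ∃ m' ≤ M, ∃ (f' : V → Fin m') (π : Fin m' → Fin m), (∀ v, f v = π (f' v)) ∧
        G.badWeight f' d ε 1 ≤ ε * (Fintype.card V : ℝ) ^ 2 ∧
        G.badWeight f' d ε 2 ≤ ε * (Fintype.card V : ℝ) ^ 2 := by
  induction T generalizing m with
  | zero =>
    refine ⟨m, fun V _ _ G f hf => ⟨m, le_rfl, f, id, fun v => rfl, ?_⟩⟩
    have hV : (0 : ℝ) < Fintype.card V := by exact_mod_cast Fintype.card_pos
    have hc : 0 < (d / 2) ^ 2 * ε ^ 3 * (Fintype.card V : ℝ) ^ 2 := by positivity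
    have key : ∀ k, k = 1 ∨ k = 2 → G.badWeight f d ε k ≤ ε * (Fintype.card V : ℝ) ^ 2 := by
      intro k hk
      by_contra! hlt
      obtain ⟨f', hf', he⟩ := G.exists_refinement f hd hε k hlt
      have h1 := G.partEnergy_le f 1
      have h2 := G.partEnergy_le f 2
      have h3 := G.partEnergy_le f' k
      norm_num at hf
      rcases hk with rfl | rfl <;> linarith
    exact ⟨key 1 (Or.inl rfl), key 2 (Or.inr rfl)⟩
  | succ T ih =>
    obtain ⟨M, hM⟩ := ih (Fintype.card (Fin m × (Fin m → Fin m → Bool × Bool)))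
    refine ⟨max m M, fun V _ _ G f hf => ?_⟩
    by_cases hreg : G.badWeight f d ε 1 ≤ ε * (Fintype.card V : ℝ) ^ 2 ∧
        G.badWeight f d ε 2 ≤ ε * (Fintype.card V : ℝ) ^ 2
    · exact ⟨m, le_max_left _ _, f, id, fun v => rfl, hreg⟩
    · have hk : ∃ k, (k = 1 ∨ k = 2) ∧ ε * (Fintype.card V : ℝ) ^ 2 < G.badWeight f d ε k := by
        by_contra! hno
        exact hreg ⟨hno 1 (Or.inl rfl), hno 2 (Or.inr rfl)⟩
      obtain ⟨k, hk, hlt⟩ := hk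
      obtain ⟨f', hf', he⟩ := G.exists_refinement f hd hε k hlt
      set e := Fintype.equivFin (Fin m × (Fin m → Fin m → Bool × Bool)) with hedef
      have hmono : ∀ l, G.partEnergy f' l ≤ G.partEnergy (fun v => e (f' v)) l := fun l =>
        G.partEnergy_mono (π := e.symm) (fun v => by simp) l
      have hmono' : ∀ l, G.partEnergy f l ≤ G.partEnergy f' l := fun l =>
        G.partEnergy_mono (π := Prod.fst) hf' l
      have hen : (2 - T * ((d / 2) ^ 2 * ε ^ 3)) * (Fintype.card V : ℝ) ^ 2
          ≤ G.partEnergy (fun v => e (f' v)) 1 + G.partEnergy (fun v => e (f' v)) 2 := by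
        push_cast at hf
        have h1 := hmono 1
        have h2 := hmono 2
        have h3 := hmono' 1
        have h4 := hmono' 2
        rcases hk with rfl | rfl <;> nlinarith
      obtain ⟨m', hm', g, π, hπ, hb⟩ := hM V G (fun v => e (f' v)) hen
      refine ⟨m', hm'.trans (le_max_right _ _), g, fun i => (e.symm (π i)).1, fun v => ?_, hb⟩
      change f v = (e.symm (π (g v))).1
      rw [← hπ v]
      simp [hf' v]

/-- Residues of an enumeration give classes of at most `n / m + 1 ≤ 2 * n / m` of the `n` vertices.
Only this upper bound is used, because it survives refinement. -/
theorem exists_equitable_map (V : Type*) [Fintype V] {m : ℕ} (hm : 0 < m)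
    (hV : m ≤ Fintype.card V) :
    ∃ f : V → Fin m, ∀ i, (#(cls f i) : ℝ) ≤ 2 / m * Fintype.card V := by
  classical
  let e := Fintype.equivFin V
  refine ⟨fun v => ⟨(e v : ℕ) % m, Nat.mod_lt _ hm⟩, fun i => ?_⟩
  have h1 : #(cls (fun v => (⟨(e v : ℕ) % m, Nat.mod_lt _ hm⟩ : Fin m)) i)
      ≤ #(Finset.range (Fintype.card V / m + 1)) := by
    refine Finset.card_le_card_of_injOn (fun v => (e v : ℕ) / m) (fun v _ => ?_) ?_
    · rw [Finset.mem_coe, Finset.mem_range, Nat.lt_succ_iff]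
      exact Nat.div_le_div_right (e v).2.le
    · intro v hv w hw hvw
      rw [Finset.mem_coe, mem_cls] at hv hw
      have h2 : (e v : ℕ) % m = (e w : ℕ) % m := by
        have := congrArg Fin.val (hv.trans hw.symm)
        simpa using this
      have h3 : (e v : ℕ) / m = (e w : ℕ) / m := hvw
      have h4 : (e v : ℕ) = e w := by
        rw [← Nat.div_add_mod (e v : ℕ) m, ← Nat.div_add_mod (e w : ℕ) m, h2, h3]
      exact e.injective (Fin.ext h4)
  rw [Finset.card_range] at h1
  have hm' : (0 : ℝ) < m := by exact_mod_cast hm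
  have h2 : (#(cls (fun v => (⟨(e v : ℕ) % m, Nat.mod_lt _ hm⟩ : Fin m)) i) : ℝ)
      ≤ (Fintype.card V / m : ℕ) + 1 := by exact_mod_cast h1
  have h3 : ((Fintype.card V / m : ℕ) : ℝ) ≤ Fintype.card V / m := Nat.cast_div_le
  have h4 : (1 : ℝ) ≤ Fintype.card V / m := by
    rw [le_div_iff₀ hm', one_mul]
    exact_mod_cast hV
  calc _ ≤ _ := h2
    _ ≤ (Fintype.card V : ℝ) / m + Fintype.card V / m := by linarith
    _ = _ := by ring

/-- A regularity lemma for standard multigraphs. -/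
theorem exists_regular_partition {d ε : ℝ} (hd : 0 < d) (hε : 0 < ε) :
    ∃ M n₀ : ℕ, ∀ (V : Type*) [Fintype V] (G : StdMultigraph V), n₀ ≤ Fintype.card V →
      ∃ m ≤ M, ∃ f : V → Fin m, (∀ i, (#(cls f i) : ℝ) ≤ ε * Fintype.card V) ∧
        G.badWeight f d ε 1 ≤ ε * (Fintype.card V : ℝ) ^ 2 ∧
        G.badWeight f d ε 2 ≤ ε * (Fintype.card V : ℝ) ^ 2 := by
  obtain ⟨m₀, hm₀⟩ := exists_nat_gt (2 / ε)
  have hm₀' : (0 : ℝ) < m₀ := lt_trans (by positivity) hm₀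
  have hm₀'' : 0 < m₀ := by exact_mod_cast hm₀'
  have hc : 0 < (d / 2) ^ 2 * ε ^ 3 := by positivity
  obtain ⟨T, hT⟩ := exists_nat_gt (2 / ((d / 2) ^ 2 * ε ^ 3))
  rw [div_lt_iff₀ hc] at hT
  obtain ⟨M, hM⟩ := exists_regular_refinement hd hε T m₀
  refine ⟨M, m₀, fun V _ G hV => ?_⟩
  have : Nonempty V := Fintype.card_pos_iff.1 (hm₀''.trans_le hV)
  obtain ⟨f, hf⟩ := exists_equitable_map V hm₀'' hV
  -- `T` was chosen so large that the energy required at the start is not positive.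
  obtain ⟨m, hm, f', π, hπ, hb⟩ := hM V G f <| by
    have h1 := G.partEnergy_nonneg f 1
    have h2 := G.partEnergy_nonneg f 2
    have : (2 - T * ((d / 2) ^ 2 * ε ^ 3)) * (Fintype.card V : ℝ) ^ 2 ≤ 0 :=
      mul_nonpos_of_nonpos_of_nonneg (by linarith) (by positivity)
    linarith
  refine ⟨m, hm, f', fun i => ?_, hb⟩
  have h1 : cls f' i ⊆ cls f (π i) := fun v hv => by
    rw [mem_cls] at hv ⊢
    rw [hπ, hv]
  have h2 : (#(cls f' i) : ℝ) ≤ #(cls f (π i)) := by exact_mod_cast Finset.card_le_card h1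
  refine h2.trans ((hf _).trans ?_)
  gcongr
  rw [div_le_iff₀ hm₀']
  rw [div_lt_iff₀ hε] at hm₀
  linarith

end Regularity

end StdMultigraph

/-! ### Fractional tilings and approximate duality -/

section FractionalTiling

variable {ι : Type*} [Fintype ι] [DecidableEq ι]

/-- The total weight of the members of `x` that contain `i`. -/
noncomputable def load (x : Finset ι → ℝ) (i : ι) : ℝ := ∑ Z with i ∈ Z, x Z

theorem le_load {x : Finset ι → ℝ} (hx : ∀ Z, 0 ≤ x Z) {i : ι} {Z : Finset ι} (hi : i ∈ Z) :
    x Z ≤ load x i :=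
  Finset.single_le_sum (f := x) (fun Z _ => hx Z) (by simpa using hi)

theorem sum_load_mul (x : Finset ι → ℝ) (w : ι → ℝ) :
    ∑ i, load x i * w i = ∑ Z, x Z * ∑ i ∈ Z, w i := by
  unfold load
  simp only [Finset.sum_filter, Finset.sum_mul, Finset.mul_sum]
  rw [Finset.sum_comm]
  refine Finset.sum_congr rfl fun Z _ => ?_
  simp only [ite_mul, zero_mul]
  rw [← Finset.sum_filter]
  simp

theorem sum_load (x : Finset ι → ℝ) : ∑ i, load x i = ∑ Z, x Z * #Z := by
  simpa using sum_load_mul x (fun _ => 1)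

theorem load_update (x : Finset ι → ℝ) (Z : Finset ι) (t : ℝ) (i : ι) :
    load (Function.update x Z (x Z + t)) i = load x i + if i ∈ Z then t else 0 := by
  classical
  have h : Function.update x Z (x Z + t) = fun Y => x Y + if Y = Z then t else 0 := by
    ext Y
    by_cases hY : Y = Z
    · subst hY; simp
    · simp [hY]
  rw [h]
  unfold load
  rw [Finset.sum_add_distrib]
  congr 1
  rw [Finset.sum_ite_eq']
  simp

theorem sq_max_add_le (a t : ℝ) :
    max (a + t) 0 ^ 2 ≤ max a 0 ^ 2 + 2 * t * max a 0 + t ^ 2 := by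
  rcases le_total a 0 with ha | ha
  · rw [max_eq_right ha]
    rcases le_total (a + t) 0 with h | h
    · rw [max_eq_right h]; nlinarith [sq_nonneg t]
    · rw [max_eq_left h]; nlinarith
  · rw [max_eq_left ha]
    rcases le_total (a + t) 0 with h | h
    · rw [max_eq_right h]; nlinarith [sq_nonneg (a + t)]
    · rw [max_eq_left h]; nlinarith

/-- First-order optimality: a linear gain dominated by a quadratic error for all small steps is not
positive. -/
theorem nonpos_of_forall_mul_le {a c B : ℝ} (hc : 0 ≤ c) (hB : 0 < B)
    (h : ∀ t, 0 < t → t ≤ B → t * a ≤ c * t ^ 2) : a ≤ 0 := by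
  by_contra! ha
  have ht : 0 < min B (a / (2 * (c + 1))) := lt_min hB (by positivity)
  have h1 := h _ ht (min_le_left _ _)
  set t := min B (a / (2 * (c + 1))) with htd
  have h2 : t ≤ a / (2 * (c + 1)) := min_le_right _ _
  rw [le_div_iff₀ (by positivity)] at h2
  have h3 : a ≤ c * t := by
    have : t * a ≤ t * (c * t) := by nlinarith
    exact le_of_mul_le_mul_left this ht
  nlinarith

/-- The penalised objective of the fractional tiling problem. -/
noncomputable def tilingObjective (b : Finset ι → ℝ) (p : ι → ℝ) (lam : ℝ) (x : Finset ι → ℝ) :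
    ℝ :=
  ∑ Z, b Z * x Z - lam * ∑ i, max (load x i - p i) 0 ^ 2

theorem continuous_tilingObjective (b : Finset ι → ℝ) (p : ι → ℝ) (lam : ℝ) :
    Continuous (tilingObjective b p lam) := by
  unfold tilingObjective load
  fun_prop

/-- First-order expansion in one coordinate. The derivative of the penalty supplies what will be the
dual weights, and the error is quadratic by `sq_max_add_le`. -/
theorem tilingObjective_update (b : Finset ι → ℝ) (p : ι → ℝ) {lam : ℝ} (hlam : 0 ≤ lam)
    (x : Finset ι → ℝ) (Z : Finset ι) (t : ℝ) :
    tilingObjective b p lam x + t * (b Z - ∑ i ∈ Z, 2 * lam * max (load x i - p i) 0)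
      - lam * #Z * t ^ 2 ≤ tilingObjective b p lam (Function.update x Z (x Z + t)) := by
  unfold tilingObjective
  have h1 : ∑ Y, b Y * Function.update x Z (x Z + t) Y = ∑ Y, b Y * x Y + t * b Z := by
    have h : Function.update x Z (x Z + t) = fun Y => x Y + if Y = Z then t else 0 := by
      ext Y
      by_cases hY : Y = Z
      · subst hY; simp
      · simp [hY]
    rw [h]
    simp only [mul_add, mul_ite, mul_zero, Finset.sum_add_distrib, Finset.sum_ite_eq',
      Finset.mem_univ, if_true]
    ring
  have h2 : ∑ i, max (load (Function.update x Z (x Z + t)) i - p i) 0 ^ 2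
      ≤ ∑ i, (max (load x i - p i) 0 ^ 2
        + if i ∈ Z then 2 * t * max (load x i - p i) 0 + t ^ 2 else 0) := by
    refine Finset.sum_le_sum fun i _ => ?_
    rw [load_update]
    split_ifs
    · have := sq_max_add_le (load x i - p i) t
      rw [show load x i + t - p i = load x i - p i + t by ring]
      linarith
    · simp
  rw [Finset.sum_add_distrib, ← Finset.sum_filter, Finset.filter_univ_mem,
    Finset.sum_add_distrib] at h2
  have h3 := mul_le_mul_of_nonneg_left h2 hlam
  rw [h1]
  have h4 : ∑ i ∈ Z, 2 * t * max (load x i - p i) 0 = 2 * t * ∑ i ∈ Z, max (load x i - p i) 0 := by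
    rw [Finset.mul_sum]
  have h5 : ∑ i ∈ Z, 2 * lam * max (load x i - p i) 0
      = 2 * lam * ∑ i ∈ Z, max (load x i - p i) 0 := by
    rw [Finset.mul_sum]
  rw [h4] at h3
  rw [h5]
  simp only [Finset.sum_const, nsmul_eq_mul] at h3
  nlinarith

/-- Approximate linear programming duality, with exact complementary slackness, for fractional
tilings by members of `T`. -/
theorem exists_fractional_tiling (T : Set (Finset ι)) (hT : ∀ Z ∈ T, Z.Nonempty)
    (b : Finset ι → ℝ) (hb1 : ∀ Z, b Z ≤ 1) (p : ι → ℝ) (hp : ∀ i, 0 ≤ p i)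
    {ε : ℝ} (hε : 0 < ε) :
    ∃ (x : Finset ι → ℝ) (w : ι → ℝ), (∀ Z, 0 ≤ x Z) ∧ (∀ i, 0 ≤ w i) ∧ (∀ i, w i ≤ 1) ∧
      (∀ Z, x Z ≠ 0 → Z ∈ T) ∧ (∀ Z ∈ T, b Z ≤ ∑ i ∈ Z, w i) ∧
      (∀ Z, x Z ≠ 0 → ∑ i ∈ Z, w i = b Z) ∧ (∀ i, w i ≠ 0 → p i ≤ load x i) ∧
      ∀ i, load x i ≤ p i + ε := by
  classical
  -- The box exists for compactness only: at a maximum all loads stay below `B`, so the upper bound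
  -- never binds on `T`.
  set B : ℝ := ∑ i, p i + ε + 1 with hB
  have hpB : ∀ i, p i + ε + 1 ≤ B := fun i => by
    have := Finset.single_le_sum (f := p) (fun i _ => hp i) (Finset.mem_univ i)
    linarith
  have hB0 : 0 < B := by
    have := Finset.sum_nonneg (fun i (_ : i ∈ univ) => hp i)
    linarith
  -- With this value, dual weight at most one means overload at most `ε`.
  set lam : ℝ := 1 / (2 * ε) with hlam
  have hlam0 : 0 < lam := by positivity
  set box : Set (Finset ι → ℝ) := Set.univ.pi fun Z => Set.Icc 0 (if Z ∈ T then B else 0) with hbox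
  have hcomp : IsCompact box := isCompact_univ_pi fun Z => isCompact_Icc
  have hne : box.Nonempty := ⟨0, fun Z _ => ⟨le_rfl, by split_ifs <;> simp [hB0.le]⟩⟩
  obtain ⟨x, hx, hmax⟩ := hcomp.exists_isMaxOn hne (continuous_tilingObjective b p lam).continuousOn
  have hx0 : ∀ Z, 0 ≤ x Z := fun Z => (hx Z trivial).1
  have hxT : ∀ Z, x Z ≠ 0 → Z ∈ T := fun Z h => by
    by_contra hZ
    have := (hx Z trivial).2
    rw [if_neg hZ] at this
    exact h (le_antisymm this (hx0 Z))
  have hxB : ∀ Z, x Z ≤ B := fun Z => (hx Z trivial).2.trans (by split_ifs <;> simp [hB0.le])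
  -- The dual solution is the gradient of the penalty. It vanishes where the load does not exceed
  -- `p`, which gives exact complementary slackness although loads may exceed `p` slightly.
  set w : ι → ℝ := fun i => 2 * lam * max (load x i - p i) 0 with hw
  have hw0 : ∀ i, 0 ≤ w i := fun i => by positivity
  have step : ∀ Z ∈ T, ∀ t, 0 ≤ x Z + t → x Z + t ≤ B →
      t * (b Z - ∑ i ∈ Z, w i) ≤ lam * #Z * t ^ 2 := by
    intro Z hZ t h0 h1
    have hmem : Function.update x Z (x Z + t) ∈ box := by
      intro Y _
      by_cases hY : Y = Z
      · subst hY; simp [hZ, h0, h1]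
      · simp only [Function.update_of_ne hY]
        exact hx Y trivial
    have h2 := hmax hmem
    have h3 := tilingObjective_update b p hlam0.le x Z t
    simp only [Set.mem_ofPred_eq] at h2
    linarith
  have hle : ∀ Z, x Z ≠ 0 → ∑ i ∈ Z, w i ≤ b Z := by
    intro Z hZ
    have hpos : 0 < x Z := lt_of_le_of_ne (hx0 Z) (Ne.symm hZ)
    have := nonpos_of_forall_mul_le (a := ∑ i ∈ Z, w i - b Z) (c := lam * #Z) (by positivity) hpos
      fun t ht htx => by
        have := step Z (hxT Z hZ) (-t) (by linarith) (by linarith [hxB Z])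
        nlinarith
    linarith
  -- An overloaded vertex lies in a tile of positive weight, whose dual weights add up to at most `b
  -- Z ≤ 1`.
  have hw1 : ∀ i, w i ≤ 1 := by
    intro i
    by_cases h : load x i ≤ p i
    · have : w i = 0 := by simp [hw, h]
      rw [this]; exact zero_le_one
    · have hpos : 0 < load x i := lt_of_le_of_lt (hp i) (not_le.1 h)
      obtain ⟨Z, hZ, hZ'⟩ := Finset.exists_ne_zero_of_sum_ne_zero hpos.ne'
      have hiZ : i ∈ Z := (Finset.mem_filter.1 hZ).2
      exact (Finset.single_le_sum (f := w) (fun i _ => hw0 i) hiZ).trans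
        ((hle Z hZ').trans (hb1 Z))
  have hload : ∀ i, load x i ≤ p i + ε := by
    intro i
    have h1 := hw1 i
    have h2 : load x i - p i ≤ max (load x i - p i) 0 := le_max_left _ _
    have h3 : max (load x i - p i) 0 ≤ ε := by
      have : 2 * lam * max (load x i - p i) 0 ≤ 1 := h1
      have h4 : 2 * lam = 1 / ε := by rw [hlam]; field_simp
      rw [h4, one_div, inv_mul_le_iff₀ hε] at this
      linarith
    linarith
  have hge : ∀ Z ∈ T, b Z ≤ ∑ i ∈ Z, w i := by
    intro Z hZ
    obtain ⟨i, hi⟩ := hT Z hZ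
    have hlt : x Z < B := by
      have h1 := le_load hx0 hi
      have h2 := hload i
      have h3 := hpB i
      linarith
    have := nonpos_of_forall_mul_le (a := b Z - ∑ i ∈ Z, w i) (c := lam * #Z) (by positivity)
      (sub_pos.2 hlt) fun t ht htx =>
        step Z hZ t (by linarith [hx0 Z]) (by linarith)
    linarith
  refine ⟨x, w, hx0, hw0, hw1, hxT, hge, fun Z hZ => le_antisymm (hle Z hZ) (hge Z (hxT Z hZ)),
    fun i hi => ?_, hload⟩
  by_contra! h
  exact hi (by simp [hw, h.le])

end FractionalTiling

namespace StdMultigraph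

/-! ### Matched and near matched sets, and exchanges between them -/

section Cliques

variable {ι : Type*} [DecidableEq ι] (R : StdMultigraph ι)

/-- The number of edges that are missing between `i` and `j`. -/
def gap (i j : ι) : ℕ := 2 - R.mult i j

/-- The number of edges that are missing between `a` and `Y`. -/
def defic (a : ι) (Y : Finset ι) : ℕ := ∑ y ∈ Y, R.gap a y

/-- The number of light neighbours of `a` in `Y`. -/
def lightDeg (Y : Finset ι) (a : ι) : ℕ := #{y ∈ Y | R.mult a y = 1}

/-- Twice the number of light edges in `Y`. -/
def lightCount (Y : Finset ι) : ℕ := ∑ y ∈ Y, R.lightDeg Y y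

/-- The vertices of `Y` are pairwise adjacent and the light edges in `Y` form a matching. -/
def IsMatched (Y : Finset ι) : Prop :=
  (∀ x ∈ Y, ∀ y ∈ Y, x ≠ y → 1 ≤ R.mult x y) ∧ ∀ x ∈ Y, R.lightDeg Y x ≤ 1

/-- The vertices of `Y` are pairwise adjacent and the light edges in `Y` form a matching and at most
one further path, which has three or four vertices. -/
def IsNearMatched (Y : Finset ι) : Prop :=
  R.IsMatched Y ∨ ∃ a ∈ Y, R.IsMatched (Y.erase a) ∧ (∀ y ∈ Y.erase a, 1 ≤ R.mult a y) ∧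
    R.lightDeg (Y.erase a) a ≤ 2 ∧
    #{y ∈ Y.erase a | R.mult a y = 1 ∧ R.lightDeg (Y.erase a) y ≠ 0} ≤ 1

variable {R} {Y Y' B : Finset ι} {a x y : ι}

theorem gap_comm (i j : ι) : R.gap i j = R.gap j i := by rw [gap, gap, R.symm]

-- Counting two missing edges from a vertex to itself makes deficiency bounds uniform: members of
-- `Y` have deficiency at least two, so a vertex of smaller deficiency lies outside `Y`.
@[simp] theorem gap_self (i : ι) : R.gap i i = 2 := by rw [gap, R.loopless]

theorem gap_add_mult (i j : ι) : R.gap i j + R.mult i j = 2 :=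
  Nat.sub_add_cancel (R.le_two i j)

theorem gap_le_defic (hy : y ∈ Y) : R.gap a y ≤ R.defic a Y :=
  Finset.single_le_sum (f := fun y => R.gap a y) (fun _ _ => Nat.zero_le _) hy

theorem defic_erase (hy : y ∈ Y) : R.defic a (Y.erase y) + R.gap a y = R.defic a Y :=
  Finset.sum_erase_add _ _ hy

theorem defic_mono (h : Y ⊆ Y') : R.defic a Y ≤ R.defic a Y' :=
  Finset.sum_le_sum_of_subset h

theorem two_le_defic_of_mem (ha : a ∈ Y) : 2 ≤ R.defic a Y := by
  simpa using gap_le_defic (R := R) (a := a) ha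

theorem notMem_of_defic_le_one (h : R.defic a Y ≤ 1) : a ∉ Y := fun ha => by
  have := two_le_defic_of_mem (R := R) ha
  omega

theorem one_le_mult_of_defic_le_one (h : R.defic a Y ≤ 1) (hy : y ∈ Y) : 1 ≤ R.mult a y := by
  have := gap_le_defic (R := R) (a := a) hy
  have := gap_add_mult (R := R) a y
  omega

theorem lightDeg_le_defic : R.lightDeg Y a ≤ R.defic a Y := by
  rw [lightDeg, Finset.card_filter, defic]
  refine Finset.sum_le_sum fun y _ => ?_
  have := gap_add_mult (R := R) a y
  split_ifs <;> omega

theorem lightDeg_mono (h : Y ⊆ Y') (a : ι) : R.lightDeg Y a ≤ R.lightDeg Y' a :=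
  Finset.card_le_card (Finset.filter_subset_filter _ h)

theorem lightDeg_insert (ha : a ∉ Y) (x : ι) :
    R.lightDeg (insert a Y) x = R.lightDeg Y x + if R.mult x a = 1 then 1 else 0 := by
  unfold lightDeg
  rw [Finset.filter_insert]
  split_ifs
  · rw [Finset.card_insert_of_notMem (by simp [ha])]
  · simp

theorem lightDeg_insert_self (a : ι) (Y : Finset ι) :
    R.lightDeg (insert a Y) a = R.lightDeg Y a := by
  unfold lightDeg
  rw [Finset.filter_insert, R.loopless, if_neg (by norm_num)]

theorem lightDeg_erase_self (a : ι) (Y : Finset ι) :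
    R.lightDeg (Y.erase a) a = R.lightDeg Y a := by
  by_cases h : a ∈ Y
  · rw [← lightDeg_insert_self, Finset.insert_erase h]
  · rw [Finset.erase_eq_of_notMem h]

theorem lightCount_insert (ha : a ∉ Y) :
    R.lightCount (insert a Y) = R.lightCount Y + 2 * R.lightDeg Y a := by
  unfold lightCount
  rw [Finset.sum_insert ha, lightDeg_insert_self,
    Finset.sum_congr rfl fun y _ => lightDeg_insert (R := R) ha y, Finset.sum_add_distrib]
  have : ∑ y ∈ Y, (if R.mult y a = 1 then 1 else 0) = R.lightDeg Y a := by
    rw [lightDeg, Finset.card_filter]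
    exact Finset.sum_congr rfl fun y _ => by rw [R.symm]
  omega

theorem lightCount_erase (ha : a ∈ Y) :
    R.lightCount (Y.erase a) + 2 * R.lightDeg Y a = R.lightCount Y := by
  have h := lightCount_insert (R := R) (Finset.notMem_erase a Y)
  rw [Finset.insert_erase ha, lightDeg_erase_self] at h
  exact h.symm

theorem lightDeg_eq_zero (h : ∀ y ∈ Y, R.mult a y = 2) : R.lightDeg Y a = 0 := by
  rw [lightDeg, Finset.card_eq_zero, Finset.filter_eq_empty_iff]
  intro y hy
  rw [h y hy]
  norm_num

theorem isMatched_empty : R.IsMatched ∅ := ⟨by simp, by simp⟩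

theorem isMatched_singleton (a : ι) : R.IsMatched {a} := by
  refine ⟨by simp, fun x hx => ?_⟩
  exact (Finset.card_filter_le _ _).trans (by simp)

theorem IsMatched.mono (h : R.IsMatched Y) (hs : Y' ⊆ Y) : R.IsMatched Y' :=
  ⟨fun x hx y hy => h.1 x (hs hx) y (hs hy),
    fun x hx => (lightDeg_mono hs x).trans (h.2 x (hs hx))⟩

theorem IsMatched.lightCount_le (h : R.IsMatched Y) : R.lightCount Y ≤ #Y := by
  refine (Finset.sum_le_card_nsmul _ _ 1 h.2).trans ?_
  simp

theorem IsMatched.insert (h : R.IsMatched Y) (hd : R.defic a Y ≤ 1)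
    (hl : ∀ y ∈ Y, R.mult a y = 1 → R.lightDeg Y y = 0) : R.IsMatched (insert a Y) := by
  have ha := notMem_of_defic_le_one hd
  constructor
  · intro x hx y hy hxy
    rw [Finset.mem_insert] at hx hy
    rcases hx with rfl | hx
    · rcases hy with rfl | hy
      · exact absurd rfl hxy
      · exact one_le_mult_of_defic_le_one hd hy
    · rcases hy with rfl | hy
      · rw [R.symm]; exact one_le_mult_of_defic_le_one hd hx
      · exact h.1 x hx y hy hxy
  · intro x hx
    rw [Finset.mem_insert] at hx
    rcases hx with rfl | hx
    · rw [lightDeg_insert_self]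
      exact lightDeg_le_defic.trans hd
    · rw [lightDeg_insert ha]
      split_ifs with hxa
      · rw [hl x hx (by rw [R.symm]; exact hxa)]
      · exact h.2 x hx

theorem defic_eq_zero_iff : R.defic a Y = 0 ↔ ∀ y ∈ Y, R.mult a y = 2 := by
  rw [defic, Finset.sum_eq_zero_iff]
  refine forall₂_congr fun y _ => ?_
  have := gap_add_mult (R := R) a y
  omega

theorem IsMatched.insert_heavy (h : R.IsMatched Y) (hd : ∀ y ∈ Y, R.mult a y = 2) :
    R.IsMatched (Insert.insert a Y) := by
  refine h.insert ?_ fun y hy h1 => ?_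
  · rw [defic_eq_zero_iff.2 hd]; exact Nat.zero_le _
  · rw [hd y hy] at h1; norm_num at h1

theorem heavy_erase_of_light (hd : R.defic a Y ≤ 1) (hy : y ∈ Y) (hl : R.mult a y = 1) :
    ∀ z ∈ Y.erase y, R.mult a z = 2 := by
  have h1 := defic_erase (R := R) (a := a) hy
  have h2 := gap_add_mult (R := R) a y
  exact defic_eq_zero_iff.1 (by omega)

/-- A vertex that misses one edge to `y ∈ Y` and nothing else can replace `y`. -/
theorem IsMatched.swap (h : R.IsMatched Y) (hd : R.defic a Y ≤ 1) (hy : y ∈ Y)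
    (hl : R.mult a y = 1) :
    R.IsMatched (Insert.insert a (Y.erase y)) ∧ #(Insert.insert a (Y.erase y)) = #Y ∧
      R.lightCount (Insert.insert a (Y.erase y)) + 2 * R.lightDeg Y y = R.lightCount Y := by
  have hh := heavy_erase_of_light hd hy hl
  have ha : a ∉ Y.erase y := fun h' => notMem_of_defic_le_one hd (Finset.mem_of_mem_erase h')
  refine ⟨(h.mono (Finset.erase_subset _ _)).insert_heavy hh, ?_, ?_⟩
  · rw [Finset.card_insert_of_notMem ha, Finset.card_erase_add_one hy]
  · rw [lightCount_insert ha, lightDeg_eq_zero hh, mul_zero, add_zero, lightCount_erase hy]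

theorem IsMatched.near (h : R.IsMatched Y) : R.IsNearMatched Y := Or.inl h

theorem IsMatched.near_insert (h : R.IsMatched Y) (ha : a ∉ Y) (hadj : ∀ y ∈ Y, 1 ≤ R.mult a y)
    (h2 : R.lightDeg Y a ≤ 2) (h1 : #{y ∈ Y | R.mult a y = 1 ∧ R.lightDeg Y y ≠ 0} ≤ 1) :
    R.IsNearMatched (Insert.insert a Y) := by
  refine Or.inr ⟨a, Finset.mem_insert_self _ _, ?_⟩
  rw [Finset.erase_insert ha]
  exact ⟨h, hadj, h2, h1⟩

theorem IsMatched.near_insert_of_defic (h : R.IsMatched Y) (hd : R.defic a Y ≤ 1) :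
    R.IsNearMatched (Insert.insert a Y) := by
  have h1 : R.lightDeg Y a ≤ 1 := lightDeg_le_defic.trans hd
  refine h.near_insert (notMem_of_defic_le_one hd)
    (fun y hy => one_le_mult_of_defic_le_one hd hy) (h1.trans one_le_two) ?_
  refine le_trans (Finset.card_le_card ?_) h1
  exact Finset.monotone_filter_right _ fun y _ hy => hy.1

theorem IsNearMatched.adj (h : R.IsNearMatched Y) :
    ∀ x ∈ Y, ∀ y ∈ Y, x ≠ y → 1 ≤ R.mult x y := by
  rcases h with h | ⟨a, ha, hm, hadj, -⟩
  · exact h.1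
  · intro x hx y hy hxy
    rcases eq_or_ne x a with rfl | hxa
    · exact hadj y (Finset.mem_erase.2 ⟨hxy.symm, hy⟩)
    · rcases eq_or_ne y a with rfl | hya
      · rw [R.symm]; exact hadj x (Finset.mem_erase.2 ⟨hxy, hx⟩)
      · exact hm.1 x (Finset.mem_erase.2 ⟨hxa, hx⟩) y (Finset.mem_erase.2 ⟨hya, hy⟩) hxy

theorem IsNearMatched.mono (h : R.IsNearMatched Y) (hs : Y' ⊆ Y) : R.IsNearMatched Y' := by
  rcases h with h | ⟨a, ha, hm, hadj, h2, h1⟩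
  · exact (h.mono hs).near
  · have hs' : Y'.erase a ⊆ Y.erase a := Finset.erase_subset_erase _ hs
    by_cases ha' : a ∈ Y'
    · refine Or.inr ⟨a, ha', hm.mono hs', fun y hy => hadj y (hs' hy),
        (lightDeg_mono hs' a).trans h2, (Finset.card_le_card fun y hy => ?_).trans h1⟩
      rw [Finset.mem_filter] at hy ⊢
      refine ⟨hs' hy.1, hy.2.1, fun h0 => hy.2.2 ?_⟩
      exact Nat.eq_zero_of_le_zero (h0 ▸ lightDeg_mono hs' y)
    · rw [Finset.erase_eq_of_notMem ha'] at hs'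
      exact (hm.mono hs').near

theorem lightDeg_union_of_heavy (h : ∀ b ∈ B, R.mult x b = 2) :
    R.lightDeg (Y ∪ B) x = R.lightDeg Y x := by
  unfold lightDeg
  rw [Finset.filter_union]
  have : ({b ∈ B | R.mult x b = 1} : Finset ι) = ∅ := by
    rw [Finset.filter_eq_empty_iff]
    intro b hb
    rw [h b hb]
    norm_num
  rw [this, Finset.union_empty]

theorem IsMatched.union (hY : R.IsMatched Y) (hB : R.IsMatched B)
    (h : ∀ y ∈ Y, ∀ b ∈ B, R.mult y b = 2) : R.IsMatched (Y ∪ B) := by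
  have h' : ∀ b ∈ B, ∀ y ∈ Y, R.mult b y = 2 := fun b hb y hy => by rw [R.symm]; exact h y hy b hb
  constructor
  · intro x hx y hy hxy
    rw [Finset.mem_union] at hx hy
    rcases hx with hx | hx <;> rcases hy with hy | hy
    · exact hY.1 x hx y hy hxy
    · rw [h x hx y hy]; norm_num
    · rw [h' x hx y hy]; norm_num
    · exact hB.1 x hx y hy hxy
  · intro x hx
    rw [Finset.mem_union] at hx
    rcases hx with hx | hx
    · rw [lightDeg_union_of_heavy (h x hx)]; exact hY.2 x hx
    · rw [Finset.union_comm, lightDeg_union_of_heavy (h' x hx)]; exact hB.2 x hx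

theorem IsNearMatched.union (hY : R.IsNearMatched Y) (hB : R.IsMatched B)
    (h : ∀ y ∈ Y, ∀ b ∈ B, R.mult y b = 2) : R.IsNearMatched (Y ∪ B) := by
  rcases hY with hY | ⟨a, ha, hm, hadj, h2, h1⟩
  · exact (hY.union hB h).near
  · have haB : a ∉ B := fun haB => by
      have := h a ha a haB
      rw [R.loopless] at this
      norm_num at this
    have he : (Y ∪ B).erase a = Y.erase a ∪ B := by
      rw [Finset.erase_union_distrib, Finset.erase_eq_of_notMem haB]
    refine Or.inr ⟨a, Finset.mem_union_left _ ha, ?_⟩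
    rw [he]
    have hh : ∀ y ∈ Y.erase a, ∀ b ∈ B, R.mult y b = 2 := fun y hy =>
      h y (Finset.mem_of_mem_erase hy)
    refine ⟨hm.union hB hh, fun y hy => ?_, ?_, (Finset.card_le_card fun y hy => ?_).trans h1⟩
    · rw [Finset.mem_union] at hy
      rcases hy with hy | hy
      · exact hadj y hy
      · rw [h a ha y hy]; norm_num
    · rw [lightDeg_union_of_heavy (h a ha)]; exact h2
    · rw [Finset.mem_filter, Finset.mem_union] at hy
      obtain ⟨hy | hy, hy1, hy2⟩ := hy
      · rw [lightDeg_union_of_heavy (hh y hy)] at hy2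
        exact Finset.mem_filter.2 ⟨hy, hy1, hy2⟩
      · rw [h a ha y hy] at hy1; norm_num at hy1

/-- A matched subset of `U` of maximum size and, subject to this, with the fewest light edges. -/
theorem exists_optimal_matched (R : StdMultigraph ι) (U : Finset ι) :
    ∃ Y ⊆ U, R.IsMatched Y ∧ (∀ Y' ⊆ U, R.IsMatched Y' → #Y' ≤ #Y) ∧
      ∀ Y' ⊆ U, R.IsMatched Y' → #Y' = #Y → R.lightCount Y ≤ R.lightCount Y' := by
  classical
  obtain ⟨Y₀, h₀, hmax⟩ := Finset.exists_max_image ({Y ∈ U.powerset | R.IsMatched Y}) Finset.card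
    ⟨∅, by simp [isMatched_empty]⟩
  obtain ⟨Y, hY, hmin⟩ := Finset.exists_min_image
    ({Y ∈ U.powerset | R.IsMatched Y ∧ #Y = #Y₀}) R.lightCount
    ⟨Y₀, by simpa using h₀⟩
  simp only [Finset.mem_filter, Finset.mem_powerset] at h₀ hmax hY hmin
  refine ⟨Y, hY.1, hY.2.1, fun Y' hU hm => ?_, fun Y' hU hm hc => hmin Y' ⟨hU, hm, ?_⟩⟩
  · rw [hY.2.2]; exact hmax Y' ⟨hU, hm⟩
  · rw [hc, hY.2.2]

theorem insert_erase_subset {U : Finset ι} (hY : Y ⊆ U) (ha : a ∈ U) :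
    Insert.insert a (Y.erase y) ⊆ U :=
  Finset.insert_subset ha ((Finset.erase_subset _ _).trans hY)

/-- A vertex of deficiency at most one either replaces a light neighbour that already has a light
edge, which lowers the light count, or can be added, which contradicts the maximum size. -/
theorem two_le_defic_of_optimal {U : Finset ι} (hY : Y ⊆ U) (hm : R.IsMatched Y)
    (hmax : ∀ Y' ⊆ U, R.IsMatched Y' → #Y' ≤ #Y)
    (hmin : ∀ Y' ⊆ U, R.IsMatched Y' → #Y' = #Y → R.lightCount Y ≤ R.lightCount Y')
    (ha : a ∈ U) : 2 ≤ R.defic a Y := by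
  by_contra! hlt
  have hd : R.defic a Y ≤ 1 := by omega
  by_cases hex : ∃ y ∈ Y, R.mult a y = 1 ∧ R.lightDeg Y y ≠ 0
  · obtain ⟨y, hy, h1, h0⟩ := hex
    obtain ⟨h2, h3, h4⟩ := hm.swap hd hy h1
    have := hmin _ (insert_erase_subset hY ha) h2 h3
    omega
  · push Not at hex
    have := hmax _ (Finset.insert_subset ha hY) (hm.insert hd hex)
    rw [Finset.card_insert_of_notMem (notMem_of_defic_le_one hd)] at this
    omega

theorem sum_mul_defic (q : ι → ℝ) (U Y : Finset ι) :
    ∑ i ∈ U, q i * (R.defic i Y : ℝ) = ∑ y ∈ Y, ∑ i ∈ U, q i * (R.gap y i : ℝ) := by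
  rw [Finset.sum_comm]
  refine Finset.sum_congr rfl fun i _ => ?_
  rw [defic, Nat.cast_sum, Finset.mul_sum]
  exact Finset.sum_congr rfl fun y _ => by rw [gap_comm]

/-- Double counting of the missing edges between `U` and `Y`, weighted by `q`. -/
theorem two_mul_sum_le (q : ι → ℝ) (hq : ∀ i, 0 ≤ q i) {D : ℝ} {U Y : Finset ι}
    (hD : ∀ a ∈ Y, ∑ i ∈ U, q i * (R.gap a i : ℝ) ≤ D) (h : ∀ a ∈ U, 2 ≤ R.defic a Y) :
    2 * ∑ i ∈ U, q i ≤ #Y * D := by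
  calc 2 * ∑ i ∈ U, q i = ∑ i ∈ U, q i * 2 := by rw [Finset.mul_sum]; simp [mul_comm]
    _ ≤ ∑ i ∈ U, q i * (R.defic i Y : ℝ) := Finset.sum_le_sum fun i hi =>
      mul_le_mul_of_nonneg_left (by exact_mod_cast h i hi) (hq i)
    _ = ∑ y ∈ Y, ∑ i ∈ U, q i * (R.gap y i : ℝ) := sum_mul_defic q U Y
    _ ≤ ∑ _y ∈ Y, D := Finset.sum_le_sum hD
    _ = #Y * D := by simp

end Cliques

/-! ### Extremal structure behind the absence of large near matched sets -/

section Stability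

variable {ι : Type*} [DecidableEq ι] {R : StdMultigraph ι}

theorem lightDeg_ne_zero {Y : Finset ι} {y z : ι} (hz : z ∈ Y) (h : R.mult y z = 1) :
    R.lightDeg Y y ≠ 0 :=
  Finset.card_ne_zero_of_mem (Finset.mem_filter.2 ⟨hz, h⟩)

theorem IsMatched.eq_of_light {Y : Finset ι} (hm : R.IsMatched Y) {x y z : ι} (hx : x ∈ Y)
    (hy : y ∈ Y) (hz : z ∈ Y) (hxy : R.mult x y = 1) (hxz : R.mult x z = 1) : y = z := by
  have := hm.2 x hx
  rw [lightDeg, Finset.card_le_one] at this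
  exact this y (Finset.mem_filter.2 ⟨hy, hxy⟩) z (Finset.mem_filter.2 ⟨hz, hxz⟩)

theorem notMem_of_gap_eq_one {Y : Finset ι} {a y : ι} (hd : R.defic a Y = 2) (hy : y ∈ Y)
    (h : R.gap a y = 1) : a ∉ Y := by
  intro ha
  have hay : a ≠ y := by rintro rfl; simp at h
  have h1 := defic_erase (R := R) (a := a) hy
  have h2 := two_le_defic_of_mem (R := R) (Finset.mem_erase.2 ⟨hay, ha⟩)
  omega

/-- The new vertex has at most two light neighbours, one of which, `y`, has no other light edge. The
light edges at the new vertex hence lie on a path with at most four vertices. -/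
theorem near_insert_of_light_unmatched {Y : Finset ι} (hm : R.IsMatched Y) {a y : ι}
    (hd : R.defic a Y = 2) (hy : y ∈ Y) (h : R.gap a y = 1) (h0 : R.lightDeg Y y = 0) :
    R.IsNearMatched (Insert.insert a Y) := by
  have hmul := gap_add_mult (R := R) a y
  have h1 := defic_erase (R := R) (a := a) hy
  refine hm.near_insert (notMem_of_gap_eq_one hd hy h) (fun z hz => ?_) (hd ▸ lightDeg_le_defic) ?_
  · rcases eq_or_ne z y with rfl | hzy
    · omega
    · exact one_le_mult_of_defic_le_one (Y := Y.erase y) (by omega) (Finset.mem_erase.2 ⟨hzy, hz⟩)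
  · have h2 : ({z ∈ Y | R.mult a z = 1 ∧ R.lightDeg Y z ≠ 0} : Finset ι)
        ⊆ ({z ∈ Y | R.mult a z = 1} : Finset ι).erase y := by
      intro z hz
      rw [Finset.mem_filter] at hz
      refine Finset.mem_erase.2 ⟨?_, Finset.mem_filter.2 ⟨hz.1, hz.2.1⟩⟩
      rintro rfl
      exact hz.2.2 h0
    refine (Finset.card_le_card h2).trans ?_
    rw [Finset.card_erase_of_mem (Finset.mem_filter.2 ⟨hy, by omega⟩)]
    have : #{z ∈ Y | R.mult a z = 1} ≤ 2 := hd ▸ lightDeg_le_defic (R := R)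
    omega

/-- The two missing edges at `a` go to `y` and `y₂`, so `a` is heavy to the rest. Since `y` and `y₂`
lie on different light edges, two light edges disappear, which is four in `lightCount`. -/
theorem isMatched_replace {Y : Finset ι} (hm : R.IsMatched Y) {a y y' y₂ : ι} (hy : y ∈ Y)
    (hy' : y' ∈ Y) (hy₂ : y₂ ∈ Y) (hyy₂ : y ≠ y₂) (hy'y₂ : y' ≠ y₂) (hl : R.mult y y' = 1)
    (hl₂ : R.lightDeg Y y₂ ≠ 0) (hd : R.defic a Y = 2) (h : R.gap a y = 1) (h₂ : R.gap a y₂ = 1) :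
    R.IsMatched (Insert.insert a ((Y.erase y).erase y₂)) ∧
      #(Insert.insert a ((Y.erase y).erase y₂)) + 1 = #Y ∧
      R.lightCount (Insert.insert a ((Y.erase y).erase y₂)) + 4 ≤ R.lightCount Y := by
  have ha := notMem_of_gap_eq_one hd hy h
  have hy₂' : y₂ ∈ Y.erase y := Finset.mem_erase.2 ⟨hyy₂.symm, hy₂⟩
  have h1 := defic_erase (R := R) (a := a) hy
  have h2 := defic_erase (R := R) (a := a) hy₂'
  have hh : ∀ z ∈ (Y.erase y).erase y₂, R.mult a z = 2 := defic_eq_zero_iff.1 (by omega)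
  have hsub : (Y.erase y).erase y₂ ⊆ Y := (Finset.erase_subset _ _).trans (Finset.erase_subset _ _)
  have ha' : a ∉ (Y.erase y).erase y₂ := fun h' => ha (hsub h')
  refine ⟨(hm.mono hsub).insert_heavy hh, ?_, ?_⟩
  · rw [Finset.card_insert_of_notMem ha', Finset.card_erase_add_one hy₂',
      Finset.card_erase_add_one hy]
  · rw [lightCount_insert ha', lightDeg_eq_zero hh]
    have h3 := lightCount_erase (R := R) hy
    have h4 := lightCount_erase (R := R) hy₂'
    have h5 : R.lightDeg Y y ≠ 0 := lightDeg_ne_zero hy' hl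
    have h6 : R.lightDeg (Y.erase y) y₂ ≠ 0 := by
      obtain ⟨z, hz⟩ := Finset.card_ne_zero.1 hl₂
      rw [Finset.mem_filter] at hz
      refine lightDeg_ne_zero (Finset.mem_erase.2 ⟨?_, hz.1⟩) hz.2
      rintro rfl
      exact hy'y₂ (hm.eq_of_light hz.1 hy' hy₂ hl (by rw [R.symm]; exact hz.2))
    omega

/-- Stability: a set `A` with large minimum degree and with no near matched subset of more than `s`
vertices, but of weight almost `s / r`, contains an almost extremal set. -/
theorem exists_extremal_of_stability {p : ι → ℝ} (hp : ∀ i, 0 ≤ p i) {r s : ℕ} (hs : 1 ≤ s)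
    (hsr : s ≤ r) {η e : ℝ} (hη : 0 ≤ η) (he : 0 ≤ e) {A : Finset ι}
    (hD : ∀ a, ∑ i ∈ A, p i * (R.gap a i : ℝ) ≤ 2 / r + η)
    (hA : (s : ℝ) / r - e ≤ ∑ i ∈ A, p i) (hnear : ∀ Y ⊆ A, R.IsNearMatched Y → #Y ≤ s)
    (hsmall : 2 * e + r * η < 2 / r) :
    ∃ S : Finset ι, (|∑ i ∈ S, p i - 1 / r| ≤ 3 * e + 2 * r * η ∧
        ∀ i ∈ S, ∀ j ∈ S, R.mult i j = 0) ∨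
      (|∑ i ∈ S, p i - 2 / r| ≤ 5 * e + 3 * r * η ∧ ∀ i ∈ S, ∀ j ∈ S, R.mult i j ≠ 2) := by
  classical
  obtain ⟨Y, hYA, hm, hmax, hmin⟩ := exists_optimal_matched R A
  set D : ℝ := 2 / r + η with hDdef
  have hr0 : (0 : ℝ) < r := by exact_mod_cast (by omega : 0 < r)
  have hsr' : (s : ℝ) ≤ r := by exact_mod_cast hsr
  have hs' : (1 : ℝ) ≤ s := by exact_mod_cast hs
  have hD0 : 0 ≤ D := by positivity
  have hsη : s * η ≤ r * η := mul_le_mul_of_nonneg_right hsr' hη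
  have hsD : (s : ℝ) * (2 / r) = 2 * (s / r) := by ring
  have hdef : ∀ a ∈ A, 2 ≤ R.defic a Y := fun a ha => two_le_defic_of_optimal hYA hm hmax hmin ha
  have hdefle : ∀ Y' : Finset ι, ∑ i ∈ A, p i * (R.defic i Y' : ℝ) ≤ #Y' * D := by
    intro Y'
    rw [sum_mul_defic]
    refine (Finset.sum_le_sum fun y _ => hD y).trans ?_
    simp
  -- A set of fewer than `s` vertices cannot absorb two missing edges from every vertex of `A`. The
  -- hypothesis `hsmall` makes the count strict.
  have hbig : ∀ Y' : Finset ι, (∀ a ∈ A, 2 ≤ R.defic a Y') → s ≤ #Y' := by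
    intro Y' h
    by_contra! hlt
    have h1 := two_mul_sum_le p hp (fun a _ => hD a) h
    have h2 : (#Y' : ℝ) ≤ s - 1 := by
      have : (#Y' : ℝ) + 1 ≤ s := by exact_mod_cast hlt
      linarith
    have h3 : (#Y' : ℝ) * D ≤ (s - 1) * D := mul_le_mul_of_nonneg_right h2 hD0
    have h4 : ((s : ℝ) - 1) * D = 2 * (s / r) - 2 / r + s * η - η := by rw [hDdef]; ring
    linarith
  have hcard : #Y = s := le_antisymm (hnear Y hYA hm.near) (hbig Y hdef)
  -- The count for `Y` is almost tight, so almost all weight of `A` has deficiency exactly two.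
  have hexc : ∑ i ∈ A, p i * ((R.defic i Y : ℝ) - 2) ≤ s * η + 2 * e := by
    have h1 := hdefle Y
    rw [hcard] at h1
    simp only [mul_sub, Finset.sum_sub_distrib]
    rw [← Finset.sum_mul]
    have : (s : ℝ) * D = 2 * (s / r) + s * η := by rw [hDdef]; ring
    linarith
  have hYne : Y.Nonempty := Finset.card_pos.1 (by omega)
  have hlow : 2 * ∑ i ∈ A, p i ≤ ∑ i ∈ A, p i * (R.defic i Y : ℝ) := by
    rw [Finset.mul_sum]
    refine Finset.sum_le_sum fun i hi => ?_
    rw [mul_comm]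
    exact mul_le_mul_of_nonneg_left (by exact_mod_cast hdef i hi) (hp i)
  by_cases hun : ∃ y ∈ Y, R.lightDeg Y y = 0
  · obtain ⟨y, hy, h0⟩ := hun
    -- An unmatched `y` leads to the independent set: vertices that miss both edges to `y` and
    -- nothing else. A vertex of deficiency two cannot miss exactly one edge to `y`, for it could
    -- then be added to `Y`. Since `Y.erase y` accounts for at most `(s - 1) * D`, about `2 / r` of
    -- the missing weight falls on `y`.
    set S : Finset ι := {i ∈ A | R.gap i y = 2 ∧ R.defic i Y = 2} with hS
    have hSmem : ∀ i ∈ S, i ∈ A ∧ R.gap i y = 2 ∧ R.defic i Y = 2 := fun i hi =>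
      Finset.mem_filter.1 hi
    have hheavy : ∀ i ∈ S, ∀ z ∈ Y.erase y, R.mult i z = 2 := by
      intro i hi
      have h1 := defic_erase (R := R) (a := i) hy
      have h2 := hSmem i hi
      exact defic_eq_zero_iff.1 (by omega)
    refine ⟨S, Or.inl ⟨?_, ?_⟩⟩
    · have hpt : ∀ i ∈ A, p i * (R.gap i y : ℝ)
          ≤ 2 * (if i ∈ S then p i else 0) + 2 * (p i * ((R.defic i Y : ℝ) - 2)) := by
        intro i hi
        have h1 : R.gap i y ≤ 2 * (if i ∈ S then 1 else 0) + 2 * (R.defic i Y - 2) := by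
          have h2 := hdef i hi
          have h3 : R.gap i y ≤ 2 := Nat.sub_le _ _
          have h4 : R.defic i Y = 2 → R.gap i y ≠ 1 := fun h4 h5 => by
            have h6 := hnear _ (Finset.insert_subset hi hYA)
              (near_insert_of_light_unmatched hm h4 hy h5 h0)
            rw [Finset.card_insert_of_notMem (notMem_of_gap_eq_one h4 hy h5)] at h6
            omega
          by_cases h5 : i ∈ S
          · simp only [h5, if_true]; omega
          · have h6 : ¬ (R.gap i y = 2 ∧ R.defic i Y = 2) := fun h6 =>
              h5 (Finset.mem_filter.2 ⟨hi, h6⟩)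
            simp only [h5, if_false]; omega
        have h2 : (R.gap i y : ℝ) ≤ 2 * (if i ∈ S then 1 else 0) + 2 * ((R.defic i Y : ℝ) - 2) := by
          have h3 : ((R.defic i Y - 2 : ℕ) : ℝ) = (R.defic i Y : ℝ) - 2 := by
            rw [Nat.cast_sub (hdef i hi)]; norm_num
          rw [← h3]
          exact_mod_cast h1
        refine (mul_le_mul_of_nonneg_left h2 (hp i)).trans (le_of_eq ?_)
        split_ifs <;> ring
      have hsum := Finset.sum_le_sum hpt
      rw [Finset.sum_add_distrib, ← Finset.mul_sum, ← Finset.mul_sum, Finset.sum_ite_mem,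
        Finset.inter_eq_right.2 (Finset.filter_subset _ _)] at hsum
      have hrest := hdefle (Y.erase y)
      rw [Finset.card_erase_of_mem hy, hcard, Nat.cast_sub hs, Nat.cast_one] at hrest
      have hsplit : ∑ i ∈ A, p i * (R.defic i Y : ℝ)
          = ∑ i ∈ A, p i * (R.defic i (Y.erase y) : ℝ) + ∑ i ∈ A, p i * (R.gap i y : ℝ) := by
        rw [← Finset.sum_add_distrib]
        refine Finset.sum_congr rfl fun i _ => ?_
        rw [← defic_erase (R := R) (a := i) hy]
        push_cast
        ring
      have hup : 2 * ∑ i ∈ S, p i ≤ D := by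
        refine le_trans ?_ (hD y)
        rw [Finset.mul_sum]
        refine le_trans (le_of_eq (Finset.sum_congr rfl fun i hi => ?_))
          (Finset.sum_le_sum_of_subset_of_nonneg (Finset.filter_subset _ A)
            fun i _ _ => mul_nonneg (hp i) (Nat.cast_nonneg _))
        rw [gap_comm, (hSmem i hi).2.1]
        push_cast
        ring
      have h4 : ((s : ℝ) - 1) * D = 2 * (s / r) - 2 / r + s * η - η := by rw [hDdef]; ring
      have h5 : (2 : ℝ) / r = 2 * (1 / r) := by ring
      rw [abs_le]
      constructor <;> nlinarith
    · intro i hi j hj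
      by_contra hij
      have hne : i ≠ j := by rintro rfl; exact hij (R.loopless i)
      have hmul := gap_add_mult (R := R) i j
      have hiY : i ∉ Y.erase y := fun h' => by
        have := hheavy i hi i h'
        rw [R.loopless] at this; norm_num at this
      have hjY : j ∉ Y.erase y := fun h' => by
        have := hheavy j hj j h'
        rw [R.loopless] at this; norm_num at this
      -- Two adjacent members of `S` could replace `y` and give a matched set of `s + 1` vertices.
      have h1 : R.IsMatched (Insert.insert j (Y.erase y)) :=
        (hm.mono (Finset.erase_subset _ _)).insert_heavy (hheavy j hj)
      have h2 : R.defic i (Insert.insert j (Y.erase y)) ≤ 1 := by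
        rw [defic, Finset.sum_insert hjY]
        have := defic_eq_zero_iff.2 (hheavy i hi)
        rw [defic] at this
        omega
      have h3 := h1.insert h2 fun z hz hz1 => by
        rcases Finset.mem_insert.1 hz with rfl | hz
        · rw [lightDeg_insert_self, lightDeg_eq_zero (hheavy _ hj)]
        · rw [hheavy i hi z hz] at hz1; norm_num at hz1
      have h4 := hmax _ (Finset.insert_subset (hSmem i hi).1
        (insert_erase_subset hYA (hSmem j hj).1)) h3
      rw [Finset.card_insert_of_notMem (notMem_of_defic_le_one h2),
        Finset.card_insert_of_notMem hjY, Finset.card_erase_add_one hy] at h4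
      omega
  · push Not at hun
    obtain ⟨y, hy⟩ := hYne
    obtain ⟨y', hy'⟩ := Finset.card_ne_zero.1 (hun y hy)
    obtain ⟨hy'Y, hyy'⟩ := Finset.mem_filter.1 hy'
    have hne : y ≠ y' := by rintro rfl; rw [R.loopless] at hyy'; norm_num at hyy'
    have hy'e : y' ∈ Y.erase y := Finset.mem_erase.2 ⟨hne.symm, hy'Y⟩
    have hs2 : 2 ≤ s := by
      have h1 : 1 ≤ #(Y.erase y) := Finset.card_pos.2 ⟨y', hy'e⟩
      rw [Finset.card_erase_of_mem hy] at h1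
      omega
    set Y₂ := (Y.erase y).erase y' with hY₂
    have hY₂Y : Y₂ ⊆ Y := (Finset.erase_subset _ _).trans (Finset.erase_subset _ _)
    have hsplit : ∀ i, R.defic i Y₂ + R.gap i y' + R.gap i y = R.defic i Y := fun i => by
      rw [← defic_erase hy, ← defic_erase hy'e]
    -- Deleting one vertex cannot save more than one light edge. A matched set `Z` of `s - 1`
    -- vertices with fewest light edges is too small for `hbig`, so some `b` has deficiency at most
    -- one. It cannot be swapped in with a gain, so it can be added at the cost of at most one light
    -- edge, and then the minimality of `Y` applies.
    have hdrop : ∀ Y' ⊆ A, R.IsMatched Y' → #Y' + 1 = #Y →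
        R.lightCount Y ≤ R.lightCount Y' + 2 := by
      intro Y' hY'A hY'm hY'c
      obtain ⟨Z, hZ, hZmin⟩ := Finset.exists_min_image
        ({Z ∈ A.powerset | R.IsMatched Z ∧ #Z + 1 = #Y}) R.lightCount
        ⟨Y', by simpa using ⟨hY'A, hY'm, hY'c⟩⟩
      simp only [Finset.mem_filter, Finset.mem_powerset] at hZ hZmin
      obtain ⟨hZA, hZm, hZc⟩ := hZ
      have hex : ∃ b ∈ A, R.defic b Z ≤ 1 := by
        by_contra! hno
        have := hbig Z fun a ha => hno a ha
        omega
      obtain ⟨b, hb, hbd⟩ := hex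
      have hle := hZmin Y' ⟨hY'A, hY'm, hY'c⟩
      by_cases hex : ∃ z ∈ Z, R.mult b z = 1 ∧ R.lightDeg Z z ≠ 0
      · obtain ⟨z, hz, h1, h0⟩ := hex
        obtain ⟨h2, h3, h4⟩ := hZm.swap hbd hz h1
        have := hZmin _ ⟨insert_erase_subset hZA hb, h2, by omega⟩
        omega
      · push Not at hex
        have hbZ := notMem_of_defic_le_one hbd
        have h1 := hmin _ (Finset.insert_subset hb hZA) (hZm.insert hbd hex)
          (by rw [Finset.card_insert_of_notMem hbZ, hZc])
        rw [lightCount_insert hbZ] at h1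
        have h2 : R.lightDeg Z b ≤ 1 := lightDeg_le_defic.trans hbd
        omega
    -- Missing single edges to two different light edges of `Y` would allow a replacement that saves
    -- two light edges, against `hdrop`.
    have hno : ∀ i ∈ A, ∀ z z' z₂, z ∈ Y → z' ∈ Y → z₂ ∈ Y → z ≠ z₂ → z' ≠ z₂ →
        R.mult z z' = 1 → R.defic i Y = 2 → R.gap i z = 1 → R.gap i z₂ = 1 → False := by
      intro i hi z z' z₂ hz hz' hz₂ hzz₂ hz'z₂ hl hd h1 h2
      obtain ⟨h3, h4, h5⟩ := isMatched_replace hm hz hz' hz₂ hzz₂ hz'z₂ hl (hun z₂ hz₂) hd h1 h2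
      have h6 := hdrop _ (Finset.insert_subset hi
        (((Finset.erase_subset _ _).trans (Finset.erase_subset _ _)).trans hYA)) h3 h4
      omega
    -- When all of `Y` is matched, the light pair `y`, `y'` plays the role of the single unmatched
    -- vertex. By `hno`, a vertex of deficiency two misses zero or two edges to the pair, and the
    -- same count gives weight about `2 / r`.
    set S : Finset ι := {i ∈ A | R.defic i Y₂ = 0 ∧ R.defic i Y = 2} with hS
    have hSmem : ∀ i ∈ S, i ∈ A ∧ R.defic i Y₂ = 0 ∧ R.defic i Y = 2 := fun i hi =>
      Finset.mem_filter.1 hi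
    refine ⟨S, Or.inr ⟨?_, ?_⟩⟩
    · have hpt : ∀ i ∈ A, p i * ((R.gap i y : ℝ) + R.gap i y')
          ≤ 2 * (if i ∈ S then p i else 0) + 4 * (p i * ((R.defic i Y : ℝ) - 2)) := by
        intro i hi
        have h1 : R.gap i y + R.gap i y'
            ≤ 2 * (if i ∈ S then 1 else 0) + 4 * (R.defic i Y - 2) := by
          have h2 := hdef i hi
          have h3 : R.gap i y ≤ 2 := Nat.sub_le _ _
          have h3' : R.gap i y' ≤ 2 := Nat.sub_le _ _
          have h4 : R.defic i Y = 2 → R.gap i y + R.gap i y' ≠ 1 := fun h4 h5 => by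
            have h6 := hsplit i
            have h7 : R.defic i Y₂ = 1 := by omega
            obtain ⟨z, hz, hz0⟩ := Finset.exists_ne_zero_of_sum_ne_zero
              (show ∑ z ∈ Y₂, R.gap i z ≠ 0 by rw [← defic, h7]; norm_num)
            have hz1 : R.gap i z = 1 := by
              have := gap_le_defic (R := R) (a := i) hz
              omega
            have hzy' : z ≠ y' := (Finset.mem_erase.1 hz).1
            have hzy : z ≠ y := (Finset.mem_erase.1 (Finset.mem_erase.1 hz).2).1
            rcases (by omega : R.gap i y = 1 ∨ R.gap i y' = 1) with h8 | h8
            · exact hno i hi y y' z hy hy'Y (hY₂Y hz) hzy.symm hzy'.symm hyy' h4 h8 hz1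
            · exact hno i hi y' y z hy'Y hy (hY₂Y hz) hzy'.symm hzy.symm
                (by rw [R.symm]; exact hyy') h4 h8 hz1
          have h6 := hsplit i
          by_cases h5 : i ∈ S
          · have := hSmem i h5
            simp only [h5, if_true]; omega
          · have h6 : ¬ (R.defic i Y₂ = 0 ∧ R.defic i Y = 2) := fun h6 =>
              h5 (Finset.mem_filter.2 ⟨hi, h6⟩)
            simp only [h5, if_false]; omega
        have h2 : (R.gap i y : ℝ) + R.gap i y'
            ≤ 2 * (if i ∈ S then 1 else 0) + 4 * ((R.defic i Y : ℝ) - 2) := by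
          have h3 : ((R.defic i Y - 2 : ℕ) : ℝ) = (R.defic i Y : ℝ) - 2 := by
            rw [Nat.cast_sub (hdef i hi)]; norm_num
          rw [← h3]
          exact_mod_cast h1
        refine (mul_le_mul_of_nonneg_left h2 (hp i)).trans (le_of_eq ?_)
        split_ifs <;> ring
      have hsum := Finset.sum_le_sum hpt
      rw [Finset.sum_add_distrib, ← Finset.mul_sum, ← Finset.mul_sum, Finset.sum_ite_mem,
        Finset.inter_eq_right.2 (Finset.filter_subset _ _)] at hsum
      have hrest := hdefle Y₂
      have hc2 : (#Y₂ : ℝ) = s - 2 := by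
        have h1 : #Y₂ + 1 = _ := Finset.card_erase_add_one hy'e
        have h2 := Finset.card_erase_add_one hy
        have h3 : #Y₂ + 2 = s := by omega
        rw [← h3]; push_cast; ring
      rw [hc2] at hrest
      have hsplit' : ∑ i ∈ A, p i * (R.defic i Y : ℝ) = ∑ i ∈ A, p i * (R.defic i Y₂ : ℝ)
          + ∑ i ∈ A, p i * ((R.gap i y : ℝ) + R.gap i y') := by
        rw [← Finset.sum_add_distrib]
        refine Finset.sum_congr rfl fun i _ => ?_
        rw [← hsplit i]
        push_cast
        ring
      have hup : 2 * ∑ i ∈ S, p i ≤ 2 * D := by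
        have h1 := hD y
        have h2 := hD y'
        have h3 : 2 * ∑ i ∈ S, p i ≤ ∑ i ∈ A, p i * ((R.gap i y : ℝ) + R.gap i y') := by
          rw [Finset.mul_sum]
          refine le_trans (le_of_eq (Finset.sum_congr rfl fun i hi => ?_))
            (Finset.sum_le_sum_of_subset_of_nonneg (Finset.filter_subset _ A)
              fun i _ _ => mul_nonneg (hp i) (by positivity))
          have h4 := hSmem i hi
          have h5 := hsplit i
          have h6 : (R.gap i y : ℝ) + R.gap i y' = 2 := by
            exact_mod_cast (by omega : R.gap i y + R.gap i y' = 2)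
          rw [h6]; ring
        have h4 : ∑ i ∈ A, p i * ((R.gap i y : ℝ) + R.gap i y')
            = ∑ i ∈ A, p i * (R.gap y i : ℝ) + ∑ i ∈ A, p i * (R.gap y' i : ℝ) := by
          rw [← Finset.sum_add_distrib]
          refine Finset.sum_congr rfl fun i _ => ?_
          rw [gap_comm i y, gap_comm i y']; ring
        linarith
      have h4 : ((s : ℝ) - 2) * D = 2 * (s / r) - 2 * (2 / r) + s * η - 2 * η := by
        rw [hDdef]; ring
      rw [abs_le]
      constructor <;> nlinarith
    · intro i hi j hj hij
      have hne' : i ≠ j := by rintro rfl; rw [R.loopless] at hij; norm_num at hij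
      have hhi := defic_eq_zero_iff.1 (hSmem i hi).2.1
      have hhj := defic_eq_zero_iff.1 (hSmem j hj).2.1
      have hjY : j ∉ Y₂ := fun h' => by
        have := hhj j h'
        rw [R.loopless] at this; norm_num at this
      have hiY : i ∉ Y₂ := fun h' => by
        have := hhi i h'
        rw [R.loopless] at this; norm_num at this
      have hiY' : i ∉ Insert.insert j Y₂ := by
        rw [Finset.mem_insert]; tauto
      have hhi' : ∀ z ∈ Insert.insert j Y₂, R.mult i z = 2 := by
        intro z hz
        rcases Finset.mem_insert.1 hz with rfl | hz
        · exact hij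
        · exact hhi z hz
      -- A heavy edge inside `S` could replace the light edge between `y` and `y'`.
      have h1 := ((hm.mono hY₂Y).insert_heavy hhj).insert_heavy hhi'
      have hc1 : #Y₂ + 1 = _ := Finset.card_erase_add_one hy'e
      have hc2 := Finset.card_erase_add_one hy
      have h2 := hmin _ (Finset.insert_subset (hSmem i hi).1
        (Finset.insert_subset (hSmem j hj).1 (hY₂Y.trans hYA))) h1
        (by rw [Finset.card_insert_of_notMem hiY', Finset.card_insert_of_notMem hjY]; omega)
      rw [lightCount_insert hiY', lightDeg_eq_zero hhi', lightCount_insert hjY,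
        lightDeg_eq_zero hhj] at h2
      have h3 := lightCount_erase (R := R) hy
      have h4 : R.lightCount Y₂ + _ = _ := lightCount_erase (R := R) hy'e
      have h5 := hun y hy
      omega

end Stability

/-! ### Almost perfect fractional tilings and their dual weights -/

section Fractional

variable {ι : Type*} [Fintype ι] [DecidableEq ι] {R : StdMultigraph ι}

theorem sum_load_mul_gap (x : Finset ι → ℝ) (a : ι) :
    ∑ i, load x i * (R.gap a i : ℝ) = ∑ Z, x Z * (R.defic a Z : ℝ) := by
  rw [sum_load_mul]
  exact Finset.sum_congr rfl fun Z _ => by rw [defic, Nat.cast_sum]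

theorem sum_load_mul_gap_le {p : ι → ℝ} {x : Finset ι → ℝ} {D η ε : ℝ}
    (hεη : ε * Fintype.card ι ≤ η) (hε : 0 ≤ ε)
    (hD : ∀ a, ∑ i, p i * (R.gap a i : ℝ) ≤ D) (hx : ∀ i, load x i ≤ p i + ε) (a : ι) :
    ∑ i, load x i * (R.gap a i : ℝ) ≤ D + 2 * η := by
  have h2 : ∀ i, (R.gap a i : ℝ) ≤ 2 := fun i => by exact_mod_cast Nat.sub_le 2 _
  calc ∑ i, load x i * (R.gap a i : ℝ) ≤ ∑ i, (p i * (R.gap a i : ℝ) + ε * 2) := by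
        refine Finset.sum_le_sum fun i _ => ?_
        have h3 := mul_le_mul_of_nonneg_right (hx i) (Nat.cast_nonneg (α := ℝ) (R.gap a i))
        have h4 := mul_le_mul_of_nonneg_left (h2 i) hε
        linarith
    _ = ∑ i, p i * (R.gap a i : ℝ) + 2 * (ε * Fintype.card ι) := by
        rw [Finset.sum_add_distrib]
        simp only [Finset.sum_const, Finset.card_univ, nsmul_eq_mul]
        ring
    _ ≤ D + 2 * η := by linarith [hD a]

theorem sum_load_of_card {x : Finset ι → ℝ} {r : ℕ} (h : ∀ Z, x Z ≠ 0 → #Z = r) :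
    ∑ i, load x i = r * ∑ Z, x Z := by
  rw [sum_load, Finset.mul_sum]
  refine Finset.sum_congr rfl fun Z _ => ?_
  by_cases hZ : x Z = 0
  · simp [hZ]
  · rw [h Z hZ]; ring

/-- Matched sets of `r` vertices cover almost everything fractionally. -/
theorem exists_matched_fractional_tiling (R : StdMultigraph ι) {r : ℕ} (hr : 2 ≤ r) {p : ι → ℝ}
    (hp : ∀ i, 0 ≤ p i) {η ε : ℝ} (hε : 0 < ε) (hεη : ε * Fintype.card ι ≤ η)
    (hD : ∀ a, ∑ i, p i * (R.gap a i : ℝ) ≤ 2 / r + η) (hp1 : 1 - η ≤ ∑ i, p i) :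
    ∃ x : Finset ι → ℝ, (∀ Z, 0 ≤ x Z) ∧ (∀ Z, x Z ≠ 0 → R.IsMatched Z ∧ #Z = r) ∧
      (∀ i, load x i ≤ p i + ε) ∧ 1 / r - 4 * r * η ≤ ∑ Z, x Z := by
  classical
  have hr0 : (0 : ℝ) < r := by exact_mod_cast (by omega : 0 < r)
  have hr2 : (2 : ℝ) ≤ r := by exact_mod_cast hr
  have hη : 0 ≤ η := le_trans (by positivity) hεη
  obtain ⟨x, w, hx0, hw0, hw1, hxT, hge, heq, hcomp, hload⟩ :=
    exists_fractional_tiling {Z : Finset ι | R.IsMatched Z ∧ #Z = r}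
      (fun Z hZ => Finset.card_pos.1 (by have := hZ.2; omega))
      -- The penalty on light edges lets duality detect swaps. As `lightCount Z ≤ r` for matched
      -- tiles, their values stay between `3 / 4` and `1`.
      (fun Z => 1 - R.lightCount Z / (4 * r))
      (fun Z => by
        have : (0 : ℝ) ≤ R.lightCount Z / (4 * r) := by positivity
        linarith) p hp hε
  refine ⟨x, hx0, fun Z hZ => hxT Z hZ, hload, ?_⟩
  -- Dual form of the exchange. A swap gives a tile of larger value but no larger dual weight, which
  -- is impossible. If `a` can be added, every member of `Z` may be dropped in its favour, so each
  -- has weight at most `1 / (2 * r)`, and `Z` has total at most `1 / 2`.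
  have htiles : ∀ a, w a = 0 → ∀ Z, x Z ≠ 0 → 2 ≤ R.defic a Z := by
    intro a ha Z hZ
    obtain ⟨hm, hc⟩ := hxT Z hZ
    by_contra! hlt
    have hd : R.defic a Z ≤ 1 := by omega
    have haZ := notMem_of_defic_le_one hd
    by_cases hex : ∃ z ∈ Z, R.mult a z = 1 ∧ R.lightDeg Z z ≠ 0
    · obtain ⟨z, hz, h1, h0⟩ := hex
      obtain ⟨h2, h3, h4⟩ := hm.swap hd hz h1
      have h5 := hge _ (show _ ∈ {Z : Finset ι | R.IsMatched Z ∧ #Z = r} from ⟨h2, h3.trans hc⟩)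
      rw [Finset.sum_insert (fun h' => haZ (Finset.mem_of_mem_erase h')), ha, zero_add] at h5
      have h6 := Finset.sum_erase_add Z w hz
      rw [heq Z hZ] at h6
      have h7 := hw0 z
      have h8 : (R.lightCount (insert a (Z.erase z)) : ℝ) + 2 ≤ R.lightCount Z := by
        exact_mod_cast (by omega : R.lightCount (insert a (Z.erase z)) + 2 ≤ R.lightCount Z)
      have h9 : ((R.lightCount (insert a (Z.erase z)) : ℝ) + 2) / (4 * r)
          ≤ R.lightCount Z / (4 * r) := by gcongr
      rw [add_div] at h9
      have : (0 : ℝ) < 2 / (4 * r) := by positivity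
      linarith
    · push Not at hex
      have hmi := hm.insert hd hex
      have hle : ∀ z ∈ Z, w z ≤ 2 / (4 * r) := by
        intro z hz
        have haz : a ∉ Z.erase z := fun h' => haZ (Finset.mem_of_mem_erase h')
        have hsub : insert a (Z.erase z) ⊆ insert a Z :=
          Finset.insert_subset_insert _ (Finset.erase_subset _ _)
        have h5 := hge _ (show insert a (Z.erase z) ∈ {Z : Finset ι | R.IsMatched Z ∧ #Z = r} from
          ⟨hmi.mono hsub, by
            rw [Finset.card_insert_of_notMem haz, Finset.card_erase_add_one hz, hc]⟩)
        rw [Finset.sum_insert haz, ha, zero_add] at h5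
        have h6 := Finset.sum_erase_add Z w hz
        rw [heq Z hZ] at h6
        have h7 := lightCount_insert (R := R) haz
        have h8 := lightCount_erase (R := R) hz
        have h9 : R.lightDeg (Z.erase z) a ≤ 1 :=
          lightDeg_le_defic.trans ((defic_mono (Finset.erase_subset _ _)).trans hd)
        have h10 : (R.lightCount (insert a (Z.erase z)) : ℝ) ≤ R.lightCount Z + 2 := by
          exact_mod_cast (by omega : R.lightCount (insert a (Z.erase z)) ≤ R.lightCount Z + 2)
        have h11 : (R.lightCount (insert a (Z.erase z)) : ℝ) / (4 * r)
          ≤ (R.lightCount Z + 2) / (4 * r) := by gcongr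
        rw [add_div] at h11
        linarith
      have h1 := Finset.sum_le_sum hle
      rw [heq Z hZ, Finset.sum_const, hc, nsmul_eq_mul] at h1
      have h2 : (R.lightCount Z : ℝ) / (4 * r) ≤ r / (4 * r) := by
        gcongr
        rw [← hc]; exact hm.lightCount_le
      have h3 : (r : ℝ) * (2 / (4 * r)) = 1 / 2 := by field_simp; norm_num
      have h4 : (r : ℝ) / (4 * r) = 1 / 4 := by field_simp
      linarith
  -- The uncovered weight. By complementary slackness it sits on vertices of dual weight zero.
  set q : ι → ℝ := fun i => max (p i - load x i) 0 with hq
  have hq0 : ∀ i, 0 ≤ q i := fun i => le_max_right _ _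
  set U : Finset ι := {i | load x i < p i} with hU
  have hUw : ∀ a ∈ U, w a = 0 := fun a ha => by
    by_contra h
    have h1 := hcomp a h
    have h2 := (Finset.mem_filter.1 ha).2
    linarith
  set u := ∑ i, q i with hu
  have hUq : ∑ i ∈ U, q i = u := by
    refine Finset.sum_subset (Finset.subset_univ _) fun i _ hi => ?_
    have : ¬ load x i < p i := fun h => hi (Finset.mem_filter.2 ⟨Finset.mem_univ _, h⟩)
    exact max_eq_right (by linarith)
  have hL := sum_load_of_card (fun Z hZ => (hxT Z hZ).2)
  have hLu : 1 - η - u ≤ r * ∑ Z, x Z := by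
    rw [← hL, hu]
    have : ∑ i, p i ≤ ∑ i, (load x i + q i) := Finset.sum_le_sum fun i _ => by
      have := le_max_left (p i - load x i) 0
      linarith
    rw [Finset.sum_add_distrib] at this
    linarith
  -- Every used tile takes two missing edges at `a`, so the uncovered part inherits the degree
  -- condition in proportion to its total `u`.
  have hUD : ∀ a ∈ U, ∑ i ∈ U, q i * (R.gap a i : ℝ) ≤ 2 * u / r + 5 * η := by
    intro a ha
    have h1 : ∑ i ∈ U, q i * (R.gap a i : ℝ) ≤ ∑ i, q i * (R.gap a i : ℝ) :=
      Finset.sum_le_sum_of_subset_of_nonneg (Finset.subset_univ _) fun i _ _ =>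
        mul_nonneg (hq0 i) (Nat.cast_nonneg _)
    have h2 : ∑ i, q i * (R.gap a i : ℝ)
        ≤ ∑ i, (p i * (R.gap a i : ℝ) - load x i * (R.gap a i : ℝ) + ε * 2) := by
      refine Finset.sum_le_sum fun i _ => ?_
      have h3 : q i ≤ p i - load x i + ε := max_le (by linarith) (by linarith [hload i])
      have h4 : (R.gap a i : ℝ) ≤ 2 := by exact_mod_cast Nat.sub_le 2 _
      have h5 := mul_le_mul_of_nonneg_right h3 (Nat.cast_nonneg (α := ℝ) (R.gap a i))
      have h6 := mul_le_mul_of_nonneg_left h4 hε.le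
      linarith
    rw [Finset.sum_add_distrib, Finset.sum_sub_distrib, sum_load_mul_gap] at h2
    simp only [Finset.sum_const, Finset.card_univ, nsmul_eq_mul] at h2
    have h3 : 2 * ∑ Z, x Z ≤ ∑ Z, x Z * (R.defic a Z : ℝ) := by
      rw [Finset.mul_sum]
      refine Finset.sum_le_sum fun Z _ => ?_
      by_cases hZ : x Z = 0
      · simp [hZ]
      · rw [mul_comm]
        exact mul_le_mul_of_nonneg_left (by exact_mod_cast htiles a (hUw a ha) Z hZ) (hx0 Z)
    have h4 := hD a
    have h5 : 2 / r - η - 2 * u / r ≤ 2 * ∑ Z, x Z := by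
      have h6 : (1 - η - u) / r ≤ ∑ Z, x Z := by
        rw [div_le_iff₀ hr0]; linarith
      have h7 : (1 - η - u) / r = 1 / r - η / r - u / r := by ring
      have h8 : η / r ≤ η / 2 := by gcongr
      have h9 : 2 / (r : ℝ) = 2 * (1 / r) := by ring
      have h10 : 2 * u / (r : ℝ) = 2 * (u / r) := by ring
      rw [h9, h10]
      linarith
    linarith
  have hu0 : 0 ≤ u := Finset.sum_nonneg fun i _ => hq0 i
  obtain ⟨Y, hYU, hYm, hmax, hmin⟩ := exists_optimal_matched R U
  -- A matched set of `r` vertices of dual weight zero would violate dual feasibility. With at most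
  -- `r - 1` vertices in `Y`, double counting leaves only a small `u`.
  have hYr : #Y < r := by
    by_contra! hle
    obtain ⟨Z, hZY, hZc⟩ := Finset.exists_subset_card_eq hle
    have hZm := hYm.mono hZY
    have h1 := hge Z ⟨hZm, hZc⟩
    rw [Finset.sum_eq_zero fun i hi => hUw i (hYU (hZY hi))] at h1
    have h2 : (R.lightCount Z : ℝ) / (4 * r) ≤ r / (4 * r) := by
      gcongr
      rw [← hZc]; exact hZm.lightCount_le
    have h4 : (r : ℝ) / (4 * r) = 1 / 4 := by field_simp
    linarith
  have h1 := two_mul_sum_le q hq0 (fun a ha => hUD a (hYU ha))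
    (fun a ha => two_le_defic_of_optimal hYU hYm hmax hmin ha)
  rw [hUq] at h1
  have h2 : (#Y : ℝ) ≤ r - 1 := by
    have : (#Y : ℝ) + 1 ≤ r := by exact_mod_cast hYr
    linarith
  have h3 : (#Y : ℝ) * (2 * u / r + 5 * η) ≤ (r - 1) * (2 * u / r + 5 * η) :=
    mul_le_mul_of_nonneg_right h2 (by positivity)
  have h4 : ((r : ℝ) - 1) * (2 * u / r + 5 * η) = 2 * u - 2 * (u / r) + 5 * (r - 1) * η := by
    field_simp
  have h5 : u / r ≤ 5 / 2 * (r - 1) * η := by linarith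
  have h6 : (1 - η - u) / r ≤ ∑ Z, x Z := by
    rw [div_le_iff₀ hr0]; linarith
  have h7 : (1 - η - u) / r = 1 / r - η / r - u / r := by ring
  have h8 : η / r ≤ η / 2 := by gcongr
  have h9 : 2 * η ≤ r * η := mul_le_mul_of_nonneg_right hr2 hη
  nlinarith

/-- An optimal fractional tiling `x` with near matched sets of `r` vertices, in which each one that
is not matched is penalised by `κ`, together with an optimal solution `w` of the dual problem. -/
structure IsOptimalTiling (R : StdMultigraph ι) (r : ℕ) (κ : ℝ) (x : Finset ι → ℝ) (w : ι → ℝ) :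
    Prop where
  nonneg : ∀ Z, 0 ≤ x Z
  weight_nonneg : ∀ i, 0 ≤ w i
  near : ∀ Z, x Z ≠ 0 → R.IsNearMatched Z
  card : ∀ Z, x Z ≠ 0 → #Z = r
  le_weight : ∀ Z, R.IsNearMatched Z → #Z = r → 1 - κ ≤ ∑ i ∈ Z, w i
  weight_eq : ∀ Z, x Z ≠ 0 → R.IsMatched Z → ∑ i ∈ Z, w i = 1

variable {r : ℕ} {κ θ θ' : ℝ} {x : Finset ι → ℝ} {w : ι → ℝ} {Y Z : Finset ι} {a z : ι}

/-- Exchanging `z` for `a` gives a near matched tile, to which dual feasibility with loss `κ`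
applies. This is where allowing one longer light path pays off. -/
theorem IsOptimalTiling.weight_le (h : R.IsOptimalTiling r κ x w) (hZ : x Z ≠ 0)
    (hm : R.IsMatched Z) (hz : z ∈ Z) (hd : R.defic a (Z.erase z) ≤ 1) : w z ≤ w a + κ := by
  have haz := notMem_of_defic_le_one hd
  have h1 := h.le_weight (insert a (Z.erase z))
    ((hm.mono (Finset.erase_subset _ _)).near_insert_of_defic hd)
    (by rw [Finset.card_insert_of_notMem haz, Finset.card_erase_add_one hz, h.card Z hZ])
  rw [Finset.sum_insert haz] at h1
  have h2 := Finset.sum_erase_add Z w hz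
  rw [h.weight_eq Z hZ hm] at h2
  linarith

/-- Otherwise `a` can replace any vertex of `Z`, so all of `Z` has small dual weight, whereas its
total is one. -/
theorem IsOptimalTiling.two_le_defic (h : R.IsOptimalTiling r κ x w) (hZ : x Z ≠ 0)
    (hm : R.IsMatched Z) (ha : w a ≤ θ) (hθ : r * (θ + κ) < 1) : 2 ≤ R.defic a Z := by
  by_contra! hlt
  have h1 : ∑ z ∈ Z, w z ≤ ∑ z ∈ Z, (θ + κ) := Finset.sum_le_sum fun z hz => by
    have h2 := defic_mono (R := R) (a := a) (Finset.erase_subset z Z)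
    have := h.weight_le hZ hm hz (a := a) (by omega)
    linarith
  rw [h.weight_eq Z hZ hm, Finset.sum_const, h.card Z hZ, nsmul_eq_mul] at h1
  linarith

/-- Vertices of `Z` above the threshold are joined to `Y` by heavy edges only, since a missing edge
would permit a cheap exchange. If `Y` outnumbered the small vertices of `Z`, then `#A + 1` vertices
of `Y` could replace these and one large vertex `b`, and dual feasibility would force `w b ≤ r * θ +
κ ≤ θ'`. -/
theorem IsOptimalTiling.card_le (h : R.IsOptimalTiling r κ x w) (hZ : x Z ≠ 0)
    (hm : R.IsMatched Z) (hY : R.IsNearMatched Y) (hYr : #Y ≤ r) (hYw : ∀ y ∈ Y, w y ≤ θ)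
    (hθ : 0 ≤ θ) (hθθ' : r * θ + κ ≤ θ') (hr : 1 ≤ r) (hθ' : r * θ' < 1)
    (hd : ∀ y ∈ Y, R.defic y Z = 2) : #Y ≤ #{z ∈ Z | w z ≤ θ'} := by
  by_contra! hlt
  have hr1 : (1 : ℝ) ≤ r := by exact_mod_cast hr
  have hrθ : θ ≤ r * θ := le_mul_of_one_le_left hθ hr1
  set A := ({z ∈ Z | w z ≤ θ'} : Finset ι) with hA
  set B := ({z ∈ Z | ¬ w z ≤ θ'} : Finset ι) with hB
  have hAB : #A + #B = #Z := Finset.card_filter_add_card_filter_not _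
  have hBne : B.Nonempty := by
    rw [Finset.nonempty_iff_ne_empty]
    intro h0
    have h1 : ∑ z ∈ Z, w z ≤ ∑ z ∈ Z, θ' := Finset.sum_le_sum fun z hz => by
      by_contra h2
      have : z ∈ B := Finset.mem_filter.2 ⟨hz, h2⟩
      rw [h0] at this
      exact absurd this (Finset.notMem_empty _)
    rw [h.weight_eq Z hZ hm, Finset.sum_const, h.card Z hZ, nsmul_eq_mul] at h1
    linarith
  obtain ⟨b, hb⟩ := hBne
  have hBZ : B ⊆ Z := Finset.filter_subset _ _
  have hheavy : ∀ y ∈ Y, ∀ c ∈ B, R.mult y c = 2 := by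
    intro y hy c hc
    by_contra hne
    have h1 := gap_add_mult (R := R) y c
    have h2 := defic_erase (R := R) (a := y) (hBZ hc)
    have h3 := hd y hy
    have h4 := h.weight_le hZ hm (hBZ hc) (a := y) (by omega)
    have h5 := (Finset.mem_filter.1 hc).2
    have h6 := hYw y hy
    exact h5 (by linarith)
  obtain ⟨Y', hY'Y, hY'c⟩ := Finset.exists_subset_card_eq (show #A + 1 ≤ #Y by omega)
  have hdisj : Disjoint Y' (B.erase b) := by
    rw [Finset.disjoint_left]
    intro y hy hy'
    have := hheavy y (hY'Y hy) y (Finset.mem_of_mem_erase hy')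
    rw [R.loopless] at this
    norm_num at this
  have hK := h.le_weight (Y' ∪ B.erase b)
    ((hY.mono hY'Y).union (hm.mono ((Finset.erase_subset _ _).trans hBZ)) fun y hy c hc =>
      hheavy y (hY'Y hy) c (Finset.mem_of_mem_erase hc))
    (by
      rw [Finset.card_union_of_disjoint hdisj, hY'c]
      have := Finset.card_erase_add_one hb
      have := h.card Z hZ
      omega)
  rw [Finset.sum_union hdisj] at hK
  have h1 : ∑ y ∈ Y', w y ≤ r * θ := by
    refine (Finset.sum_le_sum fun y hy => hYw y (hY'Y hy)).trans ?_
    rw [Finset.sum_const, nsmul_eq_mul]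
    refine mul_le_mul_of_nonneg_right ?_ hθ
    exact_mod_cast (Finset.card_le_card hY'Y).trans hYr
  have h2 := Finset.sum_erase_add B w hb
  have h3 : ∑ z ∈ B, w z ≤ 1 := by
    rw [← h.weight_eq Z hZ hm]
    exact Finset.sum_le_sum_of_subset_of_nonneg hBZ fun i _ _ => h.weight_nonneg i
  exact (Finset.mem_filter.1 hb).2 (by linarith)

open Classical in
/-- The vertices of small dual weight have total weight almost `s / r` if some `s` of them form a
near matched set. -/
theorem IsOptimalTiling.le_sum_small (h : R.IsOptimalTiling r κ x w) {p : ι → ℝ} {η e : ℝ}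
    (hη : 0 ≤ η) (hηe : 3 * η ≤ e) (hr : 2 ≤ r)
    (hload : ∀ a, ∑ i, load x i * (R.gap a i : ℝ) ≤ 2 / r + 3 * η)
    (hloadS : ∀ S : Finset ι, ∑ i ∈ S, load x i ≤ ∑ i ∈ S, p i + η)
    (hmass : 1 / r - e ≤ ∑ Z with R.IsMatched Z, x Z)
    (hY : R.IsNearMatched Y) (hYr : #Y ≤ r) (hYw : ∀ y ∈ Y, w y ≤ θ)
    (hθ : 0 ≤ θ) (hθθ' : r * θ + κ ≤ θ') (hθ' : r * θ' < 1)
    (hθκ : r * (θ + κ) < 1) : (#Y : ℝ) / r - 5 * r ^ 2 * e ≤ ∑ i with w i ≤ θ', p i := by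
  set s : ℝ := (#Y : ℝ) with hs
  have hr0 : (0 : ℝ) < r := by exact_mod_cast (by omega : 0 < r)
  have hr2 : (2 : ℝ) ≤ r := by exact_mod_cast hr
  have hsr : s ≤ r := Nat.cast_le.2 hYr
  have hs0 : 0 ≤ s := Nat.cast_nonneg _
  have he : 0 ≤ e := by linarith
  -- Matched tiles have total weight almost `1 / r`, so the degree bound at `y` leaves little
  -- deficiency beyond two per tile.
  have hex : ∀ y ∈ Y, ∑ Z with R.IsMatched Z, x Z * ((R.defic y Z : ℝ) - 2) ≤ 3 * e := by
    intro y hy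
    have h1 := hload y
    rw [sum_load_mul_gap] at h1
    have h2 : ∑ Z with R.IsMatched Z, x Z * (R.defic y Z : ℝ) ≤ ∑ Z, x Z * (R.defic y Z : ℝ) :=
      Finset.sum_le_sum_of_subset_of_nonneg (Finset.filter_subset _ _) fun Z _ _ =>
        mul_nonneg (h.nonneg Z) (Nat.cast_nonneg _)
    simp only [mul_sub, Finset.sum_sub_distrib]
    rw [← Finset.sum_mul]
    have h3 : (2 : ℝ) / r = 2 * (1 / r) := by ring
    linarith
  -- Tiles to which all of `Y` has deficiency exactly two contain `#Y` small vertices. The other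
  -- tiles are charged to the excess deficiency.
  have hpt : ∀ Z ∈ ({Z | R.IsMatched Z} : Finset (Finset ι)), x Z * s
      ≤ x Z * (#{z ∈ Z | w z ≤ θ'} : ℝ) + s * ∑ y ∈ Y, x Z * ((R.defic y Z : ℝ) - 2) := by
    intro Z hZ
    have hm : R.IsMatched Z := (Finset.mem_filter.1 hZ).2
    by_cases hxZ : x Z = 0
    · simp [hxZ]
    have h2 : ∀ y ∈ Y, 2 ≤ R.defic y Z := fun y hy =>
      h.two_le_defic hxZ hm (hYw y hy) hθκ
    have h2' : ∀ y ∈ Y, (0 : ℝ) ≤ (R.defic y Z : ℝ) - 2 := fun y hy => by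
      have : ((2 : ℕ) : ℝ) ≤ R.defic y Z := by exact_mod_cast h2 y hy
      push_cast at this
      linarith
    by_cases hall : ∀ y ∈ Y, R.defic y Z = 2
    · have h3 := h.card_le hxZ hm hY hYr hYw hθ hθθ' (by omega) hθ' hall
      have h4 : s ≤ (#{z ∈ Z | w z ≤ θ'} : ℝ) := Nat.cast_le.2 h3
      have h5 := mul_le_mul_of_nonneg_left h4 (h.nonneg Z)
      have h6 : 0 ≤ s * ∑ y ∈ Y, x Z * ((R.defic y Z : ℝ) - 2) :=
        mul_nonneg hs0 (Finset.sum_nonneg fun y hy => mul_nonneg (h.nonneg Z) (h2' y hy))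
      linarith
    · push Not at hall
      obtain ⟨y, hy, hne⟩ := hall
      have h3 : x Z ≤ ∑ y ∈ Y, x Z * ((R.defic y Z : ℝ) - 2) := by
        refine le_trans ?_ (Finset.single_le_sum
          (fun y hy => mul_nonneg (h.nonneg Z) (h2' y hy)) hy)
        have h4 : 3 ≤ R.defic y Z := by
          have := h2 y hy
          omega
        have h5 : (3 : ℝ) ≤ R.defic y Z := by exact_mod_cast h4
        exact le_mul_of_one_le_right (h.nonneg Z) (by linarith)
      have h4 : 0 ≤ x Z * (#{z ∈ Z | w z ≤ θ'} : ℝ) :=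
        mul_nonneg (h.nonneg Z) (Nat.cast_nonneg _)
      have h5 := mul_le_mul_of_nonneg_left h3 hs0
      linarith
  have hsum := Finset.sum_le_sum hpt
  rw [← Finset.sum_mul, Finset.sum_add_distrib, ← Finset.mul_sum, Finset.sum_comm] at hsum
  have h1 : ∑ y ∈ Y, ∑ Z with R.IsMatched Z, x Z * ((R.defic y Z : ℝ) - 2) ≤ s * (3 * e) := by
    refine (Finset.sum_le_sum hex).trans ?_
    rw [Finset.sum_const, nsmul_eq_mul]
  have h2 : ∑ Z with R.IsMatched Z, x Z * (#{z ∈ Z | w z ≤ θ'} : ℝ)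
      ≤ ∑ i with w i ≤ θ', load x i := by
    have h3 := sum_load_mul x (fun i => if w i ≤ θ' then 1 else 0)
    simp only [mul_ite, mul_one, mul_zero, Finset.sum_boole] at h3
    rw [← Finset.sum_filter] at h3
    rw [h3]
    refine Finset.sum_le_sum_of_subset_of_nonneg (Finset.filter_subset _ _) fun Z _ _ =>
        mul_nonneg (h.nonneg Z) (Nat.cast_nonneg _)
  have h3 := hloadS ({i | w i ≤ θ'} : Finset ι)
  have h4 := mul_le_mul_of_nonneg_right hmass hs0
  have h5 := mul_le_mul_of_nonneg_left h1 hs0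
  have h6 : (1 / (r : ℝ) - e) * s = s / r - s * e := by ring
  have h7 : s * e ≤ r * e := mul_le_mul_of_nonneg_right hsr he
  have h8 : s * (s * (3 * e)) ≤ 3 * r ^ 2 * e := by
    have : s * s ≤ r * r := mul_le_mul hsr hsr hs0 hr0.le
    nlinarith
  have h9 : (r : ℝ) * e + e ≤ 2 * r ^ 2 * e := by
    have : (r : ℝ) + 1 ≤ 2 * r ^ 2 := by nlinarith
    nlinarith
  linarith

end Fractional

/-! ### A perfect fractional tiling in the weighted reduced multigraph -/

section ReducedTiling

variable {ι : Type*} [Fintype ι] [DecidableEq ι] {R : StdMultigraph ι}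

open Classical in
/-- Almost all of the weight of some optimal tiling is on matched sets. -/
theorem exists_isOptimalTiling (R : StdMultigraph ι) {r : ℕ} (hr : 2 ≤ r) {p : ι → ℝ}
    (hp : ∀ i, 0 ≤ p i) {η ε κ : ℝ} (hε : 0 < ε) (hεη : ε * Fintype.card ι ≤ η) (hκ : 0 < κ)
    (hκ1 : κ ≤ 1) (hD : ∀ a, ∑ i, p i * (R.gap a i : ℝ) ≤ 2 / r + η) (hp1 : 1 - η ≤ ∑ i, p i)
    (hp2 : ∑ i, p i ≤ 1) :
    ∃ (x : Finset ι → ℝ) (w : ι → ℝ), R.IsOptimalTiling r κ x w ∧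
      (∀ i, w i ≠ 0 → p i ≤ load x i) ∧ (∀ i, load x i ≤ p i + ε) ∧
      1 / r - 12 * r * η / κ ≤ ∑ Z with R.IsMatched Z, x Z := by
  have hr0 : (0 : ℝ) < r := by exact_mod_cast (by omega : 0 < r)
  have hr2 : (2 : ℝ) ≤ r := by exact_mod_cast hr
  have hη : 0 ≤ η := le_trans (by positivity) hεη
  obtain ⟨y, hy0, hyT, hyload, hysum⟩ :=
    exists_matched_fractional_tiling R hr hp hε hεη hD hp1
  set b : Finset ι → ℝ := fun Z => if R.IsMatched Z then 1 else 1 - κ with hb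
  have hble : ∀ Z, b Z ≤ 1 := fun Z => by simp only [hb]; split_ifs <;> linarith
  have hbge : ∀ Z, 1 - κ ≤ b Z := fun Z => by simp only [hb]; split_ifs <;> linarith
  obtain ⟨x, w, hx0, hw0, hw1, hxT, hge, heq, hcomp, hload⟩ :=
    exists_fractional_tiling {Z : Finset ι | R.IsNearMatched Z ∧ #Z = r}
      (fun Z hZ => Finset.card_pos.1 (by have := hZ.2; omega)) b hble p hp hε
  refine ⟨x, w, ⟨hx0, hw0, fun Z hZ => (hxT Z hZ).1, fun Z hZ => (hxT Z hZ).2,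
    fun Z hn hc => (hbge Z).trans (hge Z ⟨hn, hc⟩), fun Z hZ hm => by rw [heq Z hZ, hb];
                                                                      simp [hm]⟩, hcomp, hload, ?_⟩
  -- Comparison with the matched tiling `y` through the dual: the value of `x` is almost `1 / r`.
  -- Its total weight is also at most about `1 / r`, so the loss of `κ` per unmatched tile bounds
  -- their weight.
  have h1 : ∑ i, p i * w i ≤ ∑ Z, x Z * b Z := by
    have h2 : ∑ Z, x Z * b Z = ∑ Z, x Z * ∑ i ∈ Z, w i := by
      refine Finset.sum_congr rfl fun Z _ => ?_
      by_cases hZ : x Z = 0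
      · simp [hZ]
      · rw [heq Z hZ]
    rw [h2, ← sum_load_mul]
    refine Finset.sum_le_sum fun i _ => ?_
    by_cases hi : w i = 0
    · simp [hi]
    · exact mul_le_mul_of_nonneg_right (hcomp i hi) (hw0 i)
  have h2 : ∑ Z, y Z ≤ ∑ i, p i * w i + η := by
    have h3 : ∑ Z, y Z ≤ ∑ Z, y Z * ∑ i ∈ Z, w i := by
      refine Finset.sum_le_sum fun Z _ => ?_
      by_cases hZ : y Z = 0
      · simp [hZ]
      · have h4 := hge Z ⟨(hyT Z hZ).1.near, (hyT Z hZ).2⟩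
        simp only [hb, (hyT Z hZ).1, if_true] at h4
        exact le_mul_of_one_le_right (hy0 Z) h4
    rw [← sum_load_mul] at h3
    have h4 : ∑ i, load y i * w i ≤ ∑ i, (p i * w i + ε) := Finset.sum_le_sum fun i _ => by
      have h5 := mul_le_mul_of_nonneg_right (hyload i) (hw0 i)
      have h6 := mul_le_mul_of_nonneg_left (hw1 i) hε.le
      linarith
    rw [Finset.sum_add_distrib] at h4
    simp only [Finset.sum_const, Finset.card_univ, nsmul_eq_mul] at h4
    linarith
  set m := ∑ Z with R.IsMatched Z, x Z with hm
  set N := ∑ Z with ¬ R.IsMatched Z, x Z with hN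
  have hmN : m + N = ∑ Z, x Z := Finset.sum_filter_add_sum_filter_not _ _ _
  have hbx : ∑ Z, x Z * b Z = m + (1 - κ) * N := by
    rw [← Finset.sum_filter_add_sum_filter_not _ (fun Z => R.IsMatched Z), hm, hN, Finset.mul_sum]
    congr 1
    · refine Finset.sum_congr rfl fun Z hZ => ?_
      simp [hb, (Finset.mem_filter.1 hZ).2]
    · refine Finset.sum_congr rfl fun Z hZ => ?_
      simp only [hb, (Finset.mem_filter.1 hZ).2, if_false]
      ring
  have hL := sum_load_of_card (x := x) (fun Z hZ => (hxT Z hZ).2)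
  have hL2 : (r : ℝ) * (m + N) ≤ 1 + η := by
    rw [hmN, ← hL]
    refine (Finset.sum_le_sum fun i _ => hload i).trans ?_
    rw [Finset.sum_add_distrib]
    simp only [Finset.sum_const, Finset.card_univ, nsmul_eq_mul]
    linarith
  have hL3 : m + N ≤ 1 / r + η / r := by
    rw [← add_div, le_div_iff₀ hr0]; linarith
  have h8 : η / r ≤ η / 2 := by gcongr
  have h9 : 2 * η ≤ r * η := mul_le_mul_of_nonneg_right hr2 hη
  have hN0 : κ * N ≤ 6 * r * η := by linarith
  have hN1 : N ≤ 6 * r * η / κ := by rw [le_div_iff₀ hκ]; linarith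
  have hN2 : 6 * r * η ≤ 6 * r * η / κ := by
    rw [le_div_iff₀ hκ]
    exact mul_le_of_le_one_right (by positivity) hκ1
  have hNn : 0 ≤ N := Finset.sum_nonneg fun Z _ => hx0 Z
  have h10 : 12 * r * η / κ = 6 * r * η / κ + 6 * r * η / κ := by ring
  have h11 : 0 ≤ κ * N := by positivity
  rw [h10]
  linarith

/-- Pigeonhole for a growing quantity between zero and one. It supplies a threshold at which passing
to the next one adds almost no weight. -/
theorem exists_level {J : ℕ} (hJ : 0 < J) (P : ℕ → ℝ) (h0 : 0 ≤ P 0) (h1 : P J ≤ 1) :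
    ∃ j < J, P (j + 1) ≤ P j + 1 / J := by
  have hJ' : (J : ℝ) ≠ 0 := by positivity
  obtain ⟨j, hj, hle⟩ := Finset.exists_le_of_sum_le (s := Finset.range J)
    (f := fun j => P (j + 1) - P j) (g := fun _ => 1 / (J : ℝ)) ⟨0, Finset.mem_range.2 hJ⟩ (by
      rw [Finset.sum_range_sub]
      simp only [Finset.sum_const, Finset.card_range, nsmul_eq_mul]
      rw [mul_one_div_cancel hJ']
      linarith)
  exact ⟨j, Finset.mem_range.1 hj, by linarith⟩

set_option maxHeartbeats 1000000 in
/-- A weighted multigraph of large minimum degree that is not almost extremal has a perfect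
fractional tiling with near matched sets of `r` vertices. -/
theorem exists_near_matched_fractional_tiling {r : ℕ} (hr : 2 ≤ r) {γ : ℝ} (hγ : 0 < γ) :
    ∃ η > 0, ∀ (ι : Type) [Fintype ι] [DecidableEq ι] (R : StdMultigraph ι) (p : ι → ℝ),
      (∀ i, 0 ≤ p i) → 1 - η ≤ ∑ i, p i → ∑ i, p i ≤ 1 →
      (∀ a, ∑ i, p i * (R.gap a i : ℝ) ≤ 2 / r + η) →
      (∀ S : Finset ι, |∑ i ∈ S, p i - 1 / r| < γ → ∃ i ∈ S, ∃ j ∈ S, R.mult i j ≠ 0) →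
      (∀ S : Finset ι, |∑ i ∈ S, p i - 2 / r| < γ → ∃ i ∈ S, ∃ j ∈ S, R.mult i j = 2) →
      ∀ ε > 0, ∃ x : Finset ι → ℝ, (∀ Z, 0 ≤ x Z) ∧
        (∀ Z, x Z ≠ 0 → R.IsNearMatched Z ∧ #Z = r) ∧
        ∀ i, p i ≤ load x i ∧ load x i ≤ p i + ε := by
  classical
  have hr0 : (0 : ℝ) < r := by exact_mod_cast (by omega : 0 < r)
  have hr2 : (2 : ℝ) ≤ r := by exact_mod_cast hr
  set g : ℝ := min γ (1 / r) with hg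
  have hg0 : 0 < g := lt_min hγ (by positivity)
  have hgγ : g ≤ γ := min_le_left _ _
  have hgr : g ≤ 1 / r := min_le_right _ _
  obtain ⟨J, hJ⟩ := exists_nat_gt (40 / g)
  have hJ0 : (0 : ℝ) < J := lt_trans (by positivity) hJ
  have hJpos : 0 < J := by exact_mod_cast hJ0
  have hJg : 1 / (J : ℝ) ≤ g / 40 := by
    rw [div_lt_iff₀ hg0] at hJ
    rw [div_le_iff₀ hJ0]
    linarith
  -- The thresholds grow from `κ` by factors `r + 1`. Three extra powers keep the highest one below
  -- `1 / (4 * r)`.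
  set κ : ℝ := 1 / ((r : ℝ) + 1) ^ (J + 3) with hκdef
  have hr1 : (1 : ℝ) ≤ (r : ℝ) + 1 := by linarith
  have hκ0 : 0 < κ := by positivity
  have hκ1 : κ ≤ 1 := by
    rw [hκdef, div_le_one (by positivity)]
    exact one_le_pow₀ hr1
  -- Chosen so that the loss `5 * r ^ 2 * e` equals `g / 40`. Together with `1 / J ≤ g / 40` it
  -- gives the total loss `g / 20`.
  set η : ℝ := g * κ / (2400 * r ^ 3) with hηdef
  have hη0 : 0 < η := by positivity
  set e : ℝ := 12 * r * η / κ with hedef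
  have he : 5 * r ^ 2 * e = g / 40 := by
    rw [hedef, hηdef]; field_simp; norm_num
  have he0 : 0 < e := by positivity
  have hηe : 3 * η ≤ e := by
    rw [hedef, le_div_iff₀ hκ0]
    have h1 : 3 * η * κ ≤ 3 * η := mul_le_of_le_one_right (by positivity) hκ1
    nlinarith
  have hrη : r * η ≤ g / 2400 := by
    have h1 : r * η = g / 2400 * (κ / r ^ 2) := by
      rw [hηdef]; field_simp
    rw [h1]
    refine mul_le_of_le_one_right (by positivity) ?_
    rw [div_le_one (by positivity)]
    nlinarith
  refine ⟨η, hη0, fun ι _ _ R p hp hp1 hp2 hD hS1 hS2 ε hε => ?_⟩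
  set ε' : ℝ := min ε (η / (Fintype.card ι + 1)) with hε'
  have hε'0 : 0 < ε' := lt_min hε (by positivity)
  have hε'η : ε' * Fintype.card ι ≤ η := by
    have h1 : ε' ≤ η / (Fintype.card ι + 1) := min_le_right _ _
    rw [le_div_iff₀ (by positivity)] at h1
    linarith
  obtain ⟨x, w, hopt, hcomp, hload, hmass⟩ :=
    exists_isOptimalTiling R hr hp hε'0 hε'η hκ0 hκ1 hD hp1 hp2
  refine ⟨x, hopt.nonneg, fun Z hZ => ⟨hopt.near Z hZ, hopt.card Z hZ⟩, fun i =>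
    ⟨?_, (hload i).trans (by linarith [min_le_left ε (η / (Fintype.card ι + 1))])⟩⟩
  -- A single vertex that is not fully covered has dual weight zero, so every level set contains it.
  by_contra! hlt
  have hwi : w i = 0 := by
    by_contra h
    exact absurd (hcomp i h) (not_le.2 hlt)
  set θ : ℕ → ℝ := fun j => κ * ((r : ℝ) + 1) ^ j with hθ
  set P : ℕ → ℝ := fun j => ∑ i with w i ≤ θ j, p i with hP
  obtain ⟨j, hjJ, hj⟩ := exists_level hJpos P (Finset.sum_nonneg fun i _ => hp i)
    ((Finset.sum_le_sum_of_subset_of_nonneg (Finset.filter_subset _ _) fun i _ _ => hp i).trans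
      hp2)
  have hθ0 : ∀ j, 0 ≤ θ j := fun j => by positivity
  have hκθ : ∀ j, κ ≤ θ j := fun j => le_mul_of_one_le_right hκ0.le (one_le_pow₀ hr1)
  have hθstep : r * θ j + κ ≤ θ (j + 1) := by
    have h1 := hκθ j
    have h2 : θ (j + 1) = r * θ j + θ j := by simp only [hθ]; ring
    linarith
  have hθtop : θ (j + 1) ≤ 1 / (4 * r) := by
    have h1 : θ (j + 1) ≤ κ * ((r : ℝ) + 1) ^ J := by
      simp only [hθ]
      gcongr
      exact hjJ
    refine h1.trans ?_
    rw [hκdef, pow_add, one_div_mul_eq_div, div_mul_eq_div_div, div_self (by positivity)]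
    refine one_div_le_one_div_of_le (by positivity) ?_
    nlinarith [sq_nonneg ((r : ℝ) - 1)]
  have hθle : θ j ≤ θ (j + 1) := by
    have h2 : θ (j + 1) = r * θ j + θ j := by simp only [hθ]; ring
    have := hθ0 j
    nlinarith
  have hquarter : r * (1 / (4 * (r : ℝ))) = 1 / 4 := by field_simp
  have hrtop : r * θ (j + 1) ≤ 1 / 4 := by
    rw [← hquarter]
    exact mul_le_mul_of_nonneg_left hθtop hr0.le
  have hrθ : r * θ j ≤ 1 / 4 := (mul_le_mul_of_nonneg_left hθle hr0.le).trans hrtop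
  have hrκ : r * κ ≤ 1 / 4 := (mul_le_mul_of_nonneg_left (hκθ (j + 1)) hr0.le).trans hrtop
  set A : Finset ι := {i | w i ≤ θ j} with hA
  have hAw : ∀ i ∈ A, w i ≤ θ j := fun i hi => (Finset.mem_filter.1 hi).2
  have hiA : i ∈ A := Finset.mem_filter.2 ⟨Finset.mem_univ _, by rw [hwi]; exact hθ0 j⟩
  -- The size of this largest near matched set in `A` is the `s` of the stability lemma.
  obtain ⟨Y, hY, hYmax⟩ := Finset.exists_max_image ({Y ∈ A.powerset | R.IsNearMatched Y})
    Finset.card ⟨{i}, by simpa using ⟨hiA, (isMatched_singleton i).near⟩⟩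
  simp only [Finset.mem_filter, Finset.mem_powerset] at hY hYmax
  have hY1 : 1 ≤ #Y := by
    simpa using hYmax {i} ⟨by simpa using hiA, (isMatched_singleton i).near⟩
  have hYr : #Y ≤ r := by
    by_contra! hgt
    obtain ⟨Z, hZY, hZc⟩ := Finset.exists_subset_card_eq hgt.le
    have h1 := hopt.le_weight Z (hY.2.mono hZY) hZc
    have h2 : ∑ i ∈ Z, w i ≤ r * θ j := by
      refine (Finset.sum_le_sum fun i hi => hAw i (hY.1 (hZY hi))).trans ?_
      rw [Finset.sum_const, hZc, nsmul_eq_mul]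
    nlinarith
  have hsmall := hopt.le_sum_small (p := p) hη0.le hηe hr
    (fun a => by
      have := sum_load_mul_gap_le hε'η hε'0.le hD hload a
      linarith)
    (fun S => by
      refine (Finset.sum_le_sum fun i _ => hload i).trans ?_
      rw [Finset.sum_add_distrib, Finset.sum_const, nsmul_eq_mul]
      have h1 : (#S : ℝ) ≤ Fintype.card ι := by exact_mod_cast Finset.card_le_univ S
      have h2 := mul_le_mul_of_nonneg_right h1 hε'0.le
      linarith)
    hmass hY.2 hYr (fun y hy => hAw y (hY.1 hy)) (hθ0 j) hθstep (by linarith) (by linarith)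
  -- The lower bound is known only for the next level set. The choice of `j` carries it back to `A`,
  -- where the size of near matched sets is controlled.
  have hApj : (#Y : ℝ) / r - g / 20 ≤ ∑ i ∈ A, p i := by
    have h1 : (∑ i with w i ≤ θ (j + 1), p i) ≤ ∑ i ∈ A, p i + 1 / J := by
      have h2 := hj
      simp only [hP] at h2
      convert h2 using 2
    have h3 : (#Y : ℝ) / r - 5 * r ^ 2 * e ≤ ∑ i with w i ≤ θ (j + 1), p i := by
      convert hsmall using 2
    rw [he] at h3
    linarith
  obtain ⟨S, ⟨hS, hS'⟩ | ⟨hS, hS'⟩⟩ := exists_extremal_of_stability (R := R) hp hY1 hYr hη0.le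
    (by positivity : 0 ≤ g / 20) (A := A)
    (fun a => (Finset.sum_le_sum_of_subset_of_nonneg (Finset.subset_univ _) fun i _ _ =>
      mul_nonneg (hp i) (Nat.cast_nonneg _)).trans (hD a)) hApj
    (fun Z hZ hZn => hYmax Z ⟨hZ, hZn⟩)
    (by
      have : (2 : ℝ) / r = 2 * (1 / r) := by ring
      linarith)
  · obtain ⟨i, hi, k, hk, hne⟩ := hS1 S (hS.trans_lt (by linarith))
    exact hne (hS' i hi k hk)
  · obtain ⟨i, hi, k, hk, hne⟩ := hS2 S (hS.trans_lt (by linarith))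
    exact hS' i hi k hk hne

end ReducedTiling

/-! ### Light edges as lists of paths -/

section PathLists

variable {α : Type*}

theorem pair_infix_cons_cons {u v a b : α} {l : List α} :
    [u, v] <:+: a :: b :: l ↔ (u = a ∧ v = b) ∨ [u, v] <:+: b :: l := by
  rw [List.infix_cons_iff (l₂ := b :: l)]
  simp [List.cons_prefix_cons]

theorem pair_not_infix_singleton {u v a : α} : ¬ [u, v] <:+: [a] := fun h => by
  have := h.length_le
  simp at this

theorem IsPathEdge.mem {p : List α} {u v : α} (h : IsPathEdge p u v) : u ∈ p ∧ v ∈ p := by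
  rcases h with h | h
  · exact ⟨h.subset (by simp), h.subset (by simp)⟩
  · exact ⟨h.subset (by simp), h.subset (by simp)⟩

theorem isPathEdge_two {u v a b : α} :
    IsPathEdge [a, b] u v ↔ (u = a ∧ v = b) ∨ (v = a ∧ u = b) := by
  simp [IsPathEdge, pair_infix_cons_cons, pair_not_infix_singleton]

theorem isPathEdge_three {u v a b c : α} : IsPathEdge [a, b, c] u v ↔
    ((u = a ∧ v = b) ∨ (u = b ∧ v = c)) ∨ (v = a ∧ u = b) ∨ (v = b ∧ u = c) := by
  simp [IsPathEdge, pair_infix_cons_cons, pair_not_infix_singleton]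

theorem isPathEdge_four {u v a b c d : α} : IsPathEdge [a, b, c, d] u v ↔
    ((u = a ∧ v = b) ∨ (u = b ∧ v = c) ∨ (u = c ∧ v = d)) ∨
      (v = a ∧ u = b) ∨ (v = b ∧ u = c) ∨ (v = c ∧ u = d) := by
  simp [IsPathEdge, pair_infix_cons_cons, pair_not_infix_singleton]

variable [DecidableEq α] {K : StdMultigraph α}

/-- The light edges of a matched set, as a list of paths with two vertices. -/
theorem IsMatched.exists_list {S : Finset α} (hS : K.IsMatched S) :
    ∃ Ps : List (List α), (∀ p ∈ Ps, p.length = 2) ∧ Ps.flatten.Nodup ∧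
      (∀ p ∈ Ps, ∀ x ∈ p, x ∈ S) ∧
      ∀ x ∈ S, ∀ y ∈ S, K.mult x y = 1 ↔ ∃ p ∈ Ps, IsPathEdge p x y := by
  induction hn : #S using Nat.strong_induction_on generalizing S with
  | _ n ih =>
  by_cases hex : ∃ x ∈ S, ∃ y ∈ S, K.mult x y = 1
  · obtain ⟨x, hx, y, hy, hxy⟩ := hex
    have hne : x ≠ y := by rintro rfl; rw [K.loopless] at hxy; norm_num at hxy
    have hyx : K.mult y x = 1 := by rw [K.symm]; exact hxy
    have hsub : (S.erase x).erase y ⊆ S :=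
      (Finset.erase_subset _ _).trans (Finset.erase_subset _ _)
    have hlt : #((S.erase x).erase y) < n := by
      rw [← hn]
      exact Finset.card_lt_card ⟨hsub, fun h => (Finset.mem_erase.1 (h hy)).1 rfl⟩
    obtain ⟨Ps, h2, hnd, hmem, hiff⟩ := ih _ hlt (hS.mono hsub) rfl
    have hxP : ∀ p ∈ Ps, x ∉ p := fun p hp h =>
      (Finset.mem_erase.1 (Finset.mem_erase.1 (hmem p hp x h)).2).1 rfl
    have hyP : ∀ p ∈ Ps, y ∉ p := fun p hp h => (Finset.mem_erase.1 (hmem p hp y h)).1 rfl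
    refine ⟨[x, y] :: Ps, ?_, ?_, ?_, ?_⟩
    · intro p hp
      rcases List.mem_cons.1 hp with rfl | hp
      · rfl
      · exact h2 p hp
    · rw [List.flatten_cons, List.nodup_append]
      refine ⟨by simp [hne], hnd, ?_⟩
      intro a ha b hb hab
      obtain ⟨p, hp, hbp⟩ := List.mem_flatten.1 hb
      subst hab
      simp only [List.mem_cons, List.not_mem_nil, or_false] at ha
      rcases ha with rfl | rfl
      · exact hxP p hp hbp
      · exact hyP p hp hbp
    · intro p hp z hz
      rcases List.mem_cons.1 hp with rfl | hp
      · simp only [List.mem_cons, List.not_mem_nil, or_false] at hz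
        rcases hz with rfl | rfl <;> assumption
      · exact hsub (hmem p hp z hz)
    · intro u hu v hv
      simp only [List.mem_cons, exists_eq_or_imp, isPathEdge_two]
      by_cases hux : u = x
      · subst hux
        constructor
        · intro h
          exact Or.inl (Or.inl ⟨rfl, hS.eq_of_light hx hv hy h hxy⟩)
        · rintro ((⟨-, rfl⟩ | ⟨-, h⟩) | ⟨p, hp, h⟩)
          · exact hxy
          · exact absurd h hne
          · exact absurd h.mem.1 (hxP p hp)
      by_cases huy : u = y
      · subst huy
        constructor
        · intro h
          exact Or.inl (Or.inr ⟨hS.eq_of_light hy hv hx h hyx, rfl⟩)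
        · rintro ((⟨h, -⟩ | ⟨rfl, -⟩) | ⟨p, hp, h⟩)
          · exact absurd h hne.symm
          · exact hyx
          · exact absurd h.mem.1 (hyP p hp)
      by_cases hvx : v = x
      · subst hvx
        constructor
        · intro h
          exact absurd (hS.eq_of_light hx hu hy (by rw [K.symm]; exact h) hxy) huy
        · rintro ((⟨h, -⟩ | ⟨-, h⟩) | ⟨p, hp, h⟩)
          · exact absurd h hux
          · exact absurd h huy
          · exact absurd h.mem.2 (hxP p hp)
      by_cases hvy : v = y
      · subst hvy
        constructor
        · intro h
          exact absurd (hS.eq_of_light hy hu hx (by rw [K.symm]; exact h) hyx) hux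
        · rintro ((⟨h, -⟩ | ⟨-, h⟩) | ⟨p, hp, h⟩)
          · exact absurd h hux
          · exact absurd h huy
          · exact absurd h.mem.2 (hyP p hp)
      rw [hiff u (by simp [hux, huy, hu]) v (by simp [hvx, hvy, hv])]
      simp [hux, huy]
  · push Not at hex
    exact ⟨[], by simp, by simp, by simp, fun x hx y hy => by simp [hex x hx y hy]⟩

end PathLists

/-! ### Near matched sets give members of the family -/

section KPrime

variable {r : ℕ} {K : StdMultigraph (Fin r)}

theorem mult_eq_ite {P : Prop} [Decidable P] {x y : Fin r} (h1 : 1 ≤ K.mult x y)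
    (h : K.mult x y = 1 ↔ P) : K.mult x y = if P then 1 else 2 := by
  have := K.le_two x y
  by_cases hP : P
  · rw [if_pos hP]; exact h.2 hP
  · rw [if_neg hP]
    have : K.mult x y ≠ 1 := fun h' => hP (h.1 h')
    omega

theorem mem_KPrime_of_isMatched (h : K.IsMatched univ) : K ∈ KPrime r := by
  classical
  obtain ⟨Ps, h2, hnd, -, hiff⟩ := h.exists_list
  refine ⟨Ps, fun p hp h0 => ?_, hnd, ?_, Or.inl fun i hi => ?_, fun x y hxy => ?_⟩
  · have := h2 p hp
    rw [h0] at this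
    simp at this
  · refine List.pairwise_of_forall_mem_list fun p hp q hq => ?_
    rw [h2 p hp, h2 q hq]
  · rw [h2 _ (List.getElem_mem hi)]
    split_ifs <;> norm_num
  · exact mult_eq_ite (h.1 x (mem_univ _) y (mem_univ _) hxy)
      (hiff x (mem_univ _) y (mem_univ _))

/-- `P` is closed under light edges and contains the exceptional vertex, so what remains is matched
and contributes only paths on two vertices. The first alternative in `KPrime` is enough. -/
theorem mem_KPrime_of_path (hadj : ∀ x y, x ≠ y → 1 ≤ K.mult x y) (P : List (Fin r))
    (hnd : P.Nodup) (hP2 : 2 ≤ P.length) (hP4 : P.length ≤ 4)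
    (hP : ∀ u ∈ P, ∀ v, K.mult u v = 1 ↔ IsPathEdge P u v) {a : Fin r} (ha : a ∈ P)
    (h : K.IsMatched (univ.erase a)) : K ∈ KPrime r := by
  classical
  have hS : K.IsMatched (univ \ P.toFinset) := h.mono fun x hx => by
    rw [Finset.mem_sdiff, List.mem_toFinset] at hx
    exact Finset.mem_erase.2 ⟨fun h' => hx.2 (h' ▸ ha), mem_univ _⟩
  have hmemS : ∀ x, x ∈ univ \ P.toFinset ↔ x ∉ P := fun x => by simp
  obtain ⟨Ps, h2, hnd', hmem, hiff⟩ := hS.exists_list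
  refine ⟨P :: Ps, fun p hp h0 => ?_, ?_, ?_, Or.inl fun i hi => ?_, fun x y hxy => ?_⟩
  · rcases List.mem_cons.1 hp with rfl | hp
    · rw [h0] at hP2; simp at hP2
    · have := h2 p hp
      rw [h0] at this
      simp at this
  · rw [List.flatten_cons, List.nodup_append]
    refine ⟨hnd, hnd', fun x hx y hy hxy => ?_⟩
    obtain ⟨p, hp, hyp⟩ := List.mem_flatten.1 hy
    exact (hmemS y).1 (hmem p hp y hyp) (hxy ▸ hx)
  · rw [List.pairwise_cons]
    refine ⟨fun q hq => by rw [h2 q hq]; exact hP2, ?_⟩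
    refine List.pairwise_of_forall_mem_list fun p hp q hq => ?_
    rw [h2 p hp, h2 q hq]
  · cases i with
    | zero => simpa using hP4
    | succ i =>
      have hi' : i < Ps.length := by simpa using hi
      simp [h2 _ (List.getElem_mem hi')]
  · refine mult_eq_ite (hadj x y hxy) ?_
    simp only [List.mem_cons, exists_eq_or_imp]
    by_cases hx : x ∈ P
    · rw [hP x hx y]
      refine ⟨Or.inl, ?_⟩
      rintro (h' | ⟨p, hp, h'⟩)
      · exact h'
      · exact absurd hx ((hmemS x).1 (hmem p hp x h'.mem.1))
    by_cases hy : y ∈ P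
    · have hsymm : IsPathEdge P x y ↔ IsPathEdge P y x := Or.comm
      rw [K.symm, hP y hy x, hsymm]
      refine ⟨Or.inl, ?_⟩
      rintro (h' | ⟨p, hp, h'⟩)
      · exact h'
      · exact absurd hy ((hmemS y).1 (hmem p hp y h'.mem.2))
    rw [hiff x ((hmemS x).2 hx) y ((hmemS y).2 hy)]
    exact ⟨Or.inr, fun h' => h'.resolve_left fun h'' => hx h''.mem.1⟩

/-- The light component of the exceptional vertex `a` is a path. At most two neighbours of `a`
continue it, and since at most one of them has another light edge, four vertices suffice. -/
theorem mem_KPrime_of_isNearMatched (h : K.IsNearMatched univ) : K ∈ KPrime r := by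
  classical
  have hadj' := h.adj
  have hadj : ∀ x y, x ≠ y → 1 ≤ K.mult x y := fun x y =>
    hadj' x (mem_univ _) y (mem_univ _)
  rcases h with h | ⟨a, -, hm, -, h2, h1⟩
  · exact mem_KPrime_of_isMatched h
  set L : Finset (Fin r) := {y ∈ univ.erase a | K.mult a y = 1} with hL
  have hne : ∀ x y, K.mult x y = 1 → x ≠ y := by
    rintro x y h rfl
    rw [K.loopless] at h
    norm_num at h
  have hmemL : ∀ v, K.mult a v = 1 ↔ v ∈ L := fun v => by
    rw [hL, Finset.mem_filter, Finset.mem_erase]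
    exact ⟨fun h => ⟨⟨(hne a v h).symm, mem_univ _⟩, h⟩, fun h => h.2⟩
  have hnone : ∀ y, y ≠ a → K.lightDeg (univ.erase a) y = 0 → ∀ v, K.mult y v = 1 → v = a := by
    intro y hy h0 v hv
    by_contra hva
    exact lightDeg_ne_zero (Finset.mem_erase.2 ⟨hva, mem_univ v⟩) hv h0
  have hsome : ∀ y, y ≠ a → K.lightDeg (univ.erase a) y ≠ 0 → ∃ y', y' ≠ a ∧ K.mult y y' = 1 ∧
      ∀ v, v ≠ a → K.mult y v = 1 → v = y' := by
    intro y hy h0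
    obtain ⟨y', hy'⟩ := Finset.card_ne_zero.1 h0
    rw [Finset.mem_filter] at hy'
    refine ⟨y', (Finset.mem_erase.1 hy'.1).1, hy'.2, fun v hv hyv => ?_⟩
    exact hm.eq_of_light (Finset.mem_erase.2 ⟨hy, mem_univ _⟩)
      (Finset.mem_erase.2 ⟨hv, mem_univ _⟩) hy'.1 hyv hy'.2
  have hcases : #L = 0 ∨ #L = 1 ∨ #L = 2 := by
    have : #L ≤ 2 := h2
    omega
  rcases hcases with h0 | h0 | h0
  · rw [Finset.card_eq_zero] at h0
    refine mem_KPrime_of_isMatched ?_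
    rw [← Finset.insert_erase (mem_univ a)]
    refine hm.insert_heavy fun y hy => ?_
    have h3 := hadj a y (Finset.mem_erase.1 hy).1.symm
    have h4 : K.mult a y ≠ 1 := fun h => by
      rw [hmemL, h0] at h
      exact absurd h (Finset.notMem_empty _)
    have := K.le_two a y
    omega
  · obtain ⟨y, hy⟩ := Finset.card_eq_one.1 h0
    have hay : ∀ v, K.mult a v = 1 ↔ v = y := fun v => by rw [hmemL, hy, Finset.mem_singleton]
    have hya1 : K.mult y a = 1 := by rw [K.symm]; exact (hay y).2 rfl
    have hya : y ≠ a := hne _ _ hya1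
    by_cases hl : K.lightDeg (univ.erase a) y = 0
    · have h3 := hnone y hya hl
      refine mem_KPrime_of_path hadj [a, y] (by simp [hya.symm]) (by simp) (by simp) ?_
        (a := a) (by simp) hm
      intro u hu v
      rw [isPathEdge_two]
      simp only [List.mem_cons, List.not_mem_nil, or_false] at hu
      grind
    · obtain ⟨y', hy'a, hyy', huniq⟩ := hsome y hya hl
      have hy'y : K.mult y' y = 1 := by rw [K.symm]; exact hyy'
      have hney : y ≠ y' := hne _ _ hyy'
      have h3 : ∀ v, K.mult y' v = 1 → v = y := by
        intro v hv
        by_cases hva : v = a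
        · subst hva
          rw [K.symm, hay] at hv
          exact absurd hv hney.symm
        · exact hm.eq_of_light (Finset.mem_erase.2 ⟨hy'a, mem_univ _⟩)
            (Finset.mem_erase.2 ⟨hva, mem_univ _⟩) (Finset.mem_erase.2 ⟨hya, mem_univ _⟩) hv hy'y
      refine mem_KPrime_of_path hadj [a, y, y'] (by simp [hya.symm, hy'a.symm, hney]) (by simp)
        (by simp) ?_ (a := a) (by simp) hm
      intro u hu v
      rw [isPathEdge_three]
      simp only [List.mem_cons, List.not_mem_nil, or_false] at hu
      grind
  · obtain ⟨y, z, hyz, hy⟩ := Finset.card_eq_two.1 h0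
    -- By symmetry `y` may be taken as the neighbour with no further light edge, so the path ends
    -- there and can continue only beyond `z`.
    have hfour : ∀ y z, y ≠ z → (∀ v, K.mult a v = 1 ↔ v = y ∨ v = z) →
        K.lightDeg (univ.erase a) y = 0 → K ∈ KPrime r := by
      intro y z hyz hay hl
      have hya1 : K.mult y a = 1 := by rw [K.symm]; exact (hay y).2 (Or.inl rfl)
      have hya : y ≠ a := hne _ _ hya1
      have hza1 : K.mult z a = 1 := by rw [K.symm]; exact (hay z).2 (Or.inr rfl)
      have hza : z ≠ a := hne _ _ hza1
      have h3 := hnone y hya hl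
      by_cases hlz : K.lightDeg (univ.erase a) z = 0
      · have h4 := hnone z hza hlz
        refine mem_KPrime_of_path hadj [y, a, z] (by simp [hya, hza.symm, hyz]) (by simp)
          (by simp) ?_ (a := a) (by simp) hm
        intro u hu v
        rw [isPathEdge_three]
        simp only [List.mem_cons, List.not_mem_nil, or_false] at hu
        grind
      · obtain ⟨z', hz'a, hzz', huniq⟩ := hsome z hza hlz
        have hz'z : K.mult z' z = 1 := by rw [K.symm]; exact hzz'
        have hnez : z ≠ z' := hne _ _ hzz'
        have hyz' : y ≠ z' := by
          rintro rfl
          exact hza (h3 z hz'z)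
        have h4 : ∀ v, K.mult z' v = 1 → v = z := by
          intro v hv
          by_cases hva : v = a
          · subst hva
            rw [K.symm, hay] at hv
            rcases hv with hv | hv
            · exact absurd hv.symm hyz'
            · exact absurd hv hnez.symm
          · exact hm.eq_of_light (Finset.mem_erase.2 ⟨hz'a, mem_univ _⟩)
              (Finset.mem_erase.2 ⟨hva, mem_univ _⟩) (Finset.mem_erase.2 ⟨hza, mem_univ _⟩) hv hz'z
        refine mem_KPrime_of_path hadj [y, a, z, z']
          (by simp [hya, hza.symm, hyz, hyz', hz'a.symm, hnez]) (by simp)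
          (by simp) ?_ (a := a) (by simp) hm
        intro u hu v
        rw [isPathEdge_four]
        simp only [List.mem_cons, List.not_mem_nil, or_false] at hu
        grind
    have hay : ∀ v, K.mult a v = 1 ↔ v = y ∨ v = z := fun v => by
      rw [hmemL, hy, Finset.mem_insert, Finset.mem_singleton]
    by_cases hl : K.lightDeg (univ.erase a) y = 0
    · exact hfour y z hyz hay hl
    · refine hfour z y hyz.symm (fun v => by rw [hay, or_comm]) ?_
      by_contra hlz
      rw [Finset.card_le_one] at h1
      have hyL : y ∈ L := by rw [hy]; simp
      have hzL : z ∈ L := by rw [hy]; simp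
      rw [hL, Finset.mem_filter] at hyL hzL
      exact hyz (h1 y (Finset.mem_filter.2 ⟨hyL.1, hyL.2, hl⟩) z
        (Finset.mem_filter.2 ⟨hzL.1, hzL.2, hlz⟩))

end KPrime

/-! ### Relabelling the vertices of a tile -/

section Comap

variable {α ι : Type*} [DecidableEq α] [DecidableEq ι]

/-- The multigraph on `α` induced by an injection of `α` into the vertices of `R`. -/
def comap (R : StdMultigraph ι) (f : α ↪ ι) : StdMultigraph α where
  mult x y := R.mult (f x) (f y)
  symm _ _ := R.symm _ _
  loopless _ := R.loopless _
  le_two _ _ := R.le_two _ _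

variable {R : StdMultigraph ι} {f : α ↪ ι} {Y : Finset α}

theorem lightDeg_comap (x : α) : (R.comap f).lightDeg Y x = R.lightDeg (Y.map f) (f x) := by
  unfold lightDeg
  rw [Finset.filter_map, Finset.card_map]
  rfl

theorem IsMatched.comap (h : R.IsMatched (Y.map f)) : (R.comap f).IsMatched Y := by
  refine ⟨fun x hx y hy hxy => h.1 (f x) (Finset.mem_map_of_mem f hx) (f y)
    (Finset.mem_map_of_mem f hy) (fun h' => hxy (f.injective h')), fun x hx => ?_⟩
  rw [lightDeg_comap]
  exact h.2 _ (Finset.mem_map_of_mem f hx)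

theorem IsNearMatched.comap (h : R.IsNearMatched (Y.map f)) : (R.comap f).IsNearMatched Y := by
  rcases h with h | ⟨b, hb, hm, hadj, h2, h1⟩
  · exact h.comap.near
  · obtain ⟨a, ha, rfl⟩ := Finset.mem_map.1 hb
    rw [← Finset.map_erase] at hm hadj h2 h1
    refine Or.inr ⟨a, ha, hm.comap, fun y hy => hadj _ (Finset.mem_map_of_mem f hy), ?_, ?_⟩
    · rw [lightDeg_comap]; exact h2
    · rw [Finset.filter_map, Finset.card_map] at h1
      refine (Finset.card_le_card fun y hy => ?_).trans h1
      rw [Finset.mem_filter, lightDeg_comap] at hy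
      exact Finset.mem_filter.2 hy

end Comap

/-! ### Greedy embedding of tiles into regular classes -/

section Embedding

variable {V ι : Type*} [DecidableEq ι]

theorem pairCount_eq_sum (G : StdMultigraph V) (k : ℕ) (A B : Finset V) :
    G.pairCount k A B = ∑ a ∈ A, #{b ∈ B | k ≤ G.mult a b} := by
  unfold pairCount
  rw [Finset.card_filter, Finset.sum_product]
  exact Finset.sum_congr rfl fun a _ => (Finset.card_filter _ _).symm

/-- A clique of the reduced multigraph can be embedded into large subsets of its classes. -/
theorem exists_embedding [Nonempty V] (G : StdMultigraph V) (R : StdMultigraph ι)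
    (C : ι → Finset V) {d ε : ℝ} (hd : 0 < d) (hd2 : d ≤ 2) (hε : 0 < ε)
    (hreg : ∀ i j, i ≠ j → ∀ A ⊆ C i, ∀ B ⊆ C j, ε * #(C i) ≤ #A → ε * #(C j) ≤ #B →
      d / 2 * (#A * #B) ≤ G.pairCount (R.mult i j) A B) {N : ℕ} (Z : Finset ι) (hZ : #Z ≤ N)
    (W : ι → Finset V) (hWC : ∀ i ∈ Z, W i ⊆ C i) (hWne : ∀ i ∈ Z, (W i).Nonempty)
    (hW : ∀ i ∈ Z, N * ε * (2 / d) ^ #Z * #(C i) ≤ #(W i)) :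
    ∃ v : ι → V, (∀ i ∈ Z, v i ∈ W i) ∧
      ∀ i ∈ Z, ∀ j ∈ Z, i ≠ j → R.mult i j ≤ G.mult (v i) (v j) := by
  classical
  induction Z using Finset.induction_on generalizing W with
  | empty => exact ⟨fun _ => Classical.arbitrary V, by simp, by simp⟩
  | insert i₀ Z hi₀ ih =>
    rw [Finset.card_insert_of_notMem hi₀] at hZ hW
    have hN1 : (1 : ℝ) ≤ N := by exact_mod_cast (by omega : 1 ≤ N)
    have h1d : 1 ≤ 2 / d := by rw [le_div_iff₀ hd]; linarith
    have hmem : i₀ ∈ insert i₀ Z := Finset.mem_insert_self _ _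
    have hlarge : ∀ i ∈ insert i₀ Z, N * ε * #(C i) ≤ #(W i) := fun i hi => by
      refine le_trans ?_ (hW i hi)
      refine mul_le_mul_of_nonneg_right ?_ (Nat.cast_nonneg _)
      exact le_mul_of_one_le_right (by positivity) (one_le_pow₀ h1d)
    have hlarge' : ∀ i ∈ insert i₀ Z, ε * #(C i) ≤ #(W i) := fun i hi => by
      refine le_trans ?_ (hlarge i hi)
      refine mul_le_mul_of_nonneg_right ?_ (Nat.cast_nonneg _)
      exact le_mul_of_one_le_left hε.le hN1
    have hC₀ : (0 : ℝ) < #(C i₀) := by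
      exact_mod_cast Finset.card_pos.2 ((hWne i₀ hmem).mono (hWC i₀ hmem))
    have hne : ∀ j ∈ Z, i₀ ≠ j := by rintro j hj rfl; exact hi₀ hj
    -- Choices for `i₀` with too few neighbours left in `W j`. Regularity bounds each such set by `ε
    -- * #(C i₀)`, so fewer than `N` of them cannot exhaust `W i₀`. After a good choice every other
    -- candidate set keeps a share `d / 2`, as the powers of `2 / d` allow.
    set B : ι → Finset V := fun j =>
      {v ∈ W i₀ | (#{u ∈ W j | R.mult i₀ j ≤ G.mult v u} : ℝ) < d / 2 * #(W j)} with hB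
    have hBsmall : ∀ j ∈ Z, (#(B j) : ℝ) < ε * #(C i₀) := by
      intro j hj
      by_contra! hge
      have hBpos : (0 : ℝ) < #(B j) := lt_of_lt_of_le (by positivity) hge
      have hBne : (B j).Nonempty := by
        rw [← Finset.card_pos]; exact_mod_cast hBpos
      have h1 := hreg i₀ j (hne j hj) (B j)
        ((Finset.filter_subset _ _).trans (hWC i₀ hmem)) (W j)
        (hWC j (Finset.mem_insert_of_mem hj)) hge (hlarge' j (Finset.mem_insert_of_mem hj))
      rw [pairCount_eq_sum, Nat.cast_sum] at h1
      have h2 : ∑ v ∈ B j, (#{u ∈ W j | R.mult i₀ j ≤ G.mult v u} : ℝ)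
          < ∑ v ∈ B j, d / 2 * #(W j) :=
        Finset.sum_lt_sum_of_nonempty hBne fun v hv => (Finset.mem_filter.1 hv).2
      rw [Finset.sum_const, nsmul_eq_mul] at h2
      linarith
    have hex : ∃ v₀ ∈ W i₀, v₀ ∉ Z.biUnion B := by
      by_contra! hno
      have h1 : (#(W i₀) : ℝ) ≤ ∑ j ∈ Z, (#(B j) : ℝ) := by
        exact_mod_cast (Finset.card_le_card hno).trans Finset.card_biUnion_le
      have h2 : ∑ j ∈ Z, (#(B j) : ℝ) ≤ #Z * (ε * #(C i₀)) := by
        refine (Finset.sum_le_sum fun j hj => (hBsmall j hj).le).trans ?_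
        rw [Finset.sum_const, nsmul_eq_mul]
      have h3 := hlarge i₀ hmem
      have h4 : (#Z : ℝ) + 1 ≤ N := by exact_mod_cast hZ
      have h5 : 0 < ε * #(C i₀) := by positivity
      nlinarith
    obtain ⟨v₀, hv₀, hv₀B⟩ := hex
    have hnb : ∀ j ∈ Z, d / 2 * #(W j) ≤ #{u ∈ W j | R.mult i₀ j ≤ G.mult v₀ u} := by
      intro j hj
      by_contra! hlt
      exact hv₀B (Finset.mem_biUnion.2 ⟨j, hj, Finset.mem_filter.2 ⟨hv₀, hlt⟩⟩)
    obtain ⟨v, hv, hvm⟩ := ih (by omega) (fun j => {u ∈ W j | R.mult i₀ j ≤ G.mult v₀ u})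
      (fun j hj => (Finset.filter_subset _ _).trans (hWC j (Finset.mem_insert_of_mem hj)))
      (fun j hj => by
        rw [← Finset.card_pos]
        have h1 : (0 : ℝ) < #(W j) := by
          exact_mod_cast Finset.card_pos.2 (hWne j (Finset.mem_insert_of_mem hj))
        have h2 := lt_of_lt_of_le (by positivity) (hnb j hj)
        exact_mod_cast h2)
      (fun j hj => by
        refine le_trans ?_ (hnb j hj)
        have h1 := hW j (Finset.mem_insert_of_mem hj)
        have h2 := mul_le_mul_of_nonneg_left h1 (by positivity : 0 ≤ d / 2)
        refine le_trans (le_of_eq ?_) h2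
        rw [pow_succ]
        field_simp)
    refine ⟨Function.update v i₀ v₀, fun i hi => ?_, fun i hi j hj hij => ?_⟩
    · rcases eq_or_ne i i₀ with rfl | h
      · simpa using hv₀
      · rw [Function.update_of_ne h]
        exact (Finset.mem_filter.1 (hv i (Finset.mem_of_mem_insert_of_ne hi h))).1
    · rcases eq_or_ne i i₀ with rfl | h
      · have hj' := Finset.mem_of_mem_insert_of_ne hj hij.symm
        rw [Function.update_self, Function.update_of_ne hij.symm]
        exact (Finset.mem_filter.1 (hv j hj')).2
      · have hi' := Finset.mem_of_mem_insert_of_ne hi h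
        rcases eq_or_ne j i₀ with rfl | h'
        · rw [Function.update_self, Function.update_of_ne h, R.symm, G.symm]
          exact (Finset.mem_filter.1 (hv i hi')).2
        · rw [Function.update_of_ne h, Function.update_of_ne h']
          exact hvm i hi' j (Finset.mem_of_mem_insert_of_ne hj h') hij

/-- `S` is the vertex set of a copy in `G` of a member of `𝒦'_r`. -/
def IsTile (G : StdMultigraph V) (r : ℕ) (S : Finset V) : Prop :=
  ∃ H ∈ KPrime r, ∃ c : Copy H G, c.verts = (S : Set V)

theorem IsTile.card_eq {G : StdMultigraph V} {r : ℕ} {S : Finset V} (h : G.IsTile r S) :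
    #S = r := by
  obtain ⟨H, -, c, hc⟩ := h
  have h1 := Set.ncard_coe_finset S
  rw [← hc, Copy.verts, ← Set.image_univ, Set.ncard_image_of_injective _ c.toEmbedding.injective,
    Set.ncard_univ, Nat.card_fin] at h1
  exact h1.symm

theorem isTile_image [DecidableEq V] {G : StdMultigraph V} {R : StdMultigraph ι} {r : ℕ}
    {Z : Finset ι} (hZ : R.IsNearMatched Z) (hr : #Z = r) {v : ι → V}
    (hinj : Set.InjOn v Z) (hv : ∀ i ∈ Z, ∀ j ∈ Z, i ≠ j → R.mult i j ≤ G.mult (v i) (v j)) :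
    G.IsTile r (Z.image v) := by
  set e := (Z.equivFinOfCardEq hr).symm with he
  set f : Fin r ↪ ι := e.toEmbedding.trans (Function.Embedding.subtype _) with hf
  have hfe : ∀ i, f i = (e i : ι) := fun i => rfl
  have hfZ : ∀ i, f i ∈ Z := fun i => (e i).2
  have hmap : univ.map f = Z := by
    ext i
    simp only [Finset.mem_map, Finset.mem_univ, true_and]
    refine ⟨fun ⟨k, hk⟩ => hk ▸ hfZ k, fun hi => ⟨e.symm ⟨i, hi⟩, ?_⟩⟩
    rw [hfe, Equiv.apply_symm_apply]
  refine ⟨R.comap f, mem_KPrime_of_isNearMatched (IsNearMatched.comap (by rwa [hmap])),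
    ⟨⟨fun k => v (f k), fun k l hkl => f.injective (hinj (hfZ k) (hfZ l) hkl)⟩, fun k l => ?_⟩, ?_⟩
  · rcases eq_or_ne k l with rfl | hkl
    · rw [(R.comap f).loopless]; exact Nat.zero_le _
    · exact hv _ (hfZ k) _ (hfZ l) fun h => hkl (f.injective h)
  · ext u
    simp only [Copy.verts, Set.mem_range, Finset.coe_image,
      Set.mem_image, Finset.mem_coe]
    constructor
    · rintro ⟨k, rfl⟩
      exact ⟨f k, hfZ k, rfl⟩
    · rintro ⟨i, hi, rfl⟩
      refine ⟨e.symm ⟨i, hi⟩, ?_⟩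
      change v (f (e.symm ⟨i, hi⟩)) = v i
      rw [hfe, Equiv.apply_symm_apply]

theorem exists_tiling_of_tiles [Fintype V] {G : StdMultigraph V} {r : ℕ} (T : Finset (Finset V))
    (hT : ∀ S ∈ T, G.IsTile r S) (hdisj : ∀ S ∈ T, ∀ S' ∈ T, S ≠ S' → Disjoint S S') :
    ∃ 𝒯 : Tiling (KPrime r) G, (𝒯.coveredᶜ).ncard + r * #T = Fintype.card V := by
  classical
  choose H hH c hc using hT
  set e := T.equivFin.symm with he
  refine ⟨⟨#T, fun i => H _ (e i).2, fun i => hH _ (e i).2, fun i => c _ (e i).2, fun i j hij => ?_⟩, ?_⟩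
  · rw [hc _ (e i).2, hc _ (e j).2, Finset.disjoint_coe]
    exact hdisj _ (e i).2 _ (e j).2 fun h => hij (e.injective (Subtype.ext h))
  · have hcov : (⋃ i, (c _ (e i).2).verts) = ((T.biUnion id : Finset V) : Set V) := by
      ext u
      simp only [Set.mem_iUnion, Finset.coe_biUnion, id, Finset.mem_coe]
      constructor
      · rintro ⟨i, hi⟩
        rw [hc _ (e i).2] at hi
        exact ⟨_, (e i).2, hi⟩
      · rintro ⟨S, hS, hu⟩
        refine ⟨e.symm ⟨S, hS⟩, ?_⟩
        rw [hc _ (e _).2, Equiv.apply_symm_apply]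
        exact hu
    change ((⋃ i, (c _ (e i).2).verts)ᶜ).ncard + r * #T = Fintype.card V
    rw [hcov, ← Finset.coe_compl, Set.ncard_coe_finset]
    have h1 : #(T.biUnion id) = r * #T := by
      rw [Finset.card_biUnion (t := id) hdisj, Finset.sum_congr rfl fun S hS =>
        (show #(id S) = r from IsTile.card_eq ⟨_, hH S hS, c S hS, hc S hS⟩), Finset.sum_const,
        smul_eq_mul, mul_comm]
    rw [← h1, add_comm, Finset.card_add_card_compl]

open Classical in
/-- Greedy tiling: a multiset of near matched sets of classes that uses no class too often can be
embedded disjointly. -/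
theorem exists_disjoint_tiles [Nonempty V] (G : StdMultigraph V) (R : StdMultigraph ι)
    (C : ι → Finset V) (hC : ∀ i j, i ≠ j → Disjoint (C i) (C j)) {d ε ρ : ℝ}
    (hd : 0 < d) (hd2 : d ≤ 2) (hε : 0 < ε)
    (hreg : ∀ i j, i ≠ j → ∀ A ⊆ C i, ∀ B ⊆ C j, ε * #(C i) ≤ #A → ε * #(C j) ≤ #B →
      d / 2 * (#A * #B) ≤ G.pairCount (R.mult i j) A B) {r : ℕ} (hr : 1 ≤ r)
    (hρ : r * ε * (2 / d) ^ r ≤ ρ) (M : Multiset (Finset ι))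
    (hM : ∀ Z ∈ M, R.IsNearMatched Z ∧ #Z = r)
    (hcount : ∀ i, (M.countP (fun Z => i ∈ Z) : ℝ) ≤ (1 - ρ) * #(C i)) :
    ∃ T : Finset (Finset V), (∀ S ∈ T, G.IsTile r S) ∧
      (∀ S ∈ T, ∀ S' ∈ T, S ≠ S' → Disjoint S S') ∧ #T = Multiset.card M ∧
      ∀ i, #{v ∈ C i | ∃ S ∈ T, v ∈ S} ≤ M.countP (fun Z => i ∈ Z) := by
  classical
  have hρ0 : 0 ≤ ρ := le_trans (by positivity) hρ
  induction M using Multiset.induction_on with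
  | empty => exact ⟨∅, by simp, by simp, by simp, by simp⟩
  | cons Z M ih =>
    have hle : ∀ i, M.countP (fun Z => i ∈ Z) ≤ (Z ::ₘ M).countP (fun Z => i ∈ Z) := fun i =>
      Multiset.countP_le_of_le _ (Multiset.le_cons_self _ _)
    obtain ⟨T, hT, hdisj, hcard, huse⟩ := ih (fun Y hY => hM Y (Multiset.mem_cons_of_mem hY))
      (fun i => le_trans (by exact_mod_cast hle i) (hcount i))
    obtain ⟨hZ, hZr⟩ := hM Z (Multiset.mem_cons_self _ _)
    set W : ι → Finset V := fun i => {v ∈ C i | ¬ ∃ S ∈ T, v ∈ S} with hW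
    have hWC : ∀ i, W i ⊆ C i := fun i => Finset.filter_subset _ _
    -- The tile about to be placed counts in `hcount` but has not used a vertex yet. The extra one
    -- keeps `W i` nonempty even if `ρ` is zero.
    have hWcard : ∀ i ∈ Z, ρ * #(C i) + 1 ≤ #(W i) := by
      intro i hi
      have h1 : #{v ∈ C i | ∃ S ∈ T, v ∈ S} + #(W i) = #(C i) :=
        Finset.card_filter_add_card_filter_not _
      have h2 := hcount i
      rw [Multiset.countP_cons_of_pos (p := fun Z => i ∈ Z) M hi] at h2
      have h3 : (#{v ∈ C i | ∃ S ∈ T, v ∈ S} : ℝ) ≤ M.countP (fun Z => i ∈ Z) := by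
        exact_mod_cast huse i
      have h4 : (#{v ∈ C i | ∃ S ∈ T, v ∈ S} : ℝ) + #(W i) = #(C i) := by exact_mod_cast h1
      push_cast at h2
      linarith
    obtain ⟨v, hv, hvm⟩ := exists_embedding G R C hd hd2 hε hreg Z hZr.le W (fun i _ => hWC i)
      (fun i hi => by
        rw [← Finset.card_pos]
        have h1 : (0 : ℝ) < #(W i) := lt_of_lt_of_le (by positivity) (hWcard i hi)
        exact_mod_cast h1)
      (fun i hi => by
        rw [hZr]
        have h1 := mul_le_mul_of_nonneg_right hρ (Nat.cast_nonneg (α := ℝ) #(C i))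
        linarith [hWcard i hi])
    have hvC : ∀ i ∈ Z, v i ∈ C i := fun i hi => hWC i (hv i hi)
    have hvC' : ∀ i ∈ Z, ∀ j, v i ∈ C j → i = j := fun i hi j hj => by
      by_contra hij
      exact Finset.disjoint_left.1 (hC i j hij) (hvC i hi) hj
    have hinj : Set.InjOn v Z := fun i hi j hj hij =>
      hvC' i hi j (hij ▸ hvC j hj)
    have hnew : ∀ u ∈ Z.image v, ∀ S ∈ T, u ∉ S := by
      intro u hu S hS huS
      obtain ⟨i, hi, rfl⟩ := Finset.mem_image.1 hu
      exact (Finset.mem_filter.1 (hv i hi)).2 ⟨S, hS, huS⟩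
    have hZne : Z.Nonempty := Finset.card_pos.1 (by omega)
    have hnotin : Z.image v ∉ T := fun h => by
      obtain ⟨u, hu⟩ := hZne.image v
      exact hnew u hu _ h hu
    refine ⟨insert (Z.image v) T, ?_, ?_, ?_, ?_⟩
    · intro S hS
      rcases Finset.mem_insert.1 hS with rfl | hS
      · exact isTile_image hZ hZr hinj hvm
      · exact hT S hS
    · intro S hS S' hS' hne
      rcases Finset.mem_insert.1 hS with rfl | hS <;> rcases Finset.mem_insert.1 hS' with rfl | hS'
      · exact absurd rfl hne
      · exact Finset.disjoint_left.2 fun u hu => hnew u hu S' hS'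
      · exact Finset.disjoint_right.2 fun u hu => hnew u hu S hS
      · exact hdisj S hS S' hS' hne
    · rw [Finset.card_insert_of_notMem hnotin, hcard, Multiset.card_cons]
    · intro i
      have hsub : ({u ∈ C i | ∃ S ∈ insert (Z.image v) T, u ∈ S} : Finset V)
          ⊆ ({u ∈ C i | u ∈ Z.image v} : Finset V) ∪ {u ∈ C i | ∃ S ∈ T, u ∈ S} := by
        intro u hu
        simp only [Finset.mem_filter, Finset.mem_insert, exists_eq_or_imp] at hu
        simp only [Finset.mem_union, Finset.mem_filter]
        tauto
      have h1 := (Finset.card_le_card hsub).trans (Finset.card_union_le _ _)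
      have h2 : ∀ u ∈ ({u ∈ C i | u ∈ Z.image v} : Finset V), i ∈ Z ∧ u = v i := by
        intro u hu
        rw [Finset.mem_filter] at hu
        obtain ⟨j, hj, rfl⟩ := Finset.mem_image.1 hu.2
        obtain rfl := hvC' j hj i hu.1
        exact ⟨hj, rfl⟩
      by_cases hi : i ∈ Z
      · rw [Multiset.countP_cons_of_pos (p := fun Z => i ∈ Z) M hi]
        have h3 : #{u ∈ C i | u ∈ Z.image v} ≤ 1 := by
          refine Finset.card_le_one.2 fun a ha b hb => ?_
          rw [(h2 a ha).2, (h2 b hb).2]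
        have := huse i
        omega
      · rw [Multiset.countP_cons_of_neg (p := fun Z => i ∈ Z) M hi]
        have h3 : #{u ∈ C i | u ∈ Z.image v} = 0 := by
          rw [Finset.card_eq_zero, Finset.eq_empty_iff_forall_notMem]
          exact fun u hu => hi (h2 u hu).1
        have := huse i
        omega

end Embedding

/-! ### Edge counts by ordered pairs -/

section Counting

variable {V C : Type*}

theorem pairCount_comm (G : StdMultigraph V) (k : ℕ) (A B : Finset V) :
    G.pairCount k A B = G.pairCount k B A := by
  classical
  unfold pairCount
  refine Finset.card_bij (fun e _ => e.swap) ?_ ?_ ?_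
  · intro e he
    simp only [Finset.mem_filter, Finset.mem_product, Prod.fst_swap, Prod.snd_swap] at he ⊢
    exact ⟨he.1.symm, by rw [G.symm]; exact he.2⟩
  · intro e _ e' _ h
    exact Prod.swap_injective h
  · intro e he
    refine ⟨e.swap, ?_, Prod.swap_swap e⟩
    simp only [Finset.mem_filter, Finset.mem_product, Prod.fst_swap, Prod.snd_swap] at he ⊢
    exact ⟨he.1.symm, by rw [G.symm]; exact he.2⟩

theorem pairCount_zero (G : StdMultigraph V) (A B : Finset V) :
    G.pairCount 0 A B = #A * #B := by
  simp [pairCount]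

theorem pairCount_le (G : StdMultigraph V) (k : ℕ) (A B : Finset V) :
    G.pairCount k A B ≤ #A * #B := by
  rw [← Finset.card_product]
  exact Finset.card_filter_le _ _

theorem sum_degree_eq [Fintype V] (G : StdMultigraph V) (A : Finset V) :
    ∑ v ∈ A, G.degree v = G.pairCount 1 A univ + G.pairCount 2 A univ := by
  rw [pairCount_eq_sum, pairCount_eq_sum, ← Finset.sum_add_distrib]
  refine Finset.sum_congr rfl fun v _ => ?_
  rw [degree, Finset.card_filter, Finset.card_filter, ← Finset.sum_add_distrib]
  refine Finset.sum_congr rfl fun u _ => ?_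
  have := G.le_two v u
  interval_cases G.mult v u <;> simp

theorem pairCount_filter_right [Fintype V] [DecidableEq C] (G : StdMultigraph V) (f : V → C)
    (k : ℕ) (A : Finset V) (S : Finset C) :
    G.pairCount k A {v | f v ∈ S} = ∑ j ∈ S, G.pairCount k A (cls f j) := by
  classical
  unfold pairCount
  rw [Finset.card_eq_sum_card_fiberwise (f := fun e : V × V => f e.2) (t := S)]
  · refine Finset.sum_congr rfl fun j hj => congrArg Finset.card ?_
    ext e
    simp only [Finset.mem_filter, Finset.mem_product, Finset.mem_univ, true_and, mem_cls]
    constructor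
    · rintro ⟨⟨⟨h1, -⟩, h2⟩, h3⟩
      exact ⟨⟨h1, h3⟩, h2⟩
    · rintro ⟨⟨h1, rfl⟩, h2⟩
      exact ⟨⟨⟨h1, hj⟩, h2⟩, rfl⟩
  · intro e he
    have := (Finset.mem_product.1 (Finset.mem_filter.1 (Finset.mem_coe.1 he)).1).2
    exact Finset.mem_coe.2 (Finset.mem_filter.1 this).2

theorem card_filter_mem_eq_sum [Fintype V] [DecidableEq C] (f : V → C) (S : Finset C) :
    #({v | f v ∈ S} : Finset V) = ∑ i ∈ S, #(cls f i) := by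
  rw [Finset.card_eq_sum_card_fiberwise (f := f) (t := S)]
  · refine Finset.sum_congr rfl fun j hj => congrArg Finset.card ?_
    ext v
    simp only [Finset.mem_filter, Finset.mem_univ, true_and, mem_cls]
    exact ⟨fun h => h.2, fun h => ⟨h ▸ hj, h⟩⟩
  · intro v hv
    exact Finset.mem_coe.2 (Finset.mem_filter.1 (Finset.mem_coe.1 hv)).2

theorem sum_card_cls [Fintype V] [Fintype C] [DecidableEq C] (f : V → C) :
    ∑ i, #(cls f i) = Fintype.card V := by
  have := card_filter_mem_eq_sum f univ
  simp only [Finset.mem_univ, Finset.filter_true, Finset.card_univ] at this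
  exact this.symm

/-- Ordered pairs may count an edge twice, which is harmless for the upper bounds in `IsExtremal`.
-/
theorem ncard_edgeSet_le [Fintype V] (H : SimpleGraph V) (P : Finset (V × V))
    (h : ∀ x y, H.Adj x y → (x, y) ∈ P) : H.edgeSet.ncard ≤ #P := by
  classical
  rw [← Set.ncard_coe_finset]
  refine le_trans (Set.ncard_le_ncard (t := (fun e : V × V => s(e.1, e.2)) '' P) ?_
    (Set.toFinite _)) (Set.ncard_image_le (Set.toFinite _))
  intro e
  induction e using Sym2.ind with
  | _ x y => exact fun he => ⟨(x, y), h x y he, rfl⟩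

theorem numHeavy_le [Fintype V] (G : StdMultigraph V) :
    G.numHeavy ≤ G.pairCount 2 univ univ :=
  ncard_edgeSet_le _ _ fun x y h => by
    have h' : G.mult x y = 2 := h
    simp [h']

theorem numEdges_le [Fintype V] (G : StdMultigraph V) :
    G.numEdges ≤ G.pairCount 1 univ univ + G.pairCount 2 univ univ := by
  classical
  have h1 : G.lightGraph.edgeSet.ncard ≤
      #{e ∈ (univ : Finset V) ×ˢ (univ : Finset V) | G.mult e.1 e.2 = 1} :=
    ncard_edgeSet_le _ _ fun x y h => by
      have h' : G.mult x y = 1 := h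
      simp [h']
  have h2 := G.numHeavy_le
  have h3 : #{e ∈ (univ : Finset V) ×ˢ (univ : Finset V) | G.mult e.1 e.2 = 1}
      + G.pairCount 2 univ univ = G.pairCount 1 univ univ := by
    unfold pairCount
    rw [← Finset.card_union_of_disjoint]
    · congr 1
      ext e
      simp only [Finset.mem_union, Finset.mem_filter, Finset.mem_product, Finset.mem_univ,
        true_and]
      omega
    · refine Finset.disjoint_filter.2 fun e _ h => ?_
      omega
  unfold numEdges
  omega

theorem pairCount_induce_le (G : StdMultigraph V) (k : ℕ) (S : Finset V) :
    (G.induce S).pairCount k univ univ ≤ G.pairCount k S S := by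
  classical
  refine Finset.card_le_card_of_injOn (fun e : S × S => ((e.1 : V), (e.2 : V))) ?_ ?_
  · intro e he
    have := (Finset.mem_filter.1 (Finset.mem_coe.1 he)).2
    exact Finset.mem_coe.2 (Finset.mem_filter.2
      ⟨Finset.mem_product.2 ⟨e.1.2, e.2.2⟩, this⟩)
  · rintro ⟨a, b⟩ - ⟨a', b'⟩ - h
    simp only [Prod.mk.injEq] at h
    exact Prod.ext (Subtype.ext h.1) (Subtype.ext h.2)

theorem minDegree_le_degree [Fintype V] (G : StdMultigraph V) (v : V) :
    G.minDegree ≤ G.degree v :=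
  ciInf_le (OrderBot.bddBelow _) v

end Counting

/-! ### The reduced multigraph -/

section Reduced

variable {V C : Type*} [Fintype V] [DecidableEq C]

theorem IsBad.symm {G : StdMultigraph V} {f : V → C} {d ε : ℝ} {k : ℕ} {i j : C}
    (h : G.IsBad f d ε k i j) : G.IsBad f d ε k j i := by
  obtain ⟨h1, A, B, hA, hB, hA', hB', h2⟩ := h
  refine ⟨?_, B, A, hB, hA, hB', hA', ?_⟩
  · rw [pairCount_comm, mul_comm (#(cls f j) : ℝ)]; exact h1
  · rw [pairCount_comm, mul_comm (#B : ℝ)]; exact h2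

/-- The pair `(i, j)` of classes is irregular for one of the two multiplicities. -/
def IsIrregular (G : StdMultigraph V) (f : V → C) (d ε : ℝ) (i j : C) : Prop :=
  G.IsBad f d ε 1 i j ∨ G.IsBad f d ε 2 i j

theorem isIrregular_comm {G : StdMultigraph V} {f : V → C} {d ε : ℝ} {i j : C} :
    G.IsIrregular f d ε i j ↔ G.IsIrregular f d ε j i :=
  ⟨fun h => h.imp IsBad.symm IsBad.symm, fun h => h.imp IsBad.symm IsBad.symm⟩

open Classical in
/-- The reduced multigraph on the classes of the partition `f`. -/
noncomputable def reduced (G : StdMultigraph V) (f : V → C) (d ε : ℝ) : StdMultigraph C where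
  mult i j :=
    if i = j ∨ G.IsIrregular f d ε i j then 0
    else if d * (#(cls f i) * #(cls f j)) ≤ G.pairCount 2 (cls f i) (cls f j) then 2
    else if d * (#(cls f i) * #(cls f j)) ≤ G.pairCount 1 (cls f i) (cls f j) then 1 else 0
  symm i j := by
    have h : (i = j ∨ G.IsIrregular f d ε i j) ↔ (j = i ∨ G.IsIrregular f d ε j i) :=
      or_congr eq_comm isIrregular_comm
    simp only [h]
    rw [mul_comm (#(cls f i) : ℝ), G.pairCount_comm 2 (cls f i), G.pairCount_comm 1 (cls f i)]
  loopless i := by simp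
  le_two i j := by split_ifs <;> norm_num

/-- Multiplicity zero demands nothing, since every pair then counts. This covers irregular pairs and
`i = j`. -/
theorem reduced_regular (G : StdMultigraph V) (f : V → C) {d : ℝ} (hd2 : d ≤ 2) (ε : ℝ)
    (i j : C) (A : Finset V) (hA : A ⊆ cls f i) (B : Finset V) (hB : B ⊆ cls f j)
    (hA' : ε * #(cls f i) ≤ #A) (hB' : ε * #(cls f j) ≤ #B) :
    d / 2 * (#A * #B) ≤ G.pairCount ((G.reduced f d ε).mult i j) A B := by
  have h0 : d / 2 * (#A * #B) ≤ G.pairCount 0 A B := by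
    rw [pairCount_zero]
    push_cast
    exact mul_le_of_le_one_left (by positivity) (by linarith)
  simp only [reduced]
  split_ifs with h1 h2 h3
  · exact h0
  · by_contra! hlt
    exact h1 (Or.inr (Or.inr ⟨h2, A, B, hA, hB, hA', hB', hlt⟩))
  · by_contra! hlt
    exact h1 (Or.inr (Or.inl ⟨h3, A, B, hA, hB, hA', hB', hlt⟩))
  · exact h0

open Classical in
/-- The weight of the classes that form an irregular pair with `i`. -/
noncomputable def irregularWeight [Fintype C] (G : StdMultigraph V) (f : V → C) (d ε : ℝ) (i : C) :
    ℝ :=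
  ∑ j with G.IsIrregular f d ε i j, (#(cls f j) : ℝ)

theorem sum_irregularWeight_le [Fintype C] (G : StdMultigraph V) (f : V → C) (d ε : ℝ) :
    ∑ i, (#(cls f i) : ℝ) * G.irregularWeight f d ε i ≤
      G.badWeight f d ε 1 + G.badWeight f d ε 2 := by
  classical
  unfold irregularWeight badWeight
  simp only [Finset.sum_filter]
  rw [Fintype.sum_prod_type, Fintype.sum_prod_type, ← Finset.sum_add_distrib]
  refine Finset.sum_le_sum fun i _ => ?_
  rw [Finset.mul_sum, ← Finset.sum_add_distrib]
  refine Finset.sum_le_sum fun j _ => ?_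
  have h0 : (0 : ℝ) ≤ #(cls f i) * #(cls f j) := by positivity
  unfold IsIrregular
  by_cases h1 : G.IsBad f d ε 1 i j <;> by_cases h2 : G.IsBad f d ε 2 i j <;>
    simp [h1, h2]
  positivity

/-- Edges not recorded by the reduced multigraph lie in irregular pairs, in pairs of density below
`d`, or inside the class itself. -/
theorem sum_pairCount_le_of_mult_lt [Fintype C] (G : StdMultigraph V) (f : V → C) {d : ℝ}
    (hd : 0 ≤ d) (ε : ℝ) (i : C) {k : ℕ} (hk : k = 1 ∨ k = 2) (S : Finset C)
    (hS : ∀ j ∈ S, (G.reduced f d ε).mult i j < k) :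
    ∑ j ∈ S, (G.pairCount k (cls f i) (cls f j) : ℝ) ≤
      #(cls f i) * (G.irregularWeight f d ε i + d * Fintype.card V + #(cls f i)) := by
  classical
  have hterm : ∀ j ∈ S, (G.pairCount k (cls f i) (cls f j) : ℝ) ≤
      #(cls f i) * ((if G.IsIrregular f d ε i j then (#(cls f j) : ℝ) else 0)
        + d * #(cls f j) + if i = j then (#(cls f j) : ℝ) else 0) := by
    intro j hj
    have hle : (G.pairCount k (cls f i) (cls f j) : ℝ) ≤ #(cls f i) * #(cls f j) := by
      exact_mod_cast G.pairCount_le k _ _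
    have hdj : 0 ≤ d * #(cls f j) := by positivity
    have hi0 : (0 : ℝ) ≤ #(cls f i) := by positivity
    by_cases h1 : G.IsIrregular f d ε i j
    · rw [if_pos h1]
      refine hle.trans (mul_le_mul_of_nonneg_left ?_ hi0)
      split_ifs <;> linarith [(Nat.cast_nonneg (#(cls f j)) : (0 : ℝ) ≤ _)]
    by_cases h2 : i = j
    · rw [if_neg h1, if_pos h2]
      exact hle.trans (mul_le_mul_of_nonneg_left (by linarith) hi0)
    have h3 := hS j hj
    simp only [reduced, h1, h2, or_self, if_false] at h3
    rw [if_neg h1, if_neg h2, zero_add, add_zero]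
    have h4 : ¬ d * (#(cls f i) * #(cls f j)) ≤ G.pairCount k (cls f i) (cls f j) := by
      rcases hk with rfl | rfl <;> split_ifs at h3 <;> simp_all
    linarith
  refine (Finset.sum_le_sum hterm).trans ?_
  rw [← Finset.mul_sum]
  refine mul_le_mul_of_nonneg_left ?_ (Nat.cast_nonneg _)
  rw [Finset.sum_add_distrib, Finset.sum_add_distrib]
  refine add_le_add (add_le_add ?_ ?_) ?_
  · rw [irregularWeight, Finset.sum_filter]
    refine Finset.sum_le_sum_of_subset_of_nonneg (Finset.subset_univ _) fun j _ _ => ?_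
    split_ifs <;> positivity
  · rw [← Finset.mul_sum]
    refine mul_le_mul_of_nonneg_left ?_ hd
    have h1 := sum_card_cls f
    have h2 : ∑ j ∈ S, #(cls f j) ≤ ∑ j, #(cls f j) :=
      Finset.sum_le_sum_of_subset (Finset.subset_univ _)
    rw [h1] at h2
    exact_mod_cast h2
  · rw [Finset.sum_ite_eq]
    split_ifs <;> simp

end Reduced

/-! ### From fractional tilings to tilings -/

section Rounding

variable {V ι : Type*} [DecidableEq ι]

theorem countP_sum_nsmul_singleton {κ : Type*} [Fintype κ] (k : κ → ℕ) (P : κ → Prop)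
    [DecidablePred P] :
    (∑ Z, k Z • ({Z} : Multiset κ)).countP P = ∑ Z with P Z, k Z := by
  rw [← Multiset.coe_countPAddMonoidHom, map_sum, Finset.sum_filter]
  refine Finset.sum_congr rfl fun Z _ => ?_
  rw [Multiset.coe_countPAddMonoidHom, Multiset.countP_nsmul, ← Multiset.cons_zero]
  by_cases h : P Z
  · rw [Multiset.countP_cons_of_pos _ h, if_pos h]; simp
  · rw [Multiset.countP_cons_of_neg _ h, if_neg h]; simp

/-- Rounding a fractional tiling of the reduced multigraph down to a tiling of `G`. -/
theorem exists_tiling_of_fractional_tiling [Fintype V] [Nonempty V] [Fintype ι]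
    (G : StdMultigraph V) (R : StdMultigraph ι) (C : ι → Finset V)
    (hC : ∀ i j, i ≠ j → Disjoint (C i) (C j)) {d ε ρ : ℝ}
    (hd : 0 < d) (hd2 : d ≤ 2) (hε : 0 < ε)
    (hreg : ∀ i j, i ≠ j → ∀ A ⊆ C i, ∀ B ⊆ C j, ε * #(C i) ≤ #A → ε * #(C j) ≤ #B →
      d / 2 * (#A * #B) ≤ G.pairCount (R.mult i j) A B) {r : ℕ} (hr : 1 ≤ r)
    (hρ : r * ε * (2 / d) ^ r ≤ ρ) {c : ℝ} (hc : 0 ≤ c) (x : Finset ι → ℝ) (hx0 : ∀ Z, 0 ≤ x Z)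
    (hx : ∀ Z, x Z ≠ 0 → R.IsNearMatched Z ∧ #Z = r)
    (hload : ∀ i, c * load x i ≤ (1 - ρ) * #(C i)) :
    ∃ 𝒯 : Tiling (KPrime r) G,
      ((𝒯.coveredᶜ).ncard : ℝ) + c * ∑ i, load x i ≤
        Fintype.card V + r * 2 ^ Fintype.card ι := by
  classical
  set k : Finset ι → ℕ := fun Z => ⌊c * x Z⌋₊ with hk
  have hkle : ∀ Z, (k Z : ℝ) ≤ c * x Z := fun Z =>
    Nat.floor_le (mul_nonneg hc (hx0 Z))
  obtain ⟨T, hT, hdisj, hcard, -⟩ := exists_disjoint_tiles G R C hC hd hd2 hε hreg hr hρ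
    (∑ Z, k Z • ({Z} : Multiset (Finset ι)))
    (fun Z hZ => by
      obtain ⟨Y, -, hY⟩ := Multiset.mem_sum.1 hZ
      have hYk : k Y ≠ 0 := by
        intro h
        rw [h, zero_smul] at hY
        exact Multiset.notMem_zero _ hY
      obtain rfl : Z = Y := Multiset.mem_singleton.1 (Multiset.mem_of_mem_nsmul hY)
      refine hx Z fun h => hYk ?_
      rw [hk]
      simp [h])
    (fun i => by
      rw [countP_sum_nsmul_singleton, Nat.cast_sum]
      refine le_trans ?_ (hload i)
      rw [load, Finset.mul_sum]
      refine le_trans (le_of_eq ?_) (Finset.sum_le_sum fun Z _ => hkle Z)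
      exact Finset.sum_congr (by ext; simp) fun _ _ => rfl)
  obtain ⟨𝒯, h𝒯⟩ := exists_tiling_of_tiles T hT hdisj
  refine ⟨𝒯, ?_⟩
  have hcard' : (#T : ℝ) = ∑ Z, (k Z : ℝ) := by
    rw [hcard, ← Nat.cast_sum]
    simp
  -- Rounding down loses less than one tile of `r` vertices for each subset of `ι`.
  have h1 : c * ∑ i, load x i ≤ r * ∑ Z, ((k Z : ℝ) + 1) := by
    rw [sum_load, Finset.mul_sum, Finset.mul_sum]
    refine Finset.sum_le_sum fun Z _ => ?_
    have h2 : c * x Z ≤ (k Z : ℝ) + 1 := (Nat.lt_floor_add_one _).le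
    by_cases h : x Z = 0
    · rw [h]
      simp only [zero_mul, mul_zero]
      positivity
    · rw [(hx Z h).2]
      have := mul_le_mul_of_nonneg_left h2 (Nat.cast_nonneg (α := ℝ) r)
      linarith
  rw [Finset.sum_add_distrib, ← hcard', Finset.sum_const, Finset.card_univ, Fintype.card_finset,
    nsmul_eq_mul, mul_one, mul_add] at h1
  have h3 : ((𝒯.coveredᶜ).ncard : ℝ) + r * #T = Fintype.card V := by exact_mod_cast h𝒯
  push_cast at h1
  linarith

end Rounding

/-! ### Discarding bad classes and transferring degrees -/

section GoodClasses

variable {V C : Type*} [Fintype V] [DecidableEq C] [Fintype C]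

/-- Small classes are few, hence light in total. By Markov's inequality the classes with much
irregularity are light too. Each kind costs at most `σ` times the number of vertices. -/
theorem sum_small_or_irregular_le (G : StdMultigraph V) (f : V → C) {d ε σ τ : ℝ} (hσ : 0 < σ) (hτ0 : 0 ≤ τ)
    (hεσ : 2 * ε ≤ σ ^ 2) (hτ : Fintype.card C * τ ≤ σ)
    (h1 : G.badWeight f d ε 1 ≤ ε * (Fintype.card V : ℝ) ^ 2)
    (h2 : G.badWeight f d ε 2 ≤ ε * (Fintype.card V : ℝ) ^ 2) (B : Finset C)
    (hB : ∀ i ∈ B, (#(cls f i) : ℝ) < τ * Fintype.card V ∨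
      σ * Fintype.card V < G.irregularWeight f d ε i) :
    ∑ i ∈ B, (#(cls f i) : ℝ) ≤ 2 * σ * Fintype.card V := by
  classical
  set n : ℝ := (Fintype.card V : ℝ) with hn
  have hn0 : 0 ≤ n := Nat.cast_nonneg _
  rcases hn0.eq_or_lt with h0 | hpos
  · have h3 : ∀ i ∈ B, (#(cls f i) : ℝ) ≤ 0 := fun i _ => by
      have : (#(cls f i) : ℝ) ≤ n := by rw [hn]; exact_mod_cast Finset.card_le_univ _
      linarith
    refine (Finset.sum_nonpos h3).trans ?_
    rw [← h0]; simp
  have hirr : ∀ i, 0 ≤ G.irregularWeight f d ε i := fun i =>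
    Finset.sum_nonneg fun _ _ => Nat.cast_nonneg _
  have hterm : ∀ i ∈ B, (#(cls f i) : ℝ) ≤
      τ * n + (#(cls f i) * G.irregularWeight f d ε i) / (σ * n) := by
    intro i hi
    have hq : 0 ≤ (#(cls f i) * G.irregularWeight f d ε i) / (σ * n) := by
      have := hirr i
      positivity
    rcases hB i hi with h | h
    · linarith
    · have : (#(cls f i) : ℝ) ≤ (#(cls f i) * G.irregularWeight f d ε i) / (σ * n) := by
        rw [le_div_iff₀ (by positivity)]
        exact mul_le_mul_of_nonneg_left h.le (Nat.cast_nonneg _)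
      have := mul_nonneg hτ0 hn0
      linarith
  refine (Finset.sum_le_sum hterm).trans ?_
  refine (Finset.sum_le_sum_of_subset_of_nonneg (Finset.subset_univ B) fun i _ _ => ?_).trans ?_
  · have := hirr i
    positivity
  rw [Finset.sum_add_distrib, Finset.sum_const, nsmul_eq_mul, ← Finset.sum_div, Finset.card_univ]
  have h3 := G.sum_irregularWeight_le f d ε
  have h4 : (∑ i, (#(cls f i) : ℝ) * G.irregularWeight f d ε i) / (σ * n) ≤ σ * n := by
    rw [div_le_iff₀ (by positivity)]
    nlinarith [sq_nonneg n]
  nlinarith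

variable {G : StdMultigraph V} {f : V → C} {d ε β θ : ℝ} {Good : Finset C}

/-- The degrees in class `i` are averaged. The loss `β` comes from edges that the reduced multigraph
does not record, the loss `θ` from discarded classes, and both occur for each of the two
multiplicities. -/
theorem sum_card_mul_gap_le (hd : 0 ≤ d)
    (hrest : ∑ i ∈ Goodᶜ, (#(cls f i) : ℝ) ≤ θ * Fintype.card V) {i : C}
    (hi : G.irregularWeight f d ε i + d * Fintype.card V + #(cls f i) ≤ β * Fintype.card V)
    (hne : (cls f i).Nonempty) {D : ℝ} (hD : ∀ v, D ≤ G.degree v) :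
    ∑ j ∈ Good, (#(cls f j) : ℝ) * ((G.reduced f d ε).gap i j : ℝ) ≤
      (2 + 2 * β + 2 * θ) * Fintype.card V - D := by
  classical
  set n : ℝ := (Fintype.card V : ℝ) with hn
  set R := G.reduced f d ε with hR
  have hci : (0 : ℝ) < #(cls f i) := by exact_mod_cast Finset.card_pos.2 hne
  have hk : ∀ k, k = 1 ∨ k = 2 → (G.pairCount k (cls f i) univ : ℝ) ≤
      #(cls f i) * (∑ j ∈ Good, (if k ≤ R.mult i j then (#(cls f j) : ℝ) else 0) + β * n + θ * n) := by
    intro k hk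
    have h1 := G.pairCount_filter_right f k (cls f i) univ
    simp only [Finset.mem_univ, Finset.filter_true] at h1
    rw [h1, Nat.cast_sum, ← Finset.sum_add_sum_compl Good,
      ← Finset.sum_filter_add_sum_filter_not Good (fun j => k ≤ R.mult i j)]
    have h2 := G.sum_pairCount_le_of_mult_lt f hd ε i hk {j ∈ Good | ¬ k ≤ R.mult i j}
      (fun j hj => not_le.1 (Finset.mem_filter.1 hj).2)
    have hle : ∀ j, (G.pairCount k (cls f i) (cls f j) : ℝ) ≤ #(cls f i) * #(cls f j) := fun j => by
      exact_mod_cast G.pairCount_le k _ _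
    have h3 : ∑ j ∈ Good with k ≤ R.mult i j, (G.pairCount k (cls f i) (cls f j) : ℝ) ≤
        #(cls f i) * ∑ j ∈ Good, (if k ≤ R.mult i j then (#(cls f j) : ℝ) else 0) := by
      rw [← Finset.sum_filter, Finset.mul_sum]
      exact Finset.sum_le_sum fun j _ => hle j
    have h4 : ∑ j ∈ Goodᶜ, (G.pairCount k (cls f i) (cls f j) : ℝ) ≤ #(cls f i) * (θ * n) := by
      refine (Finset.sum_le_sum fun j _ => hle j).trans ?_
      rw [← Finset.mul_sum]
      exact mul_le_mul_of_nonneg_left hrest hci.le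
    have h5 := h2.trans (mul_le_mul_of_nonneg_left hi hci.le)
    rw [mul_add, mul_add]
    linarith
  have hdeg : (#(cls f i) : ℝ) * D ≤
      G.pairCount 1 (cls f i) univ + G.pairCount 2 (cls f i) univ := by
    have h1 := G.sum_degree_eq (cls f i)
    have h2 : ∑ v ∈ cls f i, D ≤ ∑ v ∈ cls f i, (G.degree v : ℝ) :=
      Finset.sum_le_sum fun v _ => hD v
    rw [Finset.sum_const, nsmul_eq_mul] at h2
    refine h2.trans (le_of_eq ?_)
    exact_mod_cast h1
  have h1 := hk 1 (Or.inl rfl)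
  have h2 := hk 2 (Or.inr rfl)
  have h3 : D ≤ ∑ j ∈ Good, (if 1 ≤ R.mult i j then (#(cls f j) : ℝ) else 0)
      + ∑ j ∈ Good, (if 2 ≤ R.mult i j then (#(cls f j) : ℝ) else 0) + 2 * (β * n + θ * n) := by
    refine le_of_mul_le_mul_left ?_ hci
    linarith
  -- A multiplicity up to two is the number of thresholds `1` and `2` that it reaches, and the gap
  -- completes it to two.
  have h4 : ∑ j ∈ Good, (#(cls f j) : ℝ) * (R.gap i j : ℝ)
      + (∑ j ∈ Good, (if 1 ≤ R.mult i j then (#(cls f j) : ℝ) else 0)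
      + ∑ j ∈ Good, (if 2 ≤ R.mult i j then (#(cls f j) : ℝ) else 0))
      = 2 * ∑ j ∈ Good, (#(cls f j) : ℝ) := by
    rw [← Finset.sum_add_distrib, ← Finset.sum_add_distrib, Finset.mul_sum]
    refine Finset.sum_congr rfl fun j _ => ?_
    have h := R.le_two i j
    unfold gap
    interval_cases R.mult i j <;> norm_num <;> ring
  have h5 : ∑ j ∈ Good, (#(cls f j) : ℝ) ≤ n := by
    have := Finset.sum_le_sum_of_subset (f := fun j => #(cls f j)) (Finset.subset_univ Good)
    rw [sum_card_cls] at this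
    rw [hn]
    exact_mod_cast this
  linarith

theorem pairCount_filter_le_of_mult_lt (hd : 0 ≤ d) {S : Finset C}
    (hi : ∀ i ∈ S, G.irregularWeight f d ε i + d * Fintype.card V + #(cls f i) ≤
      β * Fintype.card V) {k : ℕ} (hk : k = 1 ∨ k = 2)
    (hS : ∀ i ∈ S, ∀ j ∈ S, (G.reduced f d ε).mult i j < k) (hβ : 0 ≤ β) :
    (G.pairCount k ({v | f v ∈ S} : Finset V) {v | f v ∈ S} : ℝ) ≤
      β * (Fintype.card V : ℝ) ^ 2 := by
  rw [pairCount_filter_right, Nat.cast_sum]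
  simp_rw [pairCount_comm G k _ (cls f _), pairCount_filter_right, Nat.cast_sum]
  have h1 : ∀ i ∈ S, ∑ j ∈ S, (G.pairCount k (cls f i) (cls f j) : ℝ) ≤
      #(cls f i) * (β * Fintype.card V) := fun i his =>
    (G.sum_pairCount_le_of_mult_lt f hd ε i hk S (hS i his)).trans
      (mul_le_mul_of_nonneg_left (hi i his) (Nat.cast_nonneg _))
  refine (Finset.sum_le_sum h1).trans ?_
  rw [← Finset.sum_mul]
  have h2 : ∑ j ∈ S, (#(cls f j) : ℝ) ≤ Fintype.card V := by
    have := Finset.sum_le_sum_of_subset (f := fun j => #(cls f j)) (Finset.subset_univ S)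
    rw [sum_card_cls] at this
    exact_mod_cast this
  refine (mul_le_mul_of_nonneg_right h2 (by positivity)).trans (le_of_eq (by ring))

end GoodClasses

/-- Since every good class has weight at least `τ`, an overload of order `δ * τ` is absorbed by
scaling down, with a share `δ / 2` left free for the greedy embedding. -/
theorem one_sub_mul_le_of_le_add {δ τ p l : ℝ} (hδ : 0 ≤ δ) (hδ1 : δ ≤ 1) (hτ : 0 ≤ τ)
    (hp : τ ≤ p) (hl : l ≤ p + δ * τ / 2) : (1 - δ) * l ≤ (1 - δ / 2) * p := by
  have h1 : δ * τ ≤ δ * p := mul_le_mul_of_nonneg_left hp hδ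
  have h2 : l ≤ (1 + δ / 2) * p := by linarith
  have h3 := mul_le_mul_of_nonneg_left h2 (by linarith : 0 ≤ 1 - δ)
  have h4 : 0 ≤ δ ^ 2 * p := mul_nonneg (sq_nonneg δ) (hτ.trans hp)
  linarith

/-! ### Extremal sets of classes lift to extremal sets of vertices -/

section Extremal

variable {V C : Type*} [Fintype V] [DecidableEq C] [Fintype C] {G : StdMultigraph V} {f : V → C}
  {r : ℕ} {γ d ε β : ℝ} {S : Finset C}

theorem exists_mult_ne_zero_of_not_isExtremal (hext : ¬ G.IsExtremal r γ) (hd : 0 ≤ d)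
    (hβ : 0 ≤ β) (hβγ : 2 * β < γ) (hpos : 0 < Fintype.card V)
    (hi : ∀ i ∈ S, G.irregularWeight f d ε i + d * Fintype.card V + #(cls f i) ≤
      β * Fintype.card V)
    (hS : |∑ i ∈ S, (#(cls f i) : ℝ) - (Fintype.card V : ℝ) / r| < γ * Fintype.card V) :
    ∃ i ∈ S, ∃ j ∈ S, (G.reduced f d ε).mult i j ≠ 0 := by
  by_contra! hno
  refine hext (Or.inl ⟨({v | f v ∈ S} : Finset V), ?_, ?_⟩)
  · rw [card_filter_mem_eq_sum]
    exact_mod_cast hS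
  · have h1 := pairCount_filter_le_of_mult_lt hd hi (Or.inl rfl)
      (fun i hi j hj => by rw [hno i hi j hj]; norm_num) hβ
    have h2 := pairCount_filter_le_of_mult_lt hd hi (Or.inr rfl)
      (fun i hi j hj => by rw [hno i hi j hj]; norm_num) hβ
    have h3 : ((G.induce ({v | f v ∈ S} : Finset V)).numEdges : ℝ) ≤ _ :=
      Nat.cast_le.2 ((numEdges_le _).trans
        (Nat.add_le_add (pairCount_induce_le _ 1 _) (pairCount_induce_le _ 2 _)))
    have h4 : 2 * β * (Fintype.card V : ℝ) ^ 2 < γ * (Fintype.card V : ℝ) ^ 2 :=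
      mul_lt_mul_of_pos_right hβγ (by positivity)
    push_cast at h3
    linarith

theorem exists_mult_eq_two_of_not_isExtremal (hext : ¬ G.IsExtremal r γ) (hd : 0 ≤ d)
    (hβ : 0 ≤ β) (hβγ : β < γ) (hpos : 0 < Fintype.card V)
    (hi : ∀ i ∈ S, G.irregularWeight f d ε i + d * Fintype.card V + #(cls f i) ≤
      β * Fintype.card V)
    (hS : |∑ i ∈ S, (#(cls f i) : ℝ) - 2 * (Fintype.card V : ℝ) / r| < γ * Fintype.card V) :
    ∃ i ∈ S, ∃ j ∈ S, (G.reduced f d ε).mult i j = 2 := by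
  by_contra! hno
  refine hext (Or.inr ⟨({v | f v ∈ S} : Finset V), ?_, ?_⟩)
  · rw [card_filter_mem_eq_sum]
    exact_mod_cast hS
  · have h2 := pairCount_filter_le_of_mult_lt hd hi (Or.inr rfl)
      (fun i hi j hj => lt_of_le_of_ne ((G.reduced f d ε).le_two i j) (hno i hi j hj)) hβ
    have h3 : ((G.induce ({v | f v ∈ S} : Finset V)).numHeavy : ℝ) ≤ _ :=
      Nat.cast_le.2 ((numHeavy_le _).trans (pairCount_induce_le _ 2 _))
    have h4 : β * (Fintype.card V : ℝ) ^ 2 < γ * (Fintype.card V : ℝ) ^ 2 :=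
      mul_lt_mul_of_pos_right hβγ (by positivity)
    linarith

end Extremal

/-! ### Assembly of the tiling -/

set_option maxHeartbeats 1000000 in
/-- The theorem with the dependencies of the parameters written as quantifiers. -/
theorem exists_almost_perfect_tiling.{u} {r : ℕ} (hr : 2 ≤ r) {γ : ℝ} (hγ : 0 < γ) :
    ∃ η > 0, ∀ α : ℝ, 0 < α → ∃ n₀ : ℕ, ∀ (V : Type u) [Fintype V] (G : StdMultigraph V),
      0 < Fintype.card V → n₀ ≤ Fintype.card V → ¬ G.IsExtremal r γ →
      2 * (1 - 1 / (r : ℝ) - η) * Fintype.card V ≤ (G.minDegree : ℝ) →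
      ∃ 𝒯 : Tiling (KPrime r) G, ((𝒯.coveredᶜ).ncard : ℝ) ≤ α * Fintype.card V := by
  classical
  obtain ⟨η', hη', hfrac⟩ := exists_near_matched_fractional_tiling hr hγ
  refine ⟨η' / 4, by positivity, fun α₀ hα₀ => ?_⟩
  obtain ⟨α, hα, hα1, hαα⟩ : ∃ α : ℝ, 0 < α ∧ α ≤ 1 ∧ α ≤ α₀ :=
    ⟨min α₀ 1, lt_min hα₀ one_pos, min_le_right _ _, min_le_left _ _⟩
  have hr0 : (0 : ℝ) < r := by exact_mod_cast (by omega : 0 < r)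
  -- `b` is the density threshold and also bounds irregularity per good class. The factor `40`
  -- leaves room for the losses `10 * b` in degrees, `6 * b` in extremality and `2 * b` in covered
  -- weight.
  obtain ⟨b, hb, hbη, hbγ, hbα⟩ : ∃ b : ℝ, 0 < b ∧ 40 * b ≤ η' ∧ 40 * b ≤ γ ∧ 40 * b ≤ α :=
    ⟨min (min η' γ) α / 40, by positivity,
      by rw [mul_div_cancel₀ _ (by norm_num)]; exact (min_le_left _ _).trans (min_le_left _ _),
      by rw [mul_div_cancel₀ _ (by norm_num)]; exact (min_le_left _ _).trans (min_le_right _ _),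
      by rw [mul_div_cancel₀ _ (by norm_num)]; exact min_le_right _ _⟩
  set δ : ℝ := α / 4 with hδ
  have hδ0 : 0 < δ := by positivity
  obtain ⟨ε, hε, hεb, hεb2, hεδ⟩ : ∃ ε : ℝ, 0 < ε ∧ ε ≤ b ∧ 2 * ε ≤ b ^ 2 ∧
      r * ε * (2 / b) ^ r ≤ δ / 2 := by
    refine ⟨min (min b (b ^ 2 / 2)) (δ / (2 * r * (2 / b) ^ r)), by positivity, ?_, ?_, ?_⟩
    · exact (min_le_left _ _).trans (min_le_left _ _)
    · linarith [(min_le_left (min b (b ^ 2 / 2)) (δ / (2 * r * (2 / b) ^ r))).trans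
        (min_le_right b (b ^ 2 / 2))]
    · have h := min_le_right (min b (b ^ 2 / 2)) (δ / (2 * r * (2 / b) ^ r))
      rw [le_div_iff₀ (by positivity)] at h
      linarith
  obtain ⟨M, n₁, hpart⟩ := exists_regular_partition hb hε
  set τ : ℝ := b / (M + 1) with hτ
  have hτ0 : 0 < τ := by positivity
  -- The second bound makes the rounding loss at most `δ * n`.
  refine ⟨max n₁ ⌈r * 2 ^ M / δ⌉₊, fun V _ G hpos hn hext hdeg => ?_⟩
  have : Nonempty V := Fintype.card_pos_iff.1 hpos
  obtain ⟨m, hm, f, hsmall, hbad1, hbad2⟩ := hpart V G ((le_max_left _ _).trans hn)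
  set n : ℝ := (Fintype.card V : ℝ) with hndef
  have hn0 : 0 < n := by rw [hndef]; exact_mod_cast hpos
  have hrM : r * 2 ^ M ≤ δ * n := by
    have h1 : r * 2 ^ M / δ ≤ n :=
      (Nat.le_ceil _).trans (by rw [hndef]; exact_mod_cast (le_max_right _ _).trans hn)
    rw [div_le_iff₀ hδ0] at h1
    linarith
  set Good : Finset (Fin m) :=
    {i | τ * n ≤ #(cls f i) ∧ G.irregularWeight f b ε i ≤ b * n} with hGood
  have hrest : ∑ i ∈ Goodᶜ, (#(cls f i) : ℝ) ≤ 2 * b * n := by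
    refine G.sum_small_or_irregular_le f hb hτ0.le hεb2 ?_ hbad1 hbad2 _ fun i hi => ?_
    · rw [Fintype.card_fin, hτ, ← mul_div_assoc, div_le_iff₀ (by positivity)]
      have : (m : ℝ) ≤ M := by exact_mod_cast hm
      nlinarith
    · by_contra! h
      exact (Finset.mem_compl.1 hi) (Finset.mem_filter.2 ⟨Finset.mem_univ _, h⟩)
  have hgood : ∀ i ∈ Good, τ * n ≤ #(cls f i) ∧ G.irregularWeight f b ε i ≤ b * n := fun i hi =>
    (Finset.mem_filter.1 hi).2
  have hβ : ∀ i ∈ Good, G.irregularWeight f b ε i + b * n + #(cls f i) ≤ 3 * b * n := by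
    intro i hi
    have h1 := hsmall i
    have h2 := mul_le_mul_of_nonneg_right hεb hn0.le
    linarith [(hgood i hi).2]
  have hne : ∀ i ∈ Good, (cls f i).Nonempty := by
    intro i hi
    have h : (0 : ℝ) < #(cls f i) := lt_of_lt_of_le (by positivity) (hgood i hi).1
    exact Finset.card_pos.1 (by exact_mod_cast h)
  set R := G.reduced f b ε with hR
  set R' := R.comap (Function.Embedding.subtype (· ∈ Good)) with hR'
  have hR'mult : ∀ i j, R'.mult i j = R.mult i j := fun _ _ => rfl
  -- Classes are weighted by their share of the vertices, because the partition need not be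
  -- equitable.
  set p : {i // i ∈ Good} → ℝ := fun i => #(cls f (i : Fin m)) / n with hp
  have hpn : ∀ i, p i * n = #(cls f (i : Fin m)) := fun i => div_mul_cancel₀ _ hn0.ne'
  have htotal : ∑ i ∈ Good, (#(cls f i) : ℝ) + ∑ i ∈ Goodᶜ, (#(cls f i) : ℝ) = n := by
    rw [Finset.sum_add_sum_compl, hndef]
    exact_mod_cast sum_card_cls f
  have hpsum : (∑ i, p i) * n = ∑ i ∈ Good, (#(cls f i) : ℝ) := by
    rw [Finset.sum_mul, ← Finset.sum_coe_sort Good]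
    exact Finset.sum_congr rfl fun i _ => hpn i
  have hplow : 1 - 2 * b ≤ ∑ i, p i := le_of_mul_le_mul_right (by linarith) hn0
  have hpup : ∑ i, p i ≤ 1 := by
    have h : 0 ≤ ∑ i ∈ Goodᶜ, (#(cls f i) : ℝ) := Finset.sum_nonneg fun _ _ => Nat.cast_nonneg _
    exact le_of_mul_le_mul_right (by linarith) hn0
  have hgap : ∀ a, ∑ i, p i * (R'.gap a i : ℝ) ≤ 2 / r + η' := by
    intro a
    have h1 := sum_card_mul_gap_le (G := G) (ε := ε) hb.le hrest (hβ a a.2) (hne a a.2)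
      (D := 2 * (1 - 1 / (r : ℝ) - η' / 4) * n)
      fun v => hdeg.trans (by exact_mod_cast G.minDegree_le_degree v)
    have h2 : (∑ i, p i * (R'.gap a i : ℝ)) * n =
        ∑ j ∈ Good, (#(cls f j) : ℝ) * (R.gap a j : ℝ) := by
      rw [Finset.sum_mul, ← Finset.sum_coe_sort Good]
      refine Finset.sum_congr rfl fun i _ => ?_
      rw [mul_right_comm, hpn]
      rfl
    refine le_of_mul_le_mul_right ?_ hn0
    rw [h2]
    refine h1.trans ?_
    have h3 : (2 : ℝ) / r = 2 * (1 / r) := by ring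
    rw [h3, ← sub_nonneg]
    have : 0 ≤ (η' / 2 - 10 * b) * n := mul_nonneg (by linarith) hn0.le
    linarith
  have hnear : ∀ (S : Finset {i // i ∈ Good}) (q : ℝ), |∑ i ∈ S, p i - q| < γ →
      |∑ i ∈ S.map (Function.Embedding.subtype _), (#(cls f i) : ℝ) - q * n| < γ * n := by
    intro S q h
    have h1 : ∑ i ∈ S.map (Function.Embedding.subtype _), (#(cls f i) : ℝ) =
        (∑ i ∈ S, p i) * n := by
      rw [Finset.sum_map, Finset.sum_mul]
      exact Finset.sum_congr rfl fun i _ => (hpn i).symm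
    rw [h1, ← sub_mul, abs_mul, abs_of_pos hn0]
    exact mul_lt_mul_of_pos_right h hn0
  have hβ' : ∀ (S : Finset {i // i ∈ Good}), ∀ i ∈ S.map (Function.Embedding.subtype _),
      G.irregularWeight f b ε i + b * n + #(cls f i) ≤ 3 * b * n := fun S i hi => by
    obtain ⟨j, -, rfl⟩ := Finset.mem_map.1 hi
    exact hβ j j.2
  obtain ⟨x, hx0, hx, hload⟩ := hfrac _ R' p (fun i => by positivity) (by linarith) hpup hgap
    (fun S hS => by
      have h1 := hnear S _ hS
      rw [one_div_mul_eq_div] at h1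
      obtain ⟨i, hi, j, hj, hij⟩ := exists_mult_ne_zero_of_not_isExtremal hext hb.le
        (by positivity) (by linarith) hpos (hβ' S) h1
      obtain ⟨i', hi', rfl⟩ := Finset.mem_map.1 hi
      obtain ⟨j', hj', rfl⟩ := Finset.mem_map.1 hj
      exact ⟨i', hi', j', hj', hij⟩)
    (fun S hS => by
      have h1 := hnear S _ hS
      rw [div_mul_eq_mul_div] at h1
      obtain ⟨i, hi, j, hj, hij⟩ := exists_mult_eq_two_of_not_isExtremal hext hb.le
        (by positivity) (by linarith) hpos (hβ' S) h1
      obtain ⟨i', hi', rfl⟩ := Finset.mem_map.1 hi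
      obtain ⟨j', hj', rfl⟩ := Finset.mem_map.1 hj
      exact ⟨i', hi', j', hj', hij⟩)
    (δ * τ / 2) (by positivity)
  obtain ⟨𝒯, h𝒯⟩ := exists_tiling_of_fractional_tiling G R' (fun i => cls f (i : Fin m))
    (fun i j hij => Finset.disjoint_left.2 fun v hi hj => hij (Subtype.ext
      ((mem_cls.1 hi).symm.trans (mem_cls.1 hj)))) hb (by linarith) hε
    (fun i j _ A hA B hB hA' hB' => G.reduced_regular f (by linarith) ε i j A hA B hB hA' hB')
    (by omega) hεδ (c := (1 - δ) * n) (mul_nonneg (by linarith) hn0.le) x hx0 hx (fun i => by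
      have h4 : τ ≤ p i := le_of_mul_le_mul_right ((hgood i i.2).1.trans_eq (hpn i).symm) hn0
      rw [← hpn i, mul_right_comm, ← mul_assoc]
      exact mul_le_mul_of_nonneg_right
        (one_sub_mul_le_of_le_add hδ0.le (by linarith) hτ0.le h4 (hload i).2) hn0.le)
  refine ⟨𝒯, ?_⟩
  have hι : Fintype.card {i // i ∈ Good} ≤ M := by
    rw [Fintype.card_coe]
    exact (Finset.card_le_univ _).trans (by rwa [Fintype.card_fin])
  have h1 : (r : ℝ) * 2 ^ Fintype.card {i // i ∈ Good} ≤ r * 2 ^ M :=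
    mul_le_mul_of_nonneg_left (pow_le_pow_right₀ (by norm_num) hι) hr0.le
  have h2 : 1 - 2 * b ≤ ∑ i, load x i :=
    hplow.trans (Finset.sum_le_sum fun i _ => (hload i).1)
  have h3 := mul_le_mul_of_nonneg_left h2 (mul_nonneg (by linarith : 0 ≤ 1 - δ) hn0.le)
  have h4 : 0 ≤ δ * b * n := by positivity
  have h5 : (2 * δ + 2 * b) * n ≤ α₀ * n := mul_le_mul_of_nonneg_right (by linarith) hn0.le
  nlinarith

end StdMultigraph

/-! ### Hierarchy functions and the final theorem -/

/-- A running minimum of `h` is monotone, and the factor `x / (1 + x)` makes it strictly so while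
keeping `f` below `x` and below `h`. -/
theorem exists_isHierarchyFunction (h : ℕ → ℝ) (hpos : ∀ k, 0 < h k) :
    ∃ f : ℝ → ℝ, IsHierarchyFunction f ∧ (∀ x, 0 < x → f x ≤ x) ∧
      ∀ x, 0 < x → ∀ j ≤ ⌈1 / x⌉₊, f x ≤ h j := by
  set H : ℕ → ℝ := fun k => (range (k + 1)).inf' nonempty_range_add_one fun j => min (h j) 1
    with hH
  have hH0 : ∀ k, 0 < H k := fun k =>
    (Finset.lt_inf'_iff _).2 fun j _ => lt_min (hpos j) one_pos
  have hHle : ∀ k, ∀ j ≤ k, H k ≤ min (h j) 1 := fun k j hj =>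
    Finset.inf'_le _ (Finset.mem_range.2 (by omega))
  have hHanti : ∀ k l, k ≤ l → H l ≤ H k := fun k l hkl =>
    Finset.le_inf' _ _ fun j hj => hHle l j (by have := Finset.mem_range.1 hj; omega)
  have hfac : ∀ x : ℝ, 0 < x → x / (1 + x) ≤ min x 1 := fun x hx =>
    le_min (div_le_self hx.le (by linarith)) ((div_le_one (by linarith)).2 (by linarith))
  refine ⟨fun x => H ⌈1 / x⌉₊ * (x / (1 + x)), ⟨?_, fun x hx => ?_⟩, fun x hx => ?_,
    fun x hx j hj => ?_⟩
  · intro x hx y hy hxy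
    have hx' : 0 < x := hx
    have hy' : 0 < y := hy
    have h1 : H ⌈1 / x⌉₊ ≤ H ⌈1 / y⌉₊ :=
      hHanti _ _ (Nat.ceil_mono (one_div_le_one_div_of_le hx' hxy.le))
    have h2 : x / (1 + x) < y / (1 + y) := by
      rw [div_lt_div_iff₀ (by linarith) (by linarith)]
      linarith
    exact mul_lt_mul' h1 h2 (by positivity) (hH0 _)
  · have := hH0 ⌈1 / x⌉₊
    positivity
  · have h1 := (hHle ⌈1 / x⌉₊ _ le_rfl).trans (min_le_right _ _)
    exact (mul_le_of_le_one_left (by positivity) h1).trans ((hfac x hx).trans (min_le_left _ _))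
  · have h1 := (hHle _ j hj).trans (min_le_left _ _)
    exact (mul_le_of_le_one_right (hH0 _).le ((hfac x hx).trans (min_le_right _ _))).trans h1

theorem StdMultigraph.IsExtremal.mono {V : Type*} [Fintype V] {G : StdMultigraph V} {r : ℕ}
    {γ γ' : ℝ} (h : G.IsExtremal r γ) (hγ : γ ≤ γ') : G.IsExtremal r γ' := by
  refine h.imp ?_ ?_ <;>
  · rintro ⟨S, h1, h2⟩
    exact ⟨S, h1.trans_le (mul_le_mul_of_nonneg_right hγ (by positivity)),
      h2.trans_le (mul_le_mul_of_nonneg_right hγ (by positivity))⟩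

theorem one_div_natCeil_le {x : ℝ} (hx : 0 < x) : 1 / (⌈1 / x⌉₊ : ℝ) ≤ x := by
  have h := Nat.le_ceil (1 / x)
  rw [div_le_iff₀ hx] at h
  rw [div_le_iff₀ (by exact_mod_cast Nat.ceil_pos.2 (by positivity : 0 < 1 / x))]
  linarith

theorem mainTheorem7 :
    ∃ f₁ f₂ f₃ f₄ : ℝ → ℝ,
      IsHierarchyFunction f₁ ∧ IsHierarchyFunction f₂ ∧
      IsHierarchyFunction f₃ ∧ IsHierarchyFunction f₄ ∧
      ∀ (n r : ℕ) (α η γ : ℝ), 0 < n → 2 ≤ r → 0 < α → 0 < η → 0 < γ →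
        1 / (n : ℝ) ≤ f₄ α → α ≤ f₃ η → η ≤ f₂ γ → γ ≤ f₁ (1 / (r : ℝ)) →
        ∀ (V : Type*) [Fintype V] (G : StdMultigraph V), Fintype.card V = n →
          ¬ G.IsExtremal r γ →
          2 * (1 - 1 / (r : ℝ) - η) * n ≤ (G.minDegree : ℝ) →
          ∃ T : StdMultigraph.Tiling (StdMultigraph.KPrime r) G,
            ((T.coveredᶜ).ncard : ℝ) ≤ α * n := by
  -- The constants are fixed on the grid of reciprocals of integers. Other values of `γ` and `α` are
  -- replaced by smaller grid points, using that being extremal is monotone in `γ`. The shift by two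
  -- encodes `2 ≤ r`.
  choose η₀ hη₀ hstep using fun (r k : ℕ) =>
    StdMultigraph.exists_almost_perfect_tiling (r := r + 2) (by omega)
      (γ := 1 / ((k : ℝ) + 1)) (by positivity)
  choose n₀ hn₀ using fun r k (m : ℕ) => hstep r k (1 / ((m : ℝ) + 1)) (by positivity)
  obtain ⟨f₁, hf₁, hf₁le, -⟩ := exists_isHierarchyFunction (fun _ => 1) fun _ => one_pos
  -- `f₂` sees `γ` but not `r`, and `f₄` sees only `α`. The chain `α ≤ η ≤ γ ≤ 1 / r` bounds the
  -- hidden parameters, so taking the worst case over a finite range suffices.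
  obtain ⟨f₂, hf₂, hf₂le, hf₂h⟩ := exists_isHierarchyFunction
    (fun N => (range (N + 1) ×ˢ range (N + 1)).inf'
      (nonempty_range_add_one.product nonempty_range_add_one) fun e => η₀ e.1 e.2)
    fun N => (Finset.lt_inf'_iff _).2 fun e _ => hη₀ e.1 e.2
  obtain ⟨f₄, hf₄, -, hf₄h⟩ := exists_isHierarchyFunction
    (fun N => 1 / (1 + ∑ e ∈ range (N + 1) ×ˢ range (N + 1) ×ˢ range (N + 1),
      (n₀ e.1 e.2.1 e.2.2 : ℝ)))
    fun N => by positivity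
  refine ⟨f₁, f₂, f₁, f₄, hf₁, hf₂, hf₁, hf₄, ?_⟩
  intro n r α η γ hn hr hα hη hγ hnα hαη hηγ hγr V _ G hV hext hdeg
  have hr0 : (0 : ℝ) < r := by exact_mod_cast (by omega : 0 < r)
  have hγr' : γ ≤ 1 / (r : ℝ) := hγr.trans (hf₁le _ (by positivity))
  have hγη : η ≤ γ := hηγ.trans (hf₂le _ hγ)
  have hαη' : α ≤ η := hαη.trans (hf₁le _ hη)
  have hrk : r ≤ ⌈1 / γ⌉₊ := by
    have h1 : (r : ℝ) ≤ 1 / γ := by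
      rw [le_div_iff₀ hr0] at hγr'
      rw [le_div_iff₀ hγ]
      linarith
    exact_mod_cast h1.trans (Nat.le_ceil _)
  have hkm : ⌈1 / γ⌉₊ ≤ ⌈1 / α⌉₊ :=
    Nat.ceil_mono (one_div_le_one_div_of_le hα (hαη'.trans hγη))
  obtain ⟨s, rfl⟩ := Nat.exists_eq_add_of_le' hr
  have hη₀' : η ≤ η₀ s ⌈1 / γ⌉₊ := by
    refine (hηγ.trans (hf₂h γ hγ _ le_rfl)).trans
      (Finset.inf'_le (fun e : ℕ × ℕ => η₀ e.1 e.2) (b := (s, ⌈1 / γ⌉₊)) ?_)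
    simp only [Finset.mem_product, Finset.mem_range]
    omega
  have hn' : n₀ s ⌈1 / γ⌉₊ ⌈1 / α⌉₊ ≤ n := by
    have h1 := hnα.trans (hf₄h α hα _ le_rfl)
    rw [one_div_le_one_div (by exact_mod_cast hn) (by positivity)] at h1
    have h2 : (n₀ s ⌈1 / γ⌉₊ ⌈1 / α⌉₊ : ℝ) ≤
        ∑ e ∈ range (⌈1 / α⌉₊ + 1) ×ˢ range (⌈1 / α⌉₊ + 1) ×ˢ range (⌈1 / α⌉₊ + 1),
          (n₀ e.1 e.2.1 e.2.2 : ℝ) := by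
      refine Finset.single_le_sum (f := fun e : ℕ × ℕ × ℕ => (n₀ e.1 e.2.1 e.2.2 : ℝ))
        (a := (s, ⌈1 / γ⌉₊, ⌈1 / α⌉₊)) (fun _ _ => Nat.cast_nonneg _) ?_
      simp only [Finset.mem_product, Finset.mem_range]
      omega
    exact_mod_cast (by linarith : (n₀ s ⌈1 / γ⌉₊ ⌈1 / α⌉₊ : ℝ) ≤ n)
  have hle : ∀ x : ℝ, 0 < x → 1 / ((⌈1 / x⌉₊ : ℝ) + 1) ≤ x := fun x hx =>
    (one_div_le_one_div_of_le (by exact_mod_cast Nat.ceil_pos.2 (by positivity : 0 < 1 / x))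
      (by linarith)).trans (one_div_natCeil_le hx)
  subst hV
  obtain ⟨T, hT⟩ := hn₀ s ⌈1 / γ⌉₊ ⌈1 / α⌉₊ V G hn hn' (fun h => hext (h.mono (hle γ hγ)))
    (le_trans (mul_le_mul_of_nonneg_right (by linarith) (Nat.cast_nonneg _)) hdeg)
  exact ⟨T, hT.trans (mul_le_mul_of_nonneg_right (hle α hα) (Nat.cast_nonneg _))⟩
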